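/- **Setting.** Let $d\ge 1$. A cube $Q\subset\mathbb{R}^d$ has sides parallel to the axes and side length $\ell(Q)>0$; $|A|$ is Lebesgue measure, $\langle f\rangle_Q=\frac1{|Q|}\int_Q f$, and $w(Q)=\int_Q w$. A weight is a positive locally integrable function on $\mathbb{R}^d$. For $1<p<\infty$, $p'=p/(p-1)$ and a weight $w$, write $w\in A_{p,p}$ if $$[w]_{A_{p,p}}=\sup_Q\langle w^p\rangle_Q^{1/p}\langle w^{-p'}\rangle_Q^{1/p'}<\infty,$$ and let $L^p_w$ be the space of complex-valued $f$ with $\|f\|_{L^p_w}=\big(\int_{\mathbb{R}^d}|fw|^p\big)^{1/p}<\infty$. Let $1<p\le q<\infty$, let $\mu\in A_{p,p}$ and $\lambda\in A_{q,q}$, and put $\alpha/d=1/p-1/q$ and $\nu=(\mu/\lambda)^{1/(1/p+1/q')}$. For $b\in L^1_{\mathrm{loc}}(\mathbb{R}^d;\mathbb{C})$ put $$\mathcal{O}_\nu^\alpha(b;Q)=\nu(Q)^{-\alpha/d}\Big(\frac1{\nu(Q)}\int_Q|b-\langle b\rangle_Q|\Big).$$ Say that $b\in\mathrm{VMO}_\nu^\alpha$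 if $\sup_Q\mathcal{O}_\nu^\alpha(b;Q)<\infty$, $$\lim_{r\to0}\sup_{\ell(Q)\le r}\mathcal{O}_\nu^\alpha(b;Q)=0,\qquad \lim_{r\to\infty}\sup_{\ell(Q)\ge r}\mathcal{O}_\nu^\alpha(b;Q)=0,$$ and $\lim_{|x|\to\infty}\mathcal{O}_\nu^\alpha(b;Q+x)=0$ for every cube $Q$. A collection $\mathscr{S}$ of cubes is sparse if for some $\gamma\in(0,1)$ there are pairwise disjoint measurable sets $E_Q\subset Q$, $Q\in\mathscr{S}$, with $|E_Q|>\gamma|Q|$. Define $$\mathcal{A}_{\mathscr{S}}f=\sum_{Q\in\mathscr{S}}\langle f\rangle_Q1_Q,\quad \mathcal{A}_{b,\mathscr{S}}f=\sum_{Q\in\mathscr{S}}|b-\langle b\rangle_Q|\langle f\rangle_Q1_Q,\quad \mathcal{A}^*_{b,\mathscr{S}}f=\sum_{Q\in\mathscr{S}}\big\langle|b-\langle b\rangle_Q|f\big\rangle_Q1_Q,$$ $$[b,\mathcal{A}_{\mathscr{S}}]f=b\,\mathcal{A}_{\mathscr{S}}f-\mathcal{A}_{\mathscr{S}}(bf).$$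 **Proposition.** Let $b\in\mathrm{VMO}_\nu^\alpha$, let $\mathscr{S}$ be a sparse collection of cubes, and for $k>0$ let $$\mathscr{S}_k=\mathscr{S}\setminus\{Q\in\mathscr{S}:\ \ell(Q)\in[k^{-1},k],\ \operatorname{dist}(Q,0)\le k\}.$$ 1. For every $f\in L^p_\mu$, the functions $f$, $bf$ and $|b-\langle b\rangle_Q|f$ are integrable over each $Q\in\mathscr{S}$, and the series defining $\mathcal{A}_{\mathscr{S}}f$, $\mathcal{A}_{\mathscr{S}}(bf)$, $\mathcal{A}_{b,\mathscr{S}}f$ and $\mathcal{A}^*_{b,\mathscr{S}}f$ converge absolutely almost everywhere. 2. For every $\varepsilon>0$ there is $k_0>0$ such that, for all $k\ge k_0$ and all $f\in L^p_\mu$, $$\|\mathcal{A}_{b,\mathscr{S}_k}f\|_{L^q_\lambda}+\|\mathcal{A}^*_{b,\mathscr{S}_k}f\|_{L^q_\lambda}\le\varepsilon\|f\|_{L^p_\mu}.$$ 3. The operators $[b,\mathcal{A}_{\mathscr{S}}]$ and $\mathcal{A}_{b,\mathscr{S}}$ are compact linear operators from $L^p_\mu$ to $L^q_\lambda$. -/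

import Mathlib

open MeasureTheory Filter Topology
open scoped ENNReal

noncomputable section

namespace BloomSparse

/-- The Euclidean space `ℝ^d`. -/
abbrev Rd (d : ℕ) := EuclideanSpace ℝ (Fin d)

/-- Cubes of `ℝ^d` with sides parallel to the axes, given by a corner and a positive side length. -/
@[ext]
structure Cube (d : ℕ) where
  corner : Rd d
  side : ℝ
  side_pos : 0 < side

namespace Cube

variable {d : ℕ}

/-- The point set of the cube: the product of the half-open intervals `[a_i, a_i + ℓ)`. -/
def toSet (Q : Cube d) : Set (Rd d) :=
  {x | ∀ i, Q.corner i ≤ x i ∧ x i < Q.corner i + Q.side}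

/-- The translated cube `Q + x`. -/
def translate (Q : Cube d) (x : Rd d) : Cube d := ⟨Q.corner + x, Q.side, Q.side_pos⟩

/-- The Euclidean distance `dist(Q, 0)`. -/
def distZero (Q : Cube d) : ℝ := Metric.infDist (0 : Rd d) Q.toSet

end Cube

variable {d : ℕ}

/-- The average `⟨f⟩_Q` of a complex function. -/
def avg (f : Rd d → ℂ) (Q : Cube d) : ℂ := ⨍ x in Q.toSet, f x

/-- The average `⟨w⟩_Q` of a function that is nonnegative, as an extended nonnegative number. -/
def avgPos (w : Rd d → ℝ) (Q : Cube d) : ℝ≥0∞ :=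
  (∫⁻ x in Q.toSet, ENNReal.ofReal (w x)) / volume Q.toSet

/-- The mass `w(Q) = ∫_Q w` of a function that is nonnegative. -/
def mass (w : Rd d → ℝ) (Q : Cube d) : ℝ≥0∞ := ∫⁻ x in Q.toSet, ENNReal.ofReal (w x)

/-- Weights: positive locally integrable functions. -/
def IsWeight (w : Rd d → ℝ) : Prop := (∀ x, 0 < w x) ∧ LocallyIntegrable w volume

/-- The rescaled weight characteristic
`[w]_{A_{p,p}} = sup_Q ⟨w ^ p⟩_Q ^ (1/p) * ⟨w ^ (-p')⟩_Q ^ (1/p')`. -/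
def appConst (p : ℝ) (w : Rd d → ℝ) : ℝ≥0∞ :=
  ⨆ Q : Cube d, avgPos (fun x => w x ^ p) Q ^ (1 / p) *
    avgPos (fun x => w x ^ (-p.conjExponent)) Q ^ (1 / p.conjExponent)

/-- The class `A_{p,p}`. -/
def MemApp (p : ℝ) (w : Rd d → ℝ) : Prop := IsWeight w ∧ appConst p w < ∞

/-- The fractional Bloom weight `ν = (μ / λ) ^ (1 / (1/p + 1/q'))`. -/
def bloomWeight (p q : ℝ) (mu lam : Rd d → ℝ) : Rd d → ℝ :=
  fun x => (mu x / lam x) ^ (1 / (1 / p + 1 / q.conjExponent))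

/-- The weighted fractional oscillation
`𝒪_ν^α(b; Q) = ν(Q) ^ (-α/d) * (ν(Q)⁻¹ * ∫_Q |b - ⟨b⟩_Q|)`. -/
def osc (α : ℝ) (nu : Rd d → ℝ) (b : Rd d → ℂ) (Q : Cube d) : ℝ≥0∞ :=
  mass nu Q ^ (-(α / d)) * ((∫⁻ x in Q.toSet, ‖b x - avg b Q‖ₑ) / mass nu Q)

/-- The space `BMO_ν^α`. -/
def MemBMO (α : ℝ) (nu : Rd d → ℝ) (b : Rd d → ℂ) : Prop :=
  LocallyIntegrable b volume ∧ (⨆ Q : Cube d, osc α nu b Q) < ∞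

/-- The space `VMO_ν^α`: functions of `BMO_ν^α` whose oscillation vanishes on small cubes, on large
cubes, and along the translates of each fixed cube. -/
structure MemVMO (α : ℝ) (nu : Rd d → ℝ) (b : Rd d → ℂ) : Prop where
  memBMO : MemBMO α nu b
  small : Tendsto (fun r : ℝ => ⨆ (Q : Cube d) (_ : Q.side ≤ r), osc α nu b Q) (𝓝[>] 0) (𝓝 0)
  large : Tendsto (fun r : ℝ => ⨆ (Q : Cube d) (_ : r ≤ Q.side), osc α nu b Q) atTop (𝓝 0)
  far : ∀ Q : Cube d, Tendsto (fun x : Rd d => osc α nu b (Q.translate x))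
    (cocompact (Rd d)) (𝓝 0)

/-- A collection of cubes is `γ`-sparse if its members have pairwise disjoint subsets `E_Q` with
`|E_Q| > γ |Q|`. -/
def IsSparseWith (γ : ℝ) (S : Set (Cube d)) : Prop :=
  ∃ E : Cube d → Set (Rd d), S.PairwiseDisjoint E ∧
    ∀ Q ∈ S, MeasurableSet (E Q) ∧ E Q ⊆ Q.toSet ∧
      ENNReal.ofReal γ * volume Q.toSet < volume (E Q)

/-- Sparse collections of cubes: `γ`-sparse for some `γ ∈ (0, 1)`. -/
def IsSparse (S : Set (Cube d)) : Prop := ∃ γ : ℝ, 0 < γ ∧ γ < 1 ∧ IsSparseWith γ S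

/-- The part `S_k` of `S`: the cubes with `ℓ(Q) ∈ [1/k, k]` and `dist(Q, 0) ≤ k` are removed. -/
def truncated (S : Set (Cube d)) (k : ℝ) : Set (Cube d) :=
  S \ {Q | Q ∈ S ∧ Q.side ∈ Set.Icc k⁻¹ k ∧ Q.distZero ≤ k}

/-- The value at `x` of the summand `⟨f⟩_Q 1_Q`. -/
def sparseTerm (f : Rd d → ℂ) (Q : Cube d) (x : Rd d) : ℂ :=
  Q.toSet.indicator (fun _ => avg f Q) x

/-- The value at `x` of the summand `|b - ⟨b⟩_Q| ⟨f⟩_Q 1_Q`. -/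
def commTerm (b f : Rd d → ℂ) (Q : Cube d) (x : Rd d) : ℂ :=
  Q.toSet.indicator (fun y => (‖b y - avg b Q‖ : ℂ) * avg f Q) x

/-- The value at `x` of the summand `⟨|b - ⟨b⟩_Q| f⟩_Q 1_Q`. -/
def commAdjTerm (b f : Rd d → ℂ) (Q : Cube d) (x : Rd d) : ℂ :=
  Q.toSet.indicator (fun _ => avg (fun y => (‖b y - avg b Q‖ : ℂ) * f y) Q) x

/-- The sparse operator `A_S f = ∑_{Q ∈ S} ⟨f⟩_Q 1_Q`. -/
def sparseOp (S : Set (Cube d)) (f : Rd d → ℂ) (x : Rd d) : ℂ := ∑' Q : S, sparseTerm f Q x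

/-- The sparse operator `A_{b,S} f = ∑_{Q ∈ S} |b - ⟨b⟩_Q| ⟨f⟩_Q 1_Q`. -/
def sparseComm (b : Rd d → ℂ) (S : Set (Cube d)) (f : Rd d → ℂ) (x : Rd d) : ℂ :=
  ∑' Q : S, commTerm b f Q x

/-- The sparse operator `A*_{b,S} f = ∑_{Q ∈ S} ⟨|b - ⟨b⟩_Q| f⟩_Q 1_Q`. -/
def sparseCommAdj (b : Rd d → ℂ) (S : Set (Cube d)) (f : Rd d → ℂ) (x : Rd d) : ℂ :=
  ∑' Q : S, commAdjTerm b f Q x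

/-- The commutator `[b, A_S] f = b A_S f - A_S (b f)`. -/
def commSparseOp (b : Rd d → ℂ) (S : Set (Cube d)) (f : Rd d → ℂ) (x : Rd d) : ℂ :=
  b x * sparseOp S f x - sparseOp S (fun y => b y * f y) x

/-- All the averages and sums in the definitions of `A_S f`, `A_S (b f)`, `A_{b,S} f` and
`A*_{b,S} f` make sense: the functions averaged are integrable over each cube, and at almost every
point the series converge absolutely. -/
def WellDefinedAt (b : Rd d → ℂ) (S : Set (Cube d)) (f : Rd d → ℂ) : Prop :=
  (∀ Q ∈ S, IntegrableOn f Q.toSet volume ∧ IntegrableOn (fun y => b y * f y) Q.toSet volume ∧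
    IntegrableOn (fun y => (‖b y - avg b Q‖ : ℂ) * f y) Q.toSet volume) ∧
  ∀ᵐ x ∂(volume : Measure (Rd d)),
    Summable (fun Q : S => ‖sparseTerm f Q x‖) ∧
    Summable (fun Q : S => ‖sparseTerm (fun y => b y * f y) Q x‖) ∧
    Summable (fun Q : S => ‖commTerm b f Q x‖) ∧
    Summable (fun Q : S => ‖commAdjTerm b f Q x‖)

/-- The measure `w ^ p dx`. The space `L^p_w`, with the norm `(∫ |f w| ^ p) ^ (1/p)`, is the `L^p`
space of this measure. -/
def powMeasure (p : ℝ) (w : Rd d → ℝ) : Measure (Rd d) :=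
  volume.withDensity fun x => ENNReal.ofReal (w x ^ p)

/-- Membership in `L^p_w`. -/
def MemLpw (p : ℝ) (w : Rd d → ℝ) (f : Rd d → ℂ) : Prop :=
  MemLp f (ENNReal.ofReal p) (powMeasure p w)

/-- The norm of `L^p_w`, as an extended nonnegative number. -/
def normLpw (p : ℝ) (w : Rd d → ℝ) (f : Rd d → ℂ) : ℝ≥0∞ :=
  eLpNorm f (ENNReal.ofReal p) (powMeasure p w)

/-- The map `A` on functions induces a compact linear operator from the Banach space `L^p_μ` to
the Banach space `L^q_λ`. -/
def IsCompactFrom (p q : ℝ) (hp : 1 < p) (hq : 1 < q) (mu lam : Rd d → ℝ)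
    (A : (Rd d → ℂ) → Rd d → ℂ) : Prop :=
  haveI : Fact (1 ≤ ENNReal.ofReal p) := ⟨ENNReal.one_le_ofReal.2 hp.le⟩
  haveI : Fact (1 ≤ ENNReal.ofReal q) := ⟨ENNReal.one_le_ofReal.2 hq.le⟩
  ∃ T : Lp ℂ (ENNReal.ofReal p) (powMeasure p mu) →L[ℂ] Lp ℂ (ENNReal.ofReal q) (powMeasure q lam),
    IsCompactOperator T ∧
      ∀ f : Lp ℂ (ENNReal.ofReal p) (powMeasure p mu), (T f : Rd d → ℂ) =ᵐ[volume] A f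

end BloomSparse

end

open BloomSparse

/-! Write `a = μ^p`, `s = μ^(-p')`, `c = λ^q`, `k = λ^(-q')` for the four measures and `f = φ s`. By
duality, a bound for `A_{b,S}` from `L^p_μ` to `L^q_λ` is a bound for the sum over `Q` of the forms
`oscForm`, that is `(φ s)(Q) / |Q| * ∫_Q |b - ⟨b⟩_Q| ψ dc`, by the norms of `φ` in `L^p(s)` and `ψ`
in `L^{q'}(c)`. For `A*_{b,S}` the form is the same with the two sides exchanged, that is with
exponents `q' ≤ p'` and the pairs `(k, c)`, `(s, a)`. So everything is proved once, for abstract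
`A_p` pairs of measures (`ApPair`).

Hölder's inequality for `ν` turns the oscillation condition into `∫_P |b - ⟨b⟩_P| ≤ ε a(P)^(1/p)
k(P)^(1/q')`. For `b` in `BMO` this holds with some finite `ε` on all cubes. For `b` in `VMO` it
holds with any prescribed `ε > 0`, except on bad cubes, whose side lies in `[1/R, R]` and whose
distance to the origin is at most `R` (`MemVMO.exists_oscInt_le`).

The central step is `exists_local_estimate`, a bound of the oscillation on one cube `Q` against the
density `ψ dc`. A stopping time argument dominates it by the integral of the largest value of `(∫_P
|b - ⟨b⟩_P| / |P|) (ψ c)(P) / c(P)` over the dyadic subcubes `P` of `Q`. On good subcubes this is at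
most `ε` times a power of `a(P) / c(P)` times an average of `ψ`. A reverse Hölder inequality for `a`
relative to `c` handles the first factor and leaves the average of `ψ` in an exponent `r` strictly
below `q'`. Because of this gain, the sum over a sparse family is controlled by a Carleson type
embedding, which rests on the maximal inequality for doubling measures.

For the truncated family, if `Q` has a bad dyadic subcube `P`, then `Q` is at least as large as `P`
and at least as close to the origin. Since `Q` survived the truncation, its side must exceed `k₀`,
and it meets a fixed cube `B₀`. The contributions of the bad subcubes are summed against
`a(Q)^(-1/p)`. The sum of `a(Q)^(-p'/p)` over the large cubes of a sparse family that meet `B₀`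
converges (`ApPair.tsum_large_ne_top`), so its tail is small.

Compactness follows: only finitely many cubes are removed by a truncation, each cube contributes an
operator of finite rank, and the rest is small in norm. The commutator reduces to both sparse
operators through `b ⟨f⟩_Q - ⟨b f⟩_Q = (b - ⟨b⟩_Q) ⟨f⟩_Q - ⟨(b - ⟨b⟩_Q) f⟩_Q`. -/

noncomputable section

namespace BloomSparse

variable {d : ℕ}

/-! ### Geometry of cubes and their dyadic descendants -/

namespace Cube

/-- The cube with the same centre, dilated by the factor `5`. -/
def dilate (Q : Cube d) : Cube d :=
  ⟨WithLp.toLp 2 fun i => Q.corner i - 2 * Q.side, 5 * Q.side, by linarith [Q.side_pos]⟩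

/-- The dyadic child of a cube chosen by `e`. -/
def child (Q : Cube d) (e : Fin d → Bool) : Cube d :=
  ⟨WithLp.toLp 2 fun i => Q.corner i + if e i then Q.side / 2 else 0, Q.side / 2,
    half_pos Q.side_pos⟩

/-- The index of the dyadic child that contains a point. -/
def childIdx (Q : Cube d) (x : Rd d) : Fin d → Bool :=
  fun i => decide (Q.corner i + Q.side / 2 ≤ x i)

/-- The dyadic subcube of `Q` of generation `n` that contains the point `x` of `Q`. -/
def desc : ℕ → Cube d → Rd d → Cube d
  | 0, Q, _ => Q
  | n + 1, Q, x => desc n (Q.child (Q.childIdx x)) x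

@[simp] lemma desc_zero (Q : Cube d) (x : Rd d) : desc 0 Q x = Q := rfl

lemma desc_succ (n : ℕ) (Q : Cube d) (x : Rd d) :
    desc (n + 1) Q x = desc n (Q.child (Q.childIdx x)) x := rfl

lemma mem_toSet {Q : Cube d} {x : Rd d} :
    x ∈ Q.toSet ↔ ∀ i, Q.corner i ≤ x i ∧ x i < Q.corner i + Q.side := Iff.rfl

lemma corner_mem (Q : Cube d) : Q.corner ∈ Q.toSet :=
  fun _ => ⟨le_rfl, lt_add_of_pos_right _ Q.side_pos⟩

lemma toSet_eq_preimage (Q : Cube d) :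
    Q.toSet = WithLp.ofLp ⁻¹' (Set.univ.pi fun i => Set.Ico (Q.corner i) (Q.corner i + Q.side)) := by
  ext x; simp [mem_toSet]

lemma measurableSet_toSet (Q : Cube d) : MeasurableSet Q.toSet := by
  rw [toSet_eq_preimage]
  exact (PiLp.volume_preserving_ofLp (Fin d)).measurable
    (MeasurableSet.univ_pi fun _ => measurableSet_Ico)

lemma volume_toSet (Q : Cube d) : volume Q.toSet = ENNReal.ofReal Q.side ^ d := by
  rw [toSet_eq_preimage, (PiLp.volume_preserving_ofLp (Fin d)).measure_preimage
    (MeasurableSet.univ_pi fun _ => measurableSet_Ico).nullMeasurableSet, volume_pi_pi]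
  simp

lemma volume_pos (Q : Cube d) : 0 < volume Q.toSet := by
  rw [volume_toSet]
  exact ENNReal.pow_pos (ENNReal.ofReal_pos.2 Q.side_pos) _

lemma volume_ne_zero (Q : Cube d) : volume Q.toSet ≠ 0 := Q.volume_pos.ne'

lemma volume_ne_top (Q : Cube d) : volume Q.toSet ≠ ∞ := by
  rw [volume_toSet]; exact ENNReal.pow_ne_top ENNReal.ofReal_ne_top

lemma mem_child_iff {Q : Cube d} {x : Rd d} (hx : x ∈ Q.toSet) (e : Fin d → Bool) :
    x ∈ (Q.child e).toSet ↔ Q.childIdx x = e := by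
  constructor
  · intro h
    ext i
    have h1 := h i
    simp only [child] at h1
    by_cases he : e i = true
    · simp only [he, if_true] at h1
      simp [childIdx, he, h1.1]
    · simp only [Bool.not_eq_true] at he
      simp only [he, Bool.false_eq_true, if_false] at h1
      simp only [childIdx, he, decide_eq_false_iff_not, not_le]
      linarith [h1.2]
  · rintro rfl i
    have h1 := hx i
    simp only [child, childIdx]
    by_cases he : Q.corner i + Q.side / 2 ≤ x i
    · simp only [he, decide_true, if_true, true_and]; linarith [h1.2]
    · simp only [he, decide_false, Bool.false_eq_true, if_false, add_zero, h1.1, true_and]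
      exact not_le.1 he

lemma mem_child_childIdx {Q : Cube d} {x : Rd d} (hx : x ∈ Q.toSet) :
    x ∈ (Q.child (Q.childIdx x)).toSet := (mem_child_iff hx _).2 rfl

lemma child_subset (Q : Cube d) (e : Fin d → Bool) : (Q.child e).toSet ⊆ Q.toSet := by
  intro x hx i
  have h1 := hx i
  have := Q.side_pos
  simp only [child] at h1
  split_ifs at h1 <;> constructor <;> linarith [h1.1, h1.2]

lemma childIdx_eq {Q : Cube d} {e : Fin d → Bool} {x : Rd d} (hx : x ∈ (Q.child e).toSet) :
    Q.childIdx x = e := (mem_child_iff (Q.child_subset e hx) e).1 hx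

lemma iUnion_child (Q : Cube d) : ⋃ e, (Q.child e).toSet = Q.toSet := by
  apply Set.Subset.antisymm (Set.iUnion_subset Q.child_subset)
  intro x hx
  exact Set.mem_iUnion.2 ⟨_, mem_child_childIdx hx⟩

lemma pairwise_disjoint_child (Q : Cube d) :
    Pairwise (Function.onFun Disjoint fun e => (Q.child e).toSet) := by
  intro e e' h
  refine Set.disjoint_left.2 fun x hx hx' => h ?_
  rw [← childIdx_eq hx, childIdx_eq hx']

lemma lintegral_eq_sum_child (m : Measure (Rd d)) (Q : Cube d) (f : Rd d → ℝ≥0∞) :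
    ∫⁻ x in Q.toSet, f x ∂m = ∑ e, ∫⁻ x in (Q.child e).toSet, f x ∂m := by
  rw [← iUnion_child, lintegral_iUnion (fun e => (Q.child e).measurableSet_toSet)
    Q.pairwise_disjoint_child, tsum_fintype]

lemma measure_eq_sum_child (m : Measure (Rd d)) (Q : Cube d) :
    m Q.toSet = ∑ e, m (Q.child e).toSet := by
  simpa using lintegral_eq_sum_child m Q 1

lemma measurable_childIdx (Q : Cube d) : Measurable Q.childIdx := by
  refine measurable_pi_iff.2 fun i => ?_
  refine measurable_to_bool ?_
  have : (fun x : Rd d => Q.childIdx x i) ⁻¹' {true} = {x | Q.corner i + Q.side / 2 ≤ x i} := by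
    ext x; simp [childIdx]
  rw [this]
  exact measurableSet_le measurable_const (by fun_prop)

/-- The point enters only through the child indices, which are measurable and take finitely many
values, so `F` may be arbitrary. -/
lemma measurable_desc {β : Type*} [MeasurableSpace β] (F : Cube d → β) (n : ℕ) (Q : Cube d) :
    Measurable fun x => F (desc n Q x) := by
  induction n generalizing Q with
  | zero => simp only [desc_zero]; exact measurable_const
  | succ n ih =>
    have h : Measurable fun z : (Fin d → Bool) × Rd d => F (desc n (Q.child z.1) z.2) :=
      measurable_from_prod_countable_right fun e => ih (Q.child e)
    exact h.comp (Q.measurable_childIdx.prodMk measurable_id)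

lemma mem_desc {Q : Cube d} {x : Rd d} (hx : x ∈ Q.toSet) (n : ℕ) : x ∈ (desc n Q x).toSet := by
  induction n generalizing Q with
  | zero => exact hx
  | succ n ih => exact ih (mem_child_childIdx hx)

lemma desc_subset (Q : Cube d) (x : Rd d) (n : ℕ) : (desc n Q x).toSet ⊆ Q.toSet := by
  induction n generalizing Q with
  | zero => exact subset_rfl
  | succ n ih => exact (ih _).trans (Q.child_subset _)

lemma side_desc (Q : Cube d) (x : Rd d) (n : ℕ) : (desc n Q x).side = Q.side / 2 ^ n := by
  induction n generalizing Q with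
  | zero => simp
  | succ n ih => rw [desc_succ, ih]; simp only [child]; rw [pow_succ]; field_simp

lemma volume_child (Q : Cube d) (e : Fin d → Bool) :
    volume Q.toSet = 2 ^ d * volume (Q.child e).toSet := by
  rw [volume_toSet, volume_toSet, ← mul_pow]
  congr 1
  simp only [child]
  rw [← ENNReal.ofReal_ofNat, ← ENNReal.ofReal_mul (by norm_num)]
  congr 1; ring

lemma subset_dilate (Q : Cube d) : Q.toSet ⊆ Q.dilate.toSet := by
  intro x hx i
  have := hx i; have := Q.side_pos
  simp only [dilate]; constructor <;> linarith

/-- A cube of side at most `2ℓ` that meets a cube of side `ℓ` sticks out by at most `2ℓ` on either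
side. This fixes the dilation factor `5 = 2 + 1 + 2`. -/
lemma subset_dilate_of_inter {P Q : Cube d} (h : (P.toSet ∩ Q.toSet).Nonempty)
    (hs : P.side ≤ 2 * Q.side) : P.toSet ⊆ Q.dilate.toSet := by
  obtain ⟨y, hP, hQ⟩ := h
  intro x hx i
  have := hx i; have := hP i; have := hQ i; have := Q.side_pos
  simp only [dilate]; constructor <;> linarith

lemma volume_dilate (Q : Cube d) : volume Q.dilate.toSet = 5 ^ d * volume Q.toSet := by
  rw [volume_toSet, volume_toSet, ← mul_pow]
  congr 1
  simp only [dilate]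
  rw [ENNReal.ofReal_mul (by norm_num), ENNReal.ofReal_ofNat]

/-- Compare volumes. In dimension zero all cubes have the same point set, so the claim needs `0 <
d`. -/
lemma side_le_of_subset (hd : 0 < d) {P Q : Cube d} (h : P.toSet ⊆ Q.toSet) : P.side ≤ Q.side := by
  have hv := measure_mono (μ := volume) h
  rw [volume_toSet, volume_toSet] at hv
  have := (ENNReal.pow_le_pow_left_iff hd.ne').1 hv
  exact (ENNReal.ofReal_le_ofReal_iff Q.side_pos.le).1 this

lemma distZero_anti {P Q : Cube d} (h : P.toSet ⊆ Q.toSet) : Q.distZero ≤ P.distZero :=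
  Metric.infDist_le_infDist_of_subset h ⟨_, P.corner_mem⟩

/-- The closed cube with the same corners. -/
def closed (Q : Cube d) : Set (Rd d) := {x | ∀ i, Q.corner i ≤ x i ∧ x i ≤ Q.corner i + Q.side}

lemma isClosed_closed (Q : Cube d) : IsClosed Q.closed := by
  simp only [closed, Set.ofPred_forall, Set.ofPred_and]
  refine isClosed_iInter fun i => IsClosed.inter ?_ ?_
  · exact isClosed_le continuous_const (by fun_prop)
  · exact isClosed_le (by fun_prop) continuous_const

lemma toSet_subset_closed (Q : Cube d) : Q.toSet ⊆ Q.closed :=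
  fun _ hx i => ⟨(hx i).1, (hx i).2.le⟩

lemma volume_closed (Q : Cube d) : volume Q.closed = volume Q.toSet := by
  have : Q.closed = WithLp.ofLp ⁻¹'
      (Set.univ.pi fun i => Set.Icc (Q.corner i) (Q.corner i + Q.side)) := by
    ext x; simp [closed, forall_and, Pi.le_def]
  rw [this, (PiLp.volume_preserving_ofLp (Fin d)).measure_preimage
    (MeasurableSet.univ_pi fun _ => measurableSet_Icc).nullMeasurableSet, volume_pi_pi,
    volume_toSet]
  simp

lemma toSet_ae_eq_closed (Q : Cube d) : Q.toSet =ᵐ[volume] Q.closed :=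
  ae_eq_of_subset_of_measure_ge Q.toSet_subset_closed Q.volume_closed.le
    Q.measurableSet_toSet.nullMeasurableSet (by rw [volume_closed]; exact Q.volume_ne_top)

lemma interior_toSet_nonempty (Q : Cube d) : (interior Q.toSet).Nonempty := by
  have ho : IsOpen {x : Rd d | ∀ i, Q.corner i < x i ∧ x i < Q.corner i + Q.side} := by
    simp only [Set.ofPred_forall, Set.ofPred_and]
    refine isOpen_iInter_of_finite fun i => IsOpen.inter ?_ ?_
    · exact isOpen_lt continuous_const (by fun_prop)
    · exact isOpen_lt (by fun_prop) continuous_const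
  refine ⟨WithLp.toLp 2 fun i => Q.corner i + Q.side / 2,
    mem_interior.2 ⟨_, fun x hx i => ⟨(hx i).1.le, (hx i).2⟩, ho, fun i => ?_⟩⟩
  have := Q.side_pos
  constructor <;> simp <;> linarith

lemma interior_closed_nonempty (Q : Cube d) : (interior Q.closed).Nonempty :=
  Q.interior_toSet_nonempty.mono (interior_mono Q.toSet_subset_closed)

lemma norm_le_of_coord {x : Rd d} {r : ℝ} (h : ∀ i, |x i| ≤ r) : ‖x‖ ≤ d * r := by
  have h1 : ‖x‖ ≤ ∑ i, |x i| := by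
    rw [EuclideanSpace.norm_eq]
    refine Real.sqrt_le_iff.2 ⟨Finset.sum_nonneg fun _ _ => abs_nonneg _, ?_⟩
    simpa using Finset.sum_sq_le_sq_sum_of_nonneg (s := Finset.univ)
      (f := fun i => |x i|) (fun _ _ => abs_nonneg _)
  refine h1.trans ((Finset.sum_le_sum fun i _ => h i).trans ?_)
  simp

lemma closed_subset_closedBall {Q : Cube d} {x : Rd d} (hx : x ∈ Q.closed) :
    Q.closed ⊆ Metric.closedBall x (d * Q.side) := by
  intro y hy
  rw [Metric.mem_closedBall, dist_eq_norm]
  refine norm_le_of_coord fun i => ?_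
  have := hx i; have := hy i
  rw [PiLp.sub_apply, abs_le]; constructor <;> linarith

lemma volume_closedBall_le (x : Rd d) {r : ℝ} (hr : 0 < r) :
    volume (Metric.closedBall x r) ≤ ENNReal.ofReal (2 * r) ^ d := by
  let Q : Cube d := ⟨WithLp.toLp 2 fun i => x i - r, 2 * r, by linarith⟩
  have : Metric.closedBall x r ⊆ Q.closed := by
    intro y hy i
    rw [Metric.mem_closedBall, dist_eq_norm] at hy
    have := (PiLp.norm_apply_le (y - x) i).trans hy
    rw [PiLp.sub_apply, Real.norm_eq_abs, abs_le] at this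
    simp only [Q]; constructor <;> linarith
  refine (measure_mono this).trans ?_
  rw [volume_closed, volume_toSet]

end Cube

/-! ### Lebesgue differentiation along dyadic subcubes -/

lemma setAverage_closed (b : Rd d → ℂ) (Q : Cube d) : ⨍ x in Q.closed, b x = avg b Q := by
  rw [avg, setAverage_congr Q.toSet_ae_eq_closed]

/-- Lebesgue's differentiation theorem along the dyadic subcubes of a cube. -/
theorem ae_tendsto_avg_desc {b : Rd d → ℂ} (hb : LocallyIntegrable b volume) (Q : Cube d) :
    ∀ᵐ x, x ∈ Q.toSet → Tendsto (fun n => avg b (Cube.desc n Q x)) atTop (𝓝 (b x)) := by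
  -- In dimension zero the radius `d * ℓ` used below degenerates to `0`; the space is then a single
  -- point.
  rcases Nat.eq_zero_or_pos d with rfl | hd
  · refine Eventually.of_forall fun x _ => ?_
    have : ∀ P : Cube 0, avg b P = b x := by
      intro P
      have h0 : ∀ y : Rd 0, b y = b x := fun y => by rw [Subsingleton.elim y x]
      simp only [avg, h0]
      exact setAverage_const P.volume_ne_zero P.volume_ne_top _
    simp [this]
  have hd' : (0 : ℝ) < d := Nat.cast_pos.2 hd
  -- The summand `3 ^ d` is the growth of balls under tripling of the radius. The summand `(6 * d) ^
  -- d` compares the ball of radius `3 * (d * ℓ)` with a cube of side `ℓ`.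
  let C : NNReal := (6 * d) ^ d + 3 ^ d
  have hC : ∀ x : Rd d, ∃ᶠ r in 𝓝[>] 0, volume (Metric.closedBall x (3 * r)) ≤
      C * volume (Metric.closedBall x r) := by
    intro x
    refine Eventually.frequently ?_
    filter_upwards [self_mem_nhdsWithin] with r hr
    have hr : 0 < r := hr
    rw [Measure.addHaar_closedBall_mul volume x (by norm_num : (0:ℝ) ≤ 3) hr.le,
      ← Measure.addHaar_closedBall_center volume x]
    gcongr
    simp only [finrank_euclideanSpace, Fintype.card_fin, C]
    rw [ENNReal.ofReal_pow (by norm_num), ENNReal.ofReal_ofNat]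
    push_cast
    exact le_add_self
  filter_upwards [(Vitali.vitaliFamily (volume : Measure (Rd d)) C hC).ae_tendsto_average hb]
    with x hx hxQ
  -- The Vitali family consists of closed sets, so the half-open cubes are replaced by their
  -- closures; averages do not change.
  have key : Tendsto (fun n => (Cube.desc n Q x).closed) atTop
      ((Vitali.vitaliFamily (volume : Measure (Rd d)) C hC).filterAt x) := by
    rw [VitaliFamily.tendsto_filterAt_iff]
    have hmem : ∀ n, x ∈ (Cube.desc n Q x).closed := fun n =>
      Cube.toSet_subset_closed _ (Cube.mem_desc hxQ n)
    refine ⟨Eventually.of_forall fun n => ⟨Cube.isClosed_closed _, Cube.interior_closed_nonempty _,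
      d * (Cube.desc n Q x).side, Cube.closed_subset_closedBall (hmem n), ?_⟩, fun ε hε => ?_⟩
    · have hs := (Cube.desc n Q x).side_pos
      refine (Cube.volume_closedBall_le x (by positivity)).trans ?_
      rw [Cube.volume_closed, Cube.volume_toSet,
        show 2 * (3 * (d * (Cube.desc n Q x).side)) = (6 * d) * (Cube.desc n Q x).side by ring,
        ENNReal.ofReal_mul (by positivity), mul_pow]
      gcongr
      simp only [C]
      push_cast
      rw [ENNReal.ofReal_mul (by norm_num), ENNReal.ofReal_ofNat, ENNReal.ofReal_natCast]
      exact le_self_add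
    · have : Tendsto (fun n : ℕ => d * (Q.side / 2 ^ n)) atTop (𝓝 (d * 0)) := by
        refine Tendsto.const_mul _ ?_
        exact tendsto_const_nhds.div_atTop (tendsto_pow_atTop_atTop_of_one_lt (by norm_num))
      rw [mul_zero] at this
      filter_upwards [this.eventually_le_const hε] with n hn
      refine (Cube.closed_subset_closedBall (hmem n)).trans (Metric.closedBall_subset_closedBall ?_)
      rwa [Cube.side_desc]
  refine (hx.comp key).congr fun n => ?_
  exact setAverage_closed b _

/-! ### Pairs of measures satisfying an `A_p` condition -/

/-- A pair of measures such as `w ^ p` and `w ^ (-p')` for a weight `w` of the class `A_{p,p}`. -/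
structure ApPair (p p' : ℝ) (K : ℝ≥0∞) (a s : Measure (Rd d)) : Prop where
  conj : p.HolderConjugate p'
  K_ne_top : K ≠ ∞
  ac_left : a ≪ volume
  ac_right : s ≪ volume
  vol_le : ∀ E, MeasurableSet E → volume E ≤ a E ^ (1 / p) * s E ^ (1 / p')
  prod_le : ∀ Q : Cube d, a Q.toSet ^ (1 / p) * s Q.toSet ^ (1 / p') ≤ K * volume Q.toSet

namespace ApPair

variable {p p' : ℝ} {K : ℝ≥0∞} {a s : Measure (Rd d)}

lemma symm (h : ApPair p p' K a s) : ApPair p' p K s a where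
  conj := h.conj.symm
  K_ne_top := h.K_ne_top
  ac_left := h.ac_right
  ac_right := h.ac_left
  vol_le E hE := by rw [mul_comm]; exact h.vol_le E hE
  prod_le Q := by rw [mul_comm]; exact h.prod_le Q

lemma ne_zero (h : ApPair p p' K a s) (Q : Cube d) : a Q.toSet ≠ 0 := by
  intro h0
  have := h.vol_le _ Q.measurableSet_toSet
  rw [h0, ENNReal.zero_rpow_of_pos (by simpa using h.conj.pos), zero_mul] at this
  exact Q.volume_ne_zero (le_zero_iff.1 this)

/-- An infinite mass would make the product in `prod_le` infinite, since the other factor is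
positive by `ne_zero`. -/
lemma ne_top (h : ApPair p p' K a s) (Q : Cube d) : a Q.toSet ≠ ∞ := by
  intro h0
  have := h.prod_le Q
  have h1 : s Q.toSet ^ (1 / p') ≠ 0 := by
    intro h2
    rw [ENNReal.rpow_eq_zero_iff] at h2
    rcases h2 with h2 | h2
    · exact h.symm.ne_zero Q h2.1
    · have := h.conj.symm.one_div_pos; linarith [h2.2]
  rw [h0, ENNReal.top_rpow_of_pos (by simpa using h.conj.pos), ENNReal.top_mul h1, top_le_iff] at this
  exact ENNReal.mul_ne_top h.K_ne_top Q.volume_ne_top this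

lemma K_ne_zero (h : ApPair p p' K a s) : K ≠ 0 := by
  rintro rfl
  let Q : Cube d := ⟨0, 1, one_pos⟩
  have := (h.vol_le _ Q.measurableSet_toSet).trans (h.prod_le Q)
  rw [zero_mul] at this
  exact Q.volume_ne_zero (le_zero_iff.1 this)

/-- The measure of a large part of a cube controls the measure of the cube. -/
lemma measure_le (h : ApPair p p' K a s) {Q : Cube d} {E : Set (Rd d)} (hE : MeasurableSet E)
    (hEQ : E ⊆ Q.toSet) {N : ℝ≥0∞} (hN : volume Q.toSet ≤ N * volume E) :
    a Q.toSet ≤ (K * N) ^ p * a E := by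
  have hp := h.conj.pos
  have hv0 : volume E ≠ 0 := by
    intro h0; rw [h0, mul_zero] at hN; exact Q.volume_ne_zero (le_zero_iff.1 hN)
  have hvt : volume E ≠ ∞ := ne_top_of_le_ne_top Q.volume_ne_top (measure_mono hEQ)
  -- Hölder's inequality on `E`, then `s E ≤ s Q`, then the `A_p` bound on `Q`; finally `volume E`
  -- cancels.
  have h1 : volume E * a Q.toSet ^ (1 / p) ≤ volume E * (K * N * a E ^ (1 / p)) := calc
    volume E * a Q.toSet ^ (1 / p) ≤ a E ^ (1 / p) * s Q.toSet ^ (1 / p') * a Q.toSet ^ (1 / p) := by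
        gcongr
        refine (h.vol_le E hE).trans ?_
        gcongr
        exact h.conj.symm.one_div_pos.le
    _ = a E ^ (1 / p) * (a Q.toSet ^ (1 / p) * s Q.toSet ^ (1 / p')) := by ring
    _ ≤ a E ^ (1 / p) * (K * (N * volume E)) := by
        refine mul_le_mul_right ((h.prod_le Q).trans (mul_le_mul_right hN _)) _
    _ = _ := by ring
  rw [ENNReal.mul_le_mul_iff_right hv0 hvt] at h1
  have h2 := ENNReal.rpow_le_rpow h1 hp.le
  rw [ENNReal.mul_rpow_of_nonneg _ _ hp.le, ← ENNReal.rpow_mul, ← ENNReal.rpow_mul] at h2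
  simpa [hp.ne'] using h2

lemma measure_dilate_le (h : ApPair p p' K a s) (Q : Cube d) :
    a Q.dilate.toSet ≤ (K * 5 ^ d) ^ p * a Q.toSet :=
  h.measure_le Q.measurableSet_toSet Q.subset_dilate Q.volume_dilate.le

lemma measure_child_le (h : ApPair p p' K a s) (Q : Cube d) (e : Fin d → Bool) :
    a Q.toSet ≤ (K * 2 ^ d) ^ p * a (Q.child e).toSet :=
  h.measure_le (Q.child e).measurableSet_toSet (Q.child_subset e) (Q.volume_child e).le

/-- A subset of a cube with small measure has small volume. -/
lemma volume_le_half (h : ApPair p p' K a s) {Q : Cube d} {E : Set (Rd d)} (hE : MeasurableSet E)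
    (hEQ : E ⊆ Q.toSet) (hs : (2 * K) ^ p * a E ≤ a Q.toSet) :
    2 * volume E ≤ volume Q.toSet := by
  have hp := h.conj.pos
  have h1 : 2 * K * a E ^ (1 / p) ≤ a Q.toSet ^ (1 / p) := by
    have h2 := ENNReal.rpow_le_rpow hs h.conj.one_div_pos.le
    rw [ENNReal.mul_rpow_of_nonneg _ _ h.conj.one_div_pos.le, ← ENNReal.rpow_mul] at h2
    simpa [hp.ne'] using h2
  -- The factor `(2 * K) ^ p` in the hypothesis is chosen so that its root absorbs the `2` here and
  -- the constant `K` of the `A_p` bound.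
  have h3 : K * (2 * volume E) ≤ K * volume Q.toSet := calc
    K * (2 * volume E) ≤ K * (2 * (a E ^ (1 / p) * s Q.toSet ^ (1 / p'))) := by
        gcongr
        refine (h.vol_le E hE).trans ?_
        gcongr
        exact h.conj.symm.one_div_pos.le
    _ = 2 * K * a E ^ (1 / p) * s Q.toSet ^ (1 / p') := by ring
    _ ≤ a Q.toSet ^ (1 / p) * s Q.toSet ^ (1 / p') := by gcongr
    _ ≤ _ := h.prod_le Q
  rwa [ENNReal.mul_le_mul_iff_right h.K_ne_zero h.K_ne_top] at h3

lemma sigmaFinite (h : ApPair p p' K a s) : SigmaFinite a := by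
  let Q : ℕ → Cube d := fun n =>
    ⟨WithLp.toLp 2 fun _ => -((n : ℝ) + 1), 2 * ((n : ℝ) + 1), by positivity⟩
  refine ⟨⟨⟨fun n => (Q n).toSet, fun _ => trivial, fun n => (h.ne_top _).lt_top, ?_⟩⟩⟩
  refine Set.eq_univ_of_forall fun x => Set.mem_iUnion.2 ?_
  obtain ⟨n, hn⟩ := exists_nat_ge ‖x‖
  refine ⟨n, fun i => ?_⟩
  have := (PiLp.norm_apply_le x i).trans hn
  rw [Real.norm_eq_abs, abs_le] at this
  simp only [Q]; constructor <;> linarith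

end ApPair

lemma volume_le_two_mul_diff {Q : Cube d} {U : Set (Rd d)} (hU : MeasurableSet U)
    (hUQ : U ⊆ Q.toSet) (h : 2 * volume U ≤ volume Q.toSet) :
    volume Q.toSet ≤ 2 * volume (Q.toSet \ U) := by
  have h3 : volume U + volume (Q.toSet \ U) = volume Q.toSet := by
    rw [measure_add_sdiff hU.nullMeasurableSet, Set.union_eq_self_of_subset_left hUQ]
  have h4 : volume Q.toSet + volume Q.toSet ≤ volume Q.toSet + 2 * volume (Q.toSet \ U) := calc
    volume Q.toSet + volume Q.toSet = 2 * volume U + 2 * volume (Q.toSet \ U) := by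
      rw [← two_mul, ← mul_add, h3]
    _ ≤ _ := by gcongr
  exact (ENNReal.add_le_add_iff_left Q.volume_ne_top).1 h4

/-! ### Maximal inequality and Carleson embedding for doubling measures -/

lemma lintegral_rpow_layercake {α : Type*} [MeasurableSpace α] (m : Measure α) {f : α → ℝ≥0∞}
    (hf : AEMeasurable f m) (hfin : ∀ᵐ x ∂m, f x ≠ ∞) {r : ℝ} (hr : 0 < r) :
    ∫⁻ x, f x ^ r ∂m =
      ENNReal.ofReal r * ∫⁻ t in Set.Ioi (0 : ℝ), m {x | ENNReal.ofReal t < f x} *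
        ENNReal.ofReal (t ^ (r - 1)) := by
  have h1 := lintegral_rpow_eq_lintegral_meas_lt_mul m (f := fun x => (f x).toReal)
    (Eventually.of_forall fun _ => ENNReal.toReal_nonneg) hf.ennreal_toReal hr
  have h2 : ∫⁻ x, f x ^ r ∂m = ∫⁻ x, ENNReal.ofReal ((f x).toReal ^ r) ∂m := by
    refine lintegral_congr_ae ?_
    filter_upwards [hfin] with x hx
    rw [← ENNReal.ofReal_rpow_of_nonneg ENNReal.toReal_nonneg hr.le, ENNReal.ofReal_toReal hx]
  rw [h2, h1]
  congr 1
  refine setLIntegral_congr_fun measurableSet_Ioi fun t ht => ?_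
  congr 1
  refine measure_congr ?_
  filter_upwards [hfin] with x hx
  exact propext (ENNReal.ofReal_lt_iff_lt_toReal (le_of_lt ht) hx).symm

/-- The constant in the maximal inequality. -/
def maxConst (D : ℝ≥0∞) (r : ℝ) : ℝ≥0∞ :=
  ENNReal.ofReal r * (2 * D) * ((ENNReal.ofReal (r - 1))⁻¹ * 2 ^ (r - 1))

lemma maxConst_ne_top {D : ℝ≥0∞} (hD : D ≠ ∞) {r : ℝ} (hr : 1 < r) : maxConst D r ≠ ∞ := by
  unfold maxConst
  refine ENNReal.mul_ne_top (ENNReal.mul_ne_top ENNReal.ofReal_ne_top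
    (ENNReal.mul_ne_top (by simp) hD)) (ENNReal.mul_ne_top ?_ ?_)
  · simpa using hr
  · exact ENNReal.rpow_ne_top_of_nonneg (by linarith) (by simp)

section Maximal

variable {m : Measure (Rd d)} {D : ℝ≥0∞}

/-- The weak type inequality for the maximal function of a doubling measure. -/
lemma measure_lt_maximal_le (hD : ∀ Q : Cube d, m Q.dilate.toSet ≤ D * m Q.toSet)
    (hfin : ∀ Q : Cube d, m Q.toSet ≠ ∞) {h G : Rd d → ℝ≥0∞} (hh : Measurable h) {R : ℝ}
    (hG : ∀ x t, t < G x → ∃ P : Cube d, x ∈ P.toSet ∧ P.side ≤ R ∧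
      t * m P.toSet < ∫⁻ y in P.toSet, h y ∂m) {t : ℝ≥0∞} (ht0 : t ≠ 0) (ht : t ≠ ∞) :
    m {x | t < G x} ≤ 2 * D / t * ∫⁻ y in {y | t < 2 * h y}, h y ∂m := by
  set A : Set (Rd d) := {y | t < 2 * h y} with hA
  have hAm : MeasurableSet A := measurableSet_lt measurable_const (hh.const_mul 2)
  -- Vitali selection with factor `2`: this is why sides must be bounded by `R`. The selected cubes
  -- are disjoint and their dilates cover the superlevel set.
  obtain ⟨u, hut, hud, hu⟩ := Vitali.exists_disjoint_subfamily_covering_enlargement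
    (fun P : Cube d => P.toSet)
    {P | P.side ≤ R ∧ t * m P.toSet < ∫⁻ y in P.toSet, h y ∂m} Cube.side 2 one_lt_two
    (fun P _ => P.side_pos.le) R (fun P hP => hP.1) (fun P _ => ⟨_, P.corner_mem⟩)
  have huc : u.Countable := hud.countable_of_nonempty_interior fun P _ => P.interior_toSet_nonempty
  have hcov : {x | t < G x} ⊆ ⋃ P ∈ u, P.dilate.toSet := by
    intro x hx
    obtain ⟨P, hxP, hPR, hP⟩ := hG x t hx
    obtain ⟨P', hP', hne, hs⟩ := hu P ⟨hPR, hP⟩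
    exact Set.mem_biUnion hP' (Cube.subset_dilate_of_inter hne hs hxP)
  -- Off `A` the function `h` is at most `t / 2`, so that part contributes at most half of `t * m P`
  -- and is absorbed.
  have hP : ∀ P ∈ u, t * m P.toSet ≤ 2 * ∫⁻ y in P.toSet, A.indicator h y ∂m := by
    intro P hP
    have h1 := (hut hP).2.le
    have h2 : ∫⁻ y in P.toSet, h y ∂m ≤
        ∫⁻ y in P.toSet, A.indicator h y ∂m + t / 2 * m P.toSet := by
      rw [← setLIntegral_const, ← lintegral_add_right _ measurable_const]
      refine lintegral_mono fun y => ?_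
      by_cases hy : y ∈ A
      · simp only [Set.indicator_of_mem hy]; exact le_self_add
      · simp only [Set.indicator_of_notMem hy, zero_add]
        have : 2 * h y ≤ t := not_lt.1 hy
        rw [ENNReal.le_div_iff_mul_le (by simp) (by simp), mul_comm]
        exact this
    have h3 : t * m P.toSet = t / 2 * m P.toSet + t / 2 * m P.toSet := by
      rw [← add_mul, ENNReal.add_halves]
    have h4 : t / 2 * m P.toSet ≤ ∫⁻ y in P.toSet, A.indicator h y ∂m := by
      have := h1.trans h2
      rw [h3] at this
      refine (ENNReal.add_le_add_iff_right ?_).1 this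
      exact ENNReal.mul_ne_top (ENNReal.div_ne_top ht (by simp)) (hfin P)
    rw [h3, two_mul]
    exact add_le_add h4 h4
  have key : t * m {x | t < G x} ≤ 2 * D * ∫⁻ y in A, h y ∂m := calc
    t * m {x | t < G x} ≤ t * ∑' P : u, m (P : Cube d).dilate.toSet := by
        gcongr
        exact (measure_mono hcov).trans (measure_biUnion_le _ huc _)
    _ ≤ t * ∑' P : u, D * m (P : Cube d).toSet := by
        gcongr with P
        exact hD P
    _ = D * ∑' P : u, t * m (P : Cube d).toSet := by
        rw [ENNReal.tsum_mul_left, ENNReal.tsum_mul_left]; ring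
    _ ≤ D * ∑' P : u, 2 * ∫⁻ y in (P : Cube d).toSet, A.indicator h y ∂m := by
        exact mul_le_mul_right (ENNReal.tsum_le_tsum fun P : u => hP P P.2) _
    _ = 2 * D * ∫⁻ y in ⋃ P ∈ u, P.toSet, A.indicator h y ∂m := by
        rw [lintegral_biUnion huc (fun P _ => P.measurableSet_toSet) hud, ENNReal.tsum_mul_left]
        ring
    _ ≤ 2 * D * ∫⁻ y, A.indicator h y ∂m := by
        gcongr
        exact Measure.restrict_le_self
    _ = _ := by rw [lintegral_indicator hAm]
  rw [← ENNReal.mul_le_mul_iff_right ht0 ht]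
  refine key.trans (le_of_eq ?_)
  rw [← mul_assoc, ENNReal.mul_div_cancel ht0 ht]

/-- Marcinkiewicz interpolation. The weak type bound only sees `h` on `{t < 2 h}`; inserted in the
layer cake formula for `G`, it leaves the layer cake formula for `2 h` with exponent `r - 1` and
measure `h dm`. -/
lemma lintegral_maximal_rpow_le_of_ne_top (hDt : D ≠ ∞)
    (hD : ∀ Q : Cube d, m Q.dilate.toSet ≤ D * m Q.toSet)
    (hfin : ∀ Q : Cube d, m Q.toSet ≠ ∞) {h G : Rd d → ℝ≥0∞} (hh : Measurable h)
    (hGm : Measurable G) (hGt : ∀ x, G x ≠ ∞) {R : ℝ}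
    (hG : ∀ x t, t < G x → ∃ P : Cube d, x ∈ P.toSet ∧ P.side ≤ R ∧
      t * m P.toSet < ∫⁻ y in P.toSet, h y ∂m) {r : ℝ} (hr : 1 < r)
    (hht : ∀ᵐ x ∂m, h x ≠ ∞) :
    ∫⁻ x, G x ^ r ∂m ≤ maxConst D r * ∫⁻ x, h x ^ r ∂m := by
  have hr1 : 0 < r - 1 := by linarith
  have hA : ∀ t : ℝ, MeasurableSet {y | ENNReal.ofReal t < 2 * h y} := fun t =>
    measurableSet_lt measurable_const (hh.const_mul 2)
  rw [lintegral_rpow_layercake m hGm.aemeasurable (Eventually.of_forall hGt) (by linarith)]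
  have h1 : ∫⁻ t in Set.Ioi (0 : ℝ), m {x | ENNReal.ofReal t < G x} * ENNReal.ofReal (t ^ (r - 1)) ≤
      ∫⁻ t in Set.Ioi (0 : ℝ), 2 * D * ((m.withDensity h) {x | ENNReal.ofReal t < 2 * h x} *
        ENNReal.ofReal (t ^ (r - 1 - 1))) := by
    refine setLIntegral_mono' measurableSet_Ioi fun t ht => ?_
    have ht : 0 < t := ht
    have h0 : ENNReal.ofReal t ≠ 0 := by simpa using ht
    rw [withDensity_apply _ (hA t)]
    calc _ ≤ 2 * D / ENNReal.ofReal t * (∫⁻ y in {y | ENNReal.ofReal t < 2 * h y}, h y ∂m) *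
          ENNReal.ofReal (t ^ (r - 1)) := by
            gcongr
            exact measure_lt_maximal_le hD hfin hh hG h0 ENNReal.ofReal_ne_top
      _ = 2 * D * ((∫⁻ y in {y | ENNReal.ofReal t < 2 * h y}, h y ∂m) *
          (ENNReal.ofReal (t ^ (r - 1)) / ENNReal.ofReal t)) := by
            rw [ENNReal.div_eq_inv_mul, ENNReal.div_eq_inv_mul]; ring
      _ = _ := by
            rw [← ENNReal.ofReal_div_of_pos ht, Real.rpow_sub_one ht.ne' (r - 1)]
  have h2 := lintegral_rpow_layercake (m.withDensity h) (f := fun x => 2 * h x)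
    (hh.const_mul 2).aemeasurable
    ((withDensity_absolutelyContinuous m h).ae_le (hht.mono fun x hx =>
      ENNReal.mul_ne_top (by simp) hx)) hr1
  have h3 : ∫⁻ x, (2 * h x) ^ (r - 1) ∂(m.withDensity h) = 2 ^ (r - 1) * ∫⁻ x, h x ^ r ∂m := by
    rw [lintegral_withDensity_eq_lintegral_mul _ hh ((hh.const_mul 2).pow_const _),
      ← lintegral_const_mul _ (hh.pow_const _)]
    refine lintegral_congr_ae ?_
    filter_upwards [hht] with x hx
    rw [Pi.mul_apply, ENNReal.mul_rpow_of_nonneg _ _ hr1.le, mul_left_comm]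
    congr 1
    rcases eq_or_ne (h x) 0 with h0 | h0
    · rw [h0, ENNReal.zero_rpow_of_pos (by linarith : 0 < r), zero_mul]
    · rw [ENNReal.rpow_sub _ _ h0 hx, ENNReal.rpow_one, ENNReal.mul_div_cancel h0 hx]
  rw [h3] at h2
  have h4 : ∫⁻ t in Set.Ioi (0 : ℝ), (m.withDensity h) {x | ENNReal.ofReal t < 2 * h x} *
        ENNReal.ofReal (t ^ (r - 1 - 1)) =
      (ENNReal.ofReal (r - 1))⁻¹ * (2 ^ (r - 1) * ∫⁻ x, h x ^ r ∂m) := by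
    rw [h2, ← mul_assoc, ENNReal.inv_mul_cancel (by simpa using hr) (by simp), one_mul]
  calc _ ≤ ENNReal.ofReal r * ∫⁻ t in Set.Ioi (0 : ℝ), 2 * D *
        ((m.withDensity h) {x | ENNReal.ofReal t < 2 * h x} *
        ENNReal.ofReal (t ^ (r - 1 - 1))) := by gcongr
    _ = ENNReal.ofReal r * (2 * D * ∫⁻ t in Set.Ioi (0 : ℝ),
        ((m.withDensity h) {x | ENNReal.ofReal t < 2 * h x} *
        ENNReal.ofReal (t ^ (r - 1 - 1)))) := by
          rw [lintegral_const_mul' _ _ (ENNReal.mul_ne_top (by simp) hDt)]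
    _ = _ := by rw [h4, maxConst]; ring

/-- The maximal inequality for a doubling measure, for a function `G` below the uncentred maximal
function of `h`. -/
theorem lintegral_maximal_rpow_le (hD0 : D ≠ 0) (hDt : D ≠ ∞)
    (hD : ∀ Q : Cube d, m Q.dilate.toSet ≤ D * m Q.toSet)
    (hfin : ∀ Q : Cube d, m Q.toSet ≠ ∞) {h G : Rd d → ℝ≥0∞} (hh : Measurable h)
    (hGm : Measurable G) (R : ℝ)
    (hG : ∀ x t, t < G x → ∃ P : Cube d, x ∈ P.toSet ∧ P.side ≤ R ∧
      t * m P.toSet < ∫⁻ y in P.toSet, h y ∂m) {r : ℝ} (hr : 1 < r) :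
    ∫⁻ x, G x ^ r ∂m ≤ maxConst D r * ∫⁻ x, h x ^ r ∂m := by
  have hr0 : 0 < r := by linarith
  have hc0 : maxConst D r ≠ 0 := by
    simp [maxConst, hr0, hD0, ENNReal.rpow_eq_zero_iff]
  rcases eq_or_ne (∫⁻ x, h x ^ r ∂m) ∞ with htop | htop
  · rw [htop, ENNReal.mul_top hc0]; exact le_top
  have hht : ∀ᵐ x ∂m, h x ≠ ∞ := by
    filter_upwards [ae_lt_top (hh.pow_const r) htop] with x hx h0
    rw [h0, ENNReal.top_rpow_of_pos hr0] at hx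
    exact hx.ne rfl
  -- The truncations `min G n` are finite and satisfy the same hypothesis, so monotone convergence
  -- removes the finiteness of `G`.
  have hmono : ∀ x, G x ^ r = ⨆ n : ℕ, (min (G x) n) ^ r := by
    intro x
    have h1 : G x = ⨆ n : ℕ, G x ⊓ (n : ℝ≥0∞) := by
      rw [← inf_iSup_eq, ENNReal.iSup_natCast, inf_top_eq]
    conv_lhs => rw [h1]
    exact (ENNReal.orderIsoRpow r hr0).map_iSup _
  simp_rw [hmono]
  rw [lintegral_iSup (fun n => (hGm.min measurable_const).pow_const r)]
  · refine iSup_le fun n => ?_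
    refine lintegral_maximal_rpow_le_of_ne_top hDt hD hfin hh (hGm.min measurable_const)
      (fun x => (min_le_right _ _).trans_lt (ENNReal.natCast_lt_top n) |>.ne) (R := R)
      (fun x t ht => hG x t (ht.trans_le (min_le_left _ _))) hr hht
  · intro n k hnk x
    simp only
    gcongr

/-- The embedding theorem for families of cubes with disjoint pieces. -/
theorem tsum_average_rpow_le (hD0 : D ≠ 0) (hDt : D ≠ ∞)
    (hD : ∀ Q : Cube d, m Q.dilate.toSet ≤ D * m Q.toSet)
    (h0 : ∀ Q : Cube d, m Q.toSet ≠ 0) (hfin : ∀ Q : Cube d, m Q.toSet ≠ ∞)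
    {h : Rd d → ℝ≥0∞} (hh : Measurable h)
    {S : Set (Cube d)} {E : Cube d → Set (Rd d)} (hE : S.PairwiseDisjoint E)
    (hEm : ∀ Q ∈ S, MeasurableSet (E Q)) (e : Cube d → Cube d)
    (hEe : ∀ Q ∈ S, E Q ⊆ (e Q).toSet) {r : ℝ} (hr : 1 < r) :
    ∑' Q : S, m (E Q) * ((∫⁻ x in (e Q).toSet, h x ∂m) / m (e Q).toSet) ^ r ≤
      maxConst D r * ∫⁻ x, h x ^ r ∂m := by
  have hr0 : 0 < r := by linarith
  rw [ENNReal.tsum_eq_iSup_sum]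
  refine iSup_le fun F => ?_
  set X : S → ℝ≥0∞ := fun Q => (∫⁻ x in (e Q).toSet, h x ∂m) / m (e Q).toSet with hX
  -- A finite subfamily has bounded sides, as the covering argument requires. On `E Q` the function
  -- `G` is at least the average over `e Q`, and it lies below the maximal function because `E Q ⊆ e
  -- Q`.
  let G : Rd d → ℝ≥0∞ := fun x => ⨆ Q ∈ F, (E (Q : Cube d)).indicator (fun _ => X Q) x
  have hGm : Measurable G := Measurable.biSup _ F.countable_toSet fun Q _ =>
    measurable_const.indicator (hEm Q Q.2)
  have hG := lintegral_maximal_rpow_le hD0 hDt hD hfin hh hGm (∑ Q ∈ F, (e Q).side) (hr := hr)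
    (fun x t ht => by
      obtain ⟨Q, hQ⟩ := lt_iSup_iff.1 ht
      obtain ⟨hQF, hQ⟩ := lt_iSup_iff.1 hQ
      have hx : x ∈ E Q := by
        by_contra hx
        rw [Set.indicator_of_notMem hx] at hQ
        exact not_lt_zero hQ
      rw [Set.indicator_of_mem hx] at hQ
      refine ⟨e Q, hEe Q Q.2 hx,
        Finset.single_le_sum (f := fun Q : S => (e Q).side) (fun Q _ => (e Q).side_pos.le) hQF, ?_⟩
      rwa [hX, ENNReal.lt_div_iff_mul_lt (Or.inl (h0 _)) (Or.inl (hfin _))] at hQ)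
  refine le_trans ?_ hG
  have hdis : (F : Set S).PairwiseDisjoint fun Q : S => E Q := fun Q _ Q' _ hne =>
    hE Q.2 Q'.2 fun h => hne (Subtype.ext h)
  calc ∑ Q ∈ F, m (E Q) * X Q ^ r ≤ ∑ Q ∈ F, ∫⁻ x in E (Q : Cube d), G x ^ r ∂m := by
        refine Finset.sum_le_sum fun Q hQ => ?_
        rw [mul_comm, ← setLIntegral_const]
        refine setLIntegral_mono' (hEm Q Q.2) fun x hx => ?_
        gcongr
        refine le_trans ?_ (le_iSup₂ (f := fun (Q : S) (_ : Q ∈ F) =>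
          (E (Q : Cube d)).indicator (fun _ => X Q) x) Q hQ)
        rw [Set.indicator_of_mem hx]
    _ = ∫⁻ x in ⋃ Q ∈ F, E (Q : Cube d), G x ^ r ∂m :=
        (lintegral_biUnion_finset hdis (fun Q _ => hEm Q Q.2) _).symm
    _ ≤ _ := setLIntegral_le_lintegral _ _

end Maximal

/-! ### Dyadic maximal values and a stopping time argument -/

namespace Cube

/-- The largest value of `Y` on the dyadic subcubes of `Q` of generations at most `n` that contain
the point `x` of `Q`. -/
def descSup (Y : Cube d → ℝ≥0∞) : ℕ → Cube d → Rd d → ℝ≥0∞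
  | 0, Q, _ => Y Q
  | n + 1, Q, x => max (Y Q) (descSup Y n (Q.child (Q.childIdx x)) x)

variable {Y : Cube d → ℝ≥0∞}

lemma descSup_zero (Q : Cube d) (x : Rd d) : descSup Y 0 Q x = Y Q := rfl

lemma descSup_succ (n : ℕ) (Q : Cube d) (x : Rd d) :
    descSup Y (n + 1) Q x = max (Y Q) (descSup Y n (Q.child (Q.childIdx x)) x) := rfl

lemma le_descSup (n : ℕ) (Q : Cube d) (x : Rd d) : Y Q ≤ descSup Y n Q x := by
  cases n with
  | zero => exact le_rfl
  | succ n => exact le_max_left _ _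

lemma measurable_descSup (n : ℕ) (Q : Cube d) : Measurable (descSup Y n Q) := by
  induction n generalizing Q with
  | zero => exact measurable_const
  | succ n ih =>
    have h : Measurable fun z : (Fin d → Bool) × Rd d => descSup Y n (Q.child z.1) z.2 :=
      measurable_from_prod_countable_right fun e => ih (Q.child e)
    exact measurable_const.max (h.comp (Q.measurable_childIdx.prodMk measurable_id))

lemma le_descSup_desc {j n : ℕ} (hj : j ≤ n) (Q : Cube d) (x : Rd d) :
    Y (desc j Q x) ≤ descSup Y n Q x := by
  induction n generalizing Q j with
  | zero => rw [Nat.le_zero.1 hj]; exact le_rfl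
  | succ n ih =>
    cases j with
    | zero => exact le_max_left _ _
    | succ j => exact (ih (Nat.le_of_succ_le_succ hj) _).trans (le_max_right _ _)

lemma exists_descSup_eq (n : ℕ) (Q : Cube d) (x : Rd d) :
    ∃ j ≤ n, descSup Y n Q x = Y (desc j Q x) := by
  induction n generalizing Q with
  | zero => exact ⟨0, le_rfl, rfl⟩
  | succ n ih =>
    obtain ⟨j, hj, h⟩ := ih (Q.child (Q.childIdx x))
    rw [descSup_succ]
    rcases max_choice (Y Q) (descSup Y n (Q.child (Q.childIdx x)) x) with h' | h'
    · exact ⟨0, zero_le, h'⟩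
    · exact ⟨j + 1, by omega, h'.trans h⟩

/-- A stopping time argument on the dyadic subcubes of bounded generation. -/
lemma exists_stopping_set_aux {m h L : Measure (Rd d)} {τ D : ℝ≥0∞} {n : ℕ}
    (hm : ∀ (P : Cube d) e, m P.toSet ≤ D * m (P.child e).toSet)
    {Φ : ℕ → Cube d → ℝ≥0∞} {Θ : ℕ → Cube d → Set (Rd d) → ℝ≥0∞}
    (h0 : ∀ P : Cube d, h P.toSet ≤ τ * m P.toSet → Φ 0 P ≤ L P.toSet)
    (hlarge : ∀ j < n, ∀ P : Cube d, τ * m P.toSet < h P.toSet →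
      h P.toSet ≤ D * τ * m P.toSet → Φ j P ≤ L P.toSet + Θ j P P.toSet)
    (hsucc : ∀ j, ∀ P : Cube d, h P.toSet ≤ τ * m P.toSet → Φ (j + 1) P ≤ ∑ e, Φ j (P.child e))
    (hΘ : ∀ j, ∀ P : Cube d, ∀ U : (Fin d → Bool) → Set (Rd d),
      (∀ e, MeasurableSet (U e) ∧ U e ⊆ (P.child e).toSet) →
      ∑ e, Θ j (P.child e) (U e) ≤ Θ (j + 1) P (⋃ e, U e)) :
    ∀ j, ∀ P : Cube d, (h P.toSet ≤ τ * m P.toSet ∧ j ≤ n) ∨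
      (h P.toSet ≤ D * τ * m P.toSet ∧ j < n) →
      ∃ U ⊆ P.toSet, MeasurableSet U ∧ τ * m U ≤ h U ∧ Φ j P ≤ L P.toSet + Θ j P U := by
  -- The set `U` is the union of the stopping cubes. A cube met during the descent is either
  -- unstopped, or is a child of an unstopped cube and then has density at most `D * τ`. In the
  -- second case the counter has dropped, so `j < n` strictly, and `hlarge` can be supplied by an
  -- outer induction on `n`.
  intro j
  induction j with
  | zero =>
    intro P hP
    by_cases hs : h P.toSet ≤ τ * m P.toSet
    · exact ⟨∅, Set.empty_subset _, MeasurableSet.empty, by simp,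
        (h0 P hs).trans le_self_add⟩
    · have hP := hP.resolve_left (fun h => hs h.1)
      exact ⟨P.toSet, subset_rfl, P.measurableSet_toSet, (not_le.1 hs).le,
        hlarge 0 hP.2 P (not_le.1 hs) hP.1⟩
  | succ j ih =>
    intro P hP
    by_cases hs : h P.toSet ≤ τ * m P.toSet
    · have hj : j < n := by rcases hP with hP | hP <;> omega
      have hch : ∀ e, ∃ U ⊆ (P.child e).toSet, MeasurableSet U ∧ τ * m U ≤ h U ∧
          Φ j (P.child e) ≤ L (P.child e).toSet + Θ j (P.child e) U := fun e => by
        refine ih _ (Or.inr ⟨?_, hj⟩)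
        refine (measure_mono (P.child_subset e)).trans (hs.trans ?_)
        calc τ * m P.toSet ≤ τ * (D * m (P.child e).toSet) := by gcongr; exact hm P e
          _ = _ := by ring
      choose U hUs hUm hU1 hU2 using hch
      have hdis : Pairwise (Function.onFun Disjoint U) := fun e e' hne =>
        (P.pairwise_disjoint_child hne).mono (hUs e) (hUs e')
      refine ⟨⋃ e, U e, Set.iUnion_subset fun e => (hUs e).trans (P.child_subset e),
        MeasurableSet.iUnion hUm, ?_, ?_⟩
      · rw [measure_iUnion hdis hUm, measure_iUnion hdis hUm, ← ENNReal.tsum_mul_left]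
        exact ENNReal.tsum_le_tsum hU1
      · refine (hsucc j P hs).trans ((Finset.sum_le_sum fun e _ => hU2 e).trans ?_)
        rw [Finset.sum_add_distrib, ← P.measure_eq_sum_child]
        gcongr
        exact hΘ j P U fun e => ⟨hUm e, hUs e⟩
    · have hP := hP.resolve_left (fun h => hs h.1)
      exact ⟨P.toSet, subset_rfl, P.measurableSet_toSet, (not_le.1 hs).le,
        hlarge _ hP.2 P (not_le.1 hs) hP.1⟩

end Cube

/-! ### Oscillation by local averages, and the reverse Hölder induction -/

open BloomSparse.Cube

/-- The integral of the mean oscillation, `∫_Q |b - ⟨b⟩_Q|`. -/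
def oscInt (b : Rd d → ℂ) (Q : Cube d) : ℝ≥0∞ := ∫⁻ x in Q.toSet, ‖b x - avg b Q‖ₑ

lemma integrableOn_cube {b : Rd d → ℂ} (hb : LocallyIntegrable b volume) (Q : Cube d) :
    IntegrableOn b Q.toSet := by
  refine IntegrableOn.mono_set (t := Q.closed) ?_ Q.toSet_subset_closed
  refine hb.integrableOn_isCompact (Metric.isCompact_of_isClosed_isBounded Q.isClosed_closed ?_)
  exact Metric.isBounded_closedBall.subset
    (closed_subset_closedBall (Q.toSet_subset_closed Q.corner_mem))

lemma enorm_avg_sub_le {b : Rd d → ℂ} {P : Cube d} (hb : IntegrableOn b P.toSet) (c₀ : ℂ) :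
    ‖avg b P - c₀‖ₑ ≤ (∫⁻ x in P.toSet, ‖b x - c₀‖ₑ) / volume P.toSet := by
  have h1 : avg b P - c₀ = ⨍ x in P.toSet, (b x - c₀) := by
    rw [avg, setAverage_eq, setAverage_eq, integral_sub hb
      (integrableOn_const P.volume_ne_top), smul_sub]
    congr 1
    rw [setIntegral_const, smul_smul, inv_mul_cancel₀, one_smul]
    exact (measureReal_ne_zero_iff P.volume_ne_top).2 P.volume_ne_zero
  rw [h1, average]
  refine (enorm_integral_le_lintegral_enorm _).trans ?_
  rw [lintegral_smul_measure, Measure.restrict_apply_univ, ENNReal.div_eq_inv_mul, smul_eq_mul]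

lemma oscInt_ne_top {b : Rd d → ℂ} {P : Cube d} (hb : IntegrableOn b P.toSet) : oscInt b P ≠ ∞ :=
  (hb.sub (integrableOn_const P.volume_ne_top (C := avg b P))).2.ne

/-- A mean oscillation on the dyadic subcubes of `Q` is controlled by local averages. -/
theorem lintegral_avg_desc_sub_le {b : Rd d → ℂ} (hb : LocallyIntegrable b volume)
    {c h : Measure (Rd d)} (hc0 : ∀ Q : Cube d, c Q.toSet ≠ 0) (hct : ∀ Q : Cube d, c Q.toSet ≠ ∞)
    {C₀ : ℝ≥0∞} (hC₀ : ∀ (Q : Cube d) (U : Set (Rd d)), MeasurableSet U → U ⊆ Q.toSet →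
      2 * volume U ≤ volume Q.toSet → c Q.toSet ≤ C₀ * c (Q.toSet \ U)) (n : ℕ) (Q : Cube d) :
    ∫⁻ x in Q.toSet, ‖avg b (desc n Q x) - avg b Q‖ₑ ∂h ≤
      2 ^ (d + 1) * C₀ * ∫⁻ x in Q.toSet,
        descSup (fun P => oscInt b P / volume P.toSet * (h P.toSet / c P.toSet)) n Q x ∂c := by
  set Y : Cube d → ℝ≥0∞ := fun P => oscInt b P / volume P.toSet * (h P.toSet / c P.toSet) with hY
  set C : ℝ≥0∞ := 2 ^ (d + 1) * C₀ with hC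
  induction n using Nat.strong_induction_on generalizing Q with
  | _ n IH =>
  -- If the oscillation vanishes, all averages over subcubes coincide. Otherwise it can be cancelled
  -- in the estimate of `volume U`.
  rcases eq_or_ne (oscInt b Q) 0 with hβ | hβ
  · have : ∫⁻ x in Q.toSet, ‖avg b (desc n Q x) - avg b Q‖ₑ ∂h = 0 := by
      rw [← nonpos_iff_eq_zero]
      refine (setLIntegral_mono' Q.measurableSet_toSet (g := fun _ => 0) fun x hx => ?_).trans
        (by simp)
      refine (enorm_avg_sub_le (integrableOn_cube hb _) _).trans ?_
      have : ∫⁻ y in (desc n Q x).toSet, ‖b y - avg b Q‖ₑ = 0 := by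
        rw [← nonpos_iff_eq_zero, ← hβ]
        exact lintegral_mono_set (desc_subset Q x n)
      rw [this, ENNReal.zero_div]
    rw [this]; exact zero_le
  have hβt := oscInt_ne_top (integrableOn_cube hb Q)
  -- Twice the mean of `|b - c₀|` over `Q`, so that the stopping cubes fill at most half of `Q`.
  set τ : ℝ≥0∞ := 2 * (oscInt b Q / volume Q.toSet) with hτ
  set c₀ := avg b Q with hc₀
  let h' : Measure (Rd d) := volume.withDensity fun x => ‖b x - c₀‖ₑ
  have hh' : ∀ P : Cube d, h' P.toSet = ∫⁻ x in P.toSet, ‖b x - c₀‖ₑ := fun P =>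
    withDensity_apply _ P.measurableSet_toSet
  have havg : ∀ (P : Cube d) (t : ℝ≥0∞), h' P.toSet ≤ t * volume P.toSet →
      ‖avg b P - c₀‖ₑ ≤ t := fun P t hP => by
    refine (enorm_avg_sub_le (integrableOn_cube hb _) _).trans ?_
    rw [← hh']
    exact ENNReal.div_le_of_le_mul hP
  have hβτ : oscInt b Q * 2 = τ * volume Q.toSet := by
    rw [hτ, mul_assoc, ENNReal.div_mul_cancel Q.volume_ne_zero Q.volume_ne_top, mul_comm]
  have hroot : h' Q.toSet ≤ τ * volume Q.toSet := by
    rw [← hβτ, hh']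
    exact le_mul_of_one_le_right' (by norm_num)
  -- Stop at the cubes where the mean of `|b - c₀|` exceeds `τ`. If the descent ends unstopped, the
  -- last average is within `τ` of `c₀`. On a stopping cube the average is within `2 ^ d * τ` of
  -- `c₀`, and the oscillation inside it, over fewer generations, falls under the induction
  -- hypothesis.
  obtain ⟨U, hUQ, hUm, hU1, hU2⟩ := exists_stopping_set_aux (m := volume) (h := h')
    (L := (2 ^ d * τ) • h) (τ := τ) (D := 2 ^ d) (n := n) (fun P e => (P.volume_child e).le)
    (Φ := fun j P => ∫⁻ x in P.toSet, ‖avg b (desc j P x) - c₀‖ₑ ∂h)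
    (Θ := fun j P U => C * ∫⁻ x in U, descSup Y j P x ∂c)
    (fun P hP => by
      simp only [desc_zero, lintegral_const, Measure.restrict_apply_univ, Measure.smul_apply,
        smul_eq_mul]
      gcongr
      refine (havg P τ hP).trans (le_mul_of_one_le_left' ?_)
      exact one_le_pow₀ (by norm_num))
    (fun j hj P _ hP => by
      have h1 : ∀ x, ‖avg b (desc j P x) - c₀‖ₑ ≤
          ‖avg b P - c₀‖ₑ + ‖avg b (desc j P x) - avg b P‖ₑ := fun x => by
        rw [show avg b (desc j P x) - c₀ = (avg b P - c₀) + (avg b (desc j P x) - avg b P) by ring]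
        exact enorm_add_le _ _
      refine (lintegral_mono fun x => h1 x).trans ?_
      rw [lintegral_add_left measurable_const]
      refine add_le_add ?_ (IH j hj P)
      rw [setLIntegral_const, Measure.smul_apply, smul_eq_mul]
      gcongr
      exact havg P _ hP)
    (fun j P _ => by
      refine le_of_eq ?_
      rw [lintegral_eq_sum_child]
      refine Finset.sum_congr rfl fun e _ => ?_
      refine setLIntegral_congr_fun (P.child e).measurableSet_toSet fun x hx => ?_
      simp only [desc_succ, childIdx_eq hx])
    (fun j P U hU => by
      rw [← Finset.mul_sum]
      gcongr
      rw [lintegral_iUnion (fun e => (hU e).1) (fun e e' hne =>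
        (P.pairwise_disjoint_child hne).mono (hU e).2 (hU e').2), tsum_fintype]
      refine Finset.sum_le_sum fun e _ => setLIntegral_mono' (hU e).1 fun x hx => ?_
      rw [descSup_succ, childIdx_eq ((hU e).2 hx)]
      exact le_max_right _ _)
    n Q (Or.inl ⟨hroot, le_rfl⟩)
  have hUhalf : 2 * volume U ≤ volume Q.toSet := by
    have h1 : τ * volume U ≤ oscInt b Q := by
      refine hU1.trans ((measure_mono hUQ).trans ?_)
      rw [hh', oscInt]
    rw [hτ] at h1
    have h2 : oscInt b Q * (2 * volume U) ≤ oscInt b Q * volume Q.toSet := by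
      calc oscInt b Q * (2 * volume U) =
          (2 * (oscInt b Q / volume Q.toSet) * volume U) * volume Q.toSet := by
            rw [ENNReal.div_eq_inv_mul]
            have := ENNReal.inv_mul_cancel Q.volume_ne_zero Q.volume_ne_top
            calc _ = (volume Q.toSet)⁻¹ * volume Q.toSet * (oscInt b Q * (2 * volume U)) := by
                  rw [this, one_mul]
              _ = _ := by ring
        _ ≤ _ := by gcongr
    rwa [ENNReal.mul_le_mul_iff_right hβ hβt] at h2
  refine hU2.trans ?_
  -- The error `2 ^ d * τ * h Q` equals `2 ^ (d + 1) * Y Q * c Q` and is charged to `Q \ U`, which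
  -- keeps a fixed share of `c Q`. The integrals over `U` and `Q \ U` then add up, and the constant
  -- does not grow with `n`.
  have h3 : (2 ^ d * τ) * h Q.toSet ≤ C * ∫⁻ x in Q.toSet \ U, descSup Y n Q x ∂c := calc
    (2 ^ d * τ) * h Q.toSet = 2 ^ (d + 1) * Y Q * c Q.toSet := by
        simp only [hY, hτ]
        have := ENNReal.div_mul_cancel (hc0 Q) (hct Q) (b := h Q.toSet)
        calc _ = 2 ^ (d + 1) * (oscInt b Q / volume Q.toSet) * (h Q.toSet) := by ring
          _ = 2 ^ (d + 1) * (oscInt b Q / volume Q.toSet) *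
            (h Q.toSet / c Q.toSet * c Q.toSet) := by rw [this]
          _ = _ := by ring
    _ ≤ 2 ^ (d + 1) * Y Q * (C₀ * c (Q.toSet \ U)) := by
        gcongr
        exact hC₀ Q U hUm hUQ hUhalf
    _ = C * (Y Q * c (Q.toSet \ U)) := by rw [hC]; ring
    _ = C * ∫⁻ x in Q.toSet \ U, Y Q ∂c := by rw [setLIntegral_const]
    _ ≤ _ := by
        gcongr with x
        exact le_descSup n Q x
  rw [Measure.smul_apply, smul_eq_mul]
  refine (add_le_add_left h3 _).trans ?_
  rw [← mul_add, add_comm]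
  gcongr
  have h4 : Q.toSet ∩ U = U := Set.inter_eq_right.2 hUQ
  rw [← lintegral_inter_add_sdiff _ Q.toSet hUm, h4]

/-- The reverse Hölder inequality with a given exponent `1 + η`. -/
theorem lintegral_descSup_rpow_le {a c : Measure (Rd d)}
    (hc0 : ∀ Q : Cube d, c Q.toSet ≠ 0) (hct : ∀ Q : Cube d, c Q.toSet ≠ ∞)
    (ha0 : ∀ Q : Cube d, a Q.toSet ≠ 0) (hat : ∀ Q : Cube d, a Q.toSet ≠ ∞)
    {D A ρ ρ' : ℝ≥0∞} (hD : ∀ (P : Cube d) e, c P.toSet ≤ D * c (P.child e).toSet)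
    (hA1 : 1 ≤ A)
    (hA : ∀ (Q : Cube d) (U : Set (Rd d)), MeasurableSet U → U ⊆ Q.toSet →
      A * c U ≤ c Q.toSet → a U ≤ ρ * a Q.toSet)
    {η : ℝ} (hη : 0 < η) (hρ : (D * A) ^ η * ρ ≤ ρ') (hρ' : ρ' < 1) (n : ℕ) (Q : Cube d) :
    ∫⁻ x in Q.toSet, descSup (fun P => a P.toSet / c P.toSet) n Q x ^ (1 + η) ∂c ≤
      A ^ (1 + η) / (1 - ρ') * (c Q.toSet * (a Q.toSet / c Q.toSet) ^ (1 + η)) := by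
  have hs : 0 < 1 + η := by linarith
  set X : Cube d → ℝ≥0∞ := fun P => a P.toSet / c P.toSet with hX
  have hXc : ∀ P : Cube d, X P * c P.toSet = a P.toSet := fun P =>
    ENNReal.div_mul_cancel (hc0 P) (hct P)
  have hX0 : ∀ P, X P ≠ 0 := fun P => ENNReal.div_ne_zero.2 ⟨ha0 P, hct P⟩
  have hXt : ∀ P, X P ≠ ∞ := fun P => ENNReal.div_ne_top (hat P) (hc0 P)
  have hXs : ∀ P, X P ^ (1 + η) = X P * X P ^ η := fun P => by
    rw [ENNReal.rpow_add _ _ (hX0 P) (hXt P), ENNReal.rpow_one]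
  -- The fixed point of `C ↦ A ^ (1 + η) + C * ρ'`, so that the induction on `n` reproduces the same
  -- constant.
  set C : ℝ≥0∞ := A ^ (1 + η) / (1 - ρ') with hC
  have hCρ : A ^ (1 + η) + C * ρ' = C := by
    have h1 : 1 - ρ' ≠ 0 := (tsub_pos_of_lt hρ').ne'
    have h2 : A ^ (1 + η) = C * (1 - ρ') := by
      rw [hC, ENNReal.div_mul_cancel h1 (ne_top_of_le_ne_top ENNReal.one_ne_top tsub_le_self)]
    rw [h2, ← mul_add, tsub_add_cancel_of_le hρ'.le, mul_one]
  induction n using Nat.strong_induction_on generalizing Q with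
  | _ n IH =>
  set τ : ℝ≥0∞ := A * X Q with hτ
  have hroot : a Q.toSet ≤ τ * c Q.toSet := by
    rw [hτ, mul_assoc, hXc]
    exact le_mul_of_one_le_left' hA1
  -- Stop where `a / c` exceeds `A * X Q`. A stopping cube still has `X P ≤ D * τ`, so the induction
  -- hypothesis bounds its share by `C * (D * τ) ^ η * a P`, which is additive over disjoint cubes.
  obtain ⟨U, hUQ, hUm, hU1, hU2⟩ := exists_stopping_set_aux (m := c) (h := a)
    (L := τ ^ (1 + η) • c) (τ := τ) (D := D) (n := n) hD
    (Φ := fun j P => ∫⁻ x in P.toSet, max τ (descSup X j P x) ^ (1 + η) ∂c)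
    (Θ := fun j P U => C * (D * τ) ^ η * a U)
    (fun P hP => by
      have : X P ≤ τ := ENNReal.div_le_of_le_mul hP
      simp only [descSup_zero, max_eq_left this]
      rw [setLIntegral_const, Measure.smul_apply, smul_eq_mul])
    (fun j hj P hlt hP => by
      have h1 : τ ≤ X P := by
        rw [hX, ENNReal.le_div_iff_mul_le (Or.inl (hc0 P)) (Or.inl (hct P))]; exact hlt.le
      have h2 : X P ≤ D * τ := ENNReal.div_le_of_le_mul hP
      simp only [fun x => max_eq_right (h1.trans (le_descSup j P x))]
      refine ((IH j hj P).trans ?_).trans le_add_self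
      change C * (c P.toSet * X P ^ (1 + η)) ≤ _
      rw [hXs, ← hXc P, mul_assoc]
      refine mul_le_mul_right ?_ C
      calc c P.toSet * (X P * X P ^ η) = X P ^ η * (X P * c P.toSet) := by ring
        _ ≤ _ := by gcongr)
    (fun j P hP => by
      have h1 : X P ≤ τ := ENNReal.div_le_of_le_mul hP
      refine le_of_eq ?_
      rw [lintegral_eq_sum_child]
      refine Finset.sum_congr rfl fun e _ => ?_
      refine setLIntegral_congr_fun (P.child e).measurableSet_toSet fun x hx => ?_
      simp only [descSup_succ, childIdx_eq hx, ← max_assoc, max_eq_left h1])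
    (fun j P U hU => by
      rw [← Finset.mul_sum, measure_iUnion (fun e e' hne =>
        (P.pairwise_disjoint_child hne).mono (hU e).2 (hU e').2) (fun e => (hU e).1),
        tsum_fintype])
    n Q (Or.inl ⟨hroot, le_rfl⟩)
  have hUa : a U ≤ ρ * a Q.toSet := by
    refine hA Q U hUm hUQ ?_
    have h1 : X Q * (A * c U) ≤ X Q * c Q.toSet := calc
      X Q * (A * c U) = τ * c U := by rw [hτ]; ring
      _ ≤ a U := hU1
      _ ≤ a Q.toSet := measure_mono hUQ
      _ = _ := (hXc Q).symm
    rwa [ENNReal.mul_le_mul_iff_right (hX0 Q) (hXt Q)] at h1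
  calc ∫⁻ x in Q.toSet, descSup X n Q x ^ (1 + η) ∂c
      ≤ ∫⁻ x in Q.toSet, max τ (descSup X n Q x) ^ (1 + η) ∂c := by
        gcongr with x
        exact le_max_right _ _
    _ ≤ τ ^ (1 + η) * c Q.toSet + C * (D * τ) ^ η * (ρ * a Q.toSet) := by
        refine hU2.trans ?_
        rw [Measure.smul_apply, smul_eq_mul]
        gcongr
    _ = A ^ (1 + η) * (c Q.toSet * X Q ^ (1 + η)) +
          C * ((D * A) ^ η * ρ) * (c Q.toSet * X Q ^ (1 + η)) := by
        rw [hτ, ENNReal.mul_rpow_of_nonneg _ _ hs.le, ← mul_assoc D A,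
          ENNReal.mul_rpow_of_nonneg _ _ hη.le, ← hXc Q, hXs Q]
        ring
    _ ≤ A ^ (1 + η) * (c Q.toSet * X Q ^ (1 + η)) +
          C * ρ' * (c Q.toSet * X Q ^ (1 + η)) := by gcongr
    _ = _ := by rw [← add_mul, hCρ]

/-- As `η` decreases to `0`, `B ^ η` tends to `1`. This selects the exponent of the reverse Hölder
inequality. -/
lemma ENNReal.exists_rpow_mul_le {B ρ ρ' : ℝ≥0∞} (hB1 : 1 ≤ B) (hB : B ≠ ∞) (h : ρ < ρ')
    (hρ' : ρ' ≠ ∞) : ∃ η : ℝ, 0 < η ∧ B ^ η * ρ ≤ ρ' := by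
  lift B to NNReal using hB
  lift ρ' to NNReal using hρ'
  lift ρ to NNReal using h.ne_top
  have hB0 : (B : ℝ) ≠ 0 := by
    have : 1 ≤ B := by exact_mod_cast hB1
    exact_mod_cast (zero_lt_one.trans_le this).ne'
  have h1 : Tendsto (fun η : ℝ => (B : ℝ) ^ η * ρ) (𝓝[>] 0) (𝓝 ((B : ℝ) ^ (0 : ℝ) * ρ)) :=
    (((Real.continuous_const_rpow hB0).tendsto 0).mono_left nhdsWithin_le_nhds).mul_const _
  rw [Real.rpow_zero, one_mul] at h1
  have h2 : (ρ : ℝ) < ρ' := by exact_mod_cast h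
  obtain ⟨η, hη, hη0⟩ := ((h1.eventually_le_const h2).and self_mem_nhdsWithin).exists
  refine ⟨η, hη0, ?_⟩
  rw [← ENNReal.coe_rpow_of_nonneg _ (le_of_lt hη0)]
  exact_mod_cast hη

/-! ### Reverse Hölder inequality and the estimate on one cube -/

section Local

variable {p p' q q' : ℝ} {K : ℝ≥0∞} {a s c k : Measure (Rd d)}

/-- The reverse Hölder inequality for a measure of class `A_∞` relative to another one. -/
theorem exists_reverseHolder (hA : ApPair p p' K a s) (hC : ApPair q q' K c k) :
    ∃ η : ℝ, 0 < η ∧ ∃ C : ℝ≥0∞, C ≠ ∞ ∧ ∀ (n : ℕ) (Q : Cube d),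
      ∫⁻ x in Q.toSet, descSup (fun P => a P.toSet / c P.toSet) n Q x ^ (1 + η) ∂c ≤
        C * (c Q.toSet * (a Q.toSet / c Q.toSet) ^ (1 + η)) := by
  have hKt := hA.K_ne_top
  have htop : ∀ {t r : ℝ≥0∞} {x : ℝ}, t ≠ ∞ → r ≠ ∞ → 0 ≤ x → (t * r) ^ x ≠ ∞ :=
    fun ht hr hx => ENNReal.rpow_ne_top_of_nonneg hx (ENNReal.mul_ne_top ht hr)
  set M : ℝ≥0∞ := (K * 2) ^ p with hM
  have hMt : M ≠ ∞ := htop hKt (by simp) hA.conj.nonneg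
  set A : ℝ≥0∞ := max 1 ((2 * K) ^ q) with hAdef
  have hAt : A ≠ ∞ := by
    exact (max_lt ENNReal.one_lt_top (htop (by simp) hKt hC.conj.nonneg).lt_top).ne
  set D : ℝ≥0∞ := max 1 ((K * 2 ^ d) ^ q) with hDdef
  have hDt : D ≠ ∞ := by
    exact (max_lt ENNReal.one_lt_top (htop hKt (by simp) hC.conj.nonneg).lt_top).ne
  have hρ1 : 1 - M⁻¹ < 1 :=
    ENNReal.sub_lt_self (by simp) (by simp) (ENNReal.inv_ne_zero.2 hMt)
  obtain ⟨ρ', hρ', hρ'1⟩ := exists_between hρ1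
  obtain ⟨η, hη, hηρ⟩ := ENNReal.exists_rpow_mul_le (B := D * A)
    (one_le_mul (le_max_left _ _) (le_max_left _ _)) (ENNReal.mul_ne_top hDt hAt) hρ' hρ'1.ne_top
  refine ⟨η, hη, A ^ (1 + η) / (1 - ρ'), ENNReal.div_ne_top
    (ENNReal.rpow_ne_top_of_nonneg (by linarith) hAt) (tsub_pos_of_lt hρ'1).ne', fun n Q => ?_⟩
  refine lintegral_descSup_rpow_le hC.ne_zero hC.ne_top hA.ne_zero hA.ne_top
    (fun P e => (hC.measure_child_le P e).trans (by gcongr; exact le_max_right _ _))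
    (le_max_left _ _) ?_ hη hηρ hρ'1 n Q
  -- The comparison passes through Lebesgue measure: a set with a small share of `c` fills at most
  -- half of `Q`, so its complement carries at least the share `M⁻¹` of `a`.
  intro Q U hU hUQ hAU
  have h1 : 2 * volume U ≤ volume Q.toSet := hC.volume_le_half hU hUQ
    (le_trans (by gcongr; exact le_max_right _ _) hAU)
  have h2 : a Q.toSet ≤ M * a (Q.toSet \ U) := hA.measure_le (Q.measurableSet_toSet.diff hU)
    Set.sdiff_subset (volume_le_two_mul_diff hU hUQ h1)
  have h3 : a U + a (Q.toSet \ U) = a Q.toSet := by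
    rw [measure_add_sdiff hU.nullMeasurableSet, Set.union_eq_self_of_subset_left hUQ]
  have h4 : M⁻¹ * a Q.toSet ≤ a (Q.toSet \ U) := by
    rw [← ENNReal.div_eq_inv_mul]
    exact ENNReal.div_le_of_le_mul' h2
  rw [ENNReal.sub_mul (fun _ _ => hA.ne_top Q), one_mul]
  refine ENNReal.le_sub_of_add_le_right ?_ ?_
  · exact ne_top_of_le_ne_top (hA.ne_top Q) (h4.trans (measure_mono Set.sdiff_subset))
  · exact (add_le_add_right h4 _).trans h3.le

/-- The maximal inequality on the dyadic subcubes of a cube. -/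
lemma lintegral_descSup_average_le (hC : ApPair q q' K c k) {ψ : Rd d → ℝ≥0∞} (hψ : Measurable ψ)
    {r : ℝ} (hr : 1 < r) (n : ℕ) (Q : Cube d) :
    ∫⁻ x in Q.toSet, descSup (fun P => c.withDensity ψ P.toSet / c P.toSet) n Q x ^ r ∂c ≤
      maxConst ((K * 5 ^ d) ^ q) r * ∫⁻ x in Q.toSet, ψ x ^ r ∂c := by
  have hr0 : 0 < r := by linarith
  have hQ := Q.measurableSet_toSet
  have hD0 : (K * 5 ^ d) ^ q ≠ 0 := by
    intro h
    have := hC.measure_dilate_le Q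
    rw [h, zero_mul] at this
    exact hC.ne_zero _ (le_zero_iff.1 this)
  have key := lintegral_maximal_rpow_le (m := c) hD0
    (ENNReal.rpow_ne_top_of_nonneg hC.conj.nonneg (ENNReal.mul_ne_top hC.K_ne_top (by simp)))
    hC.measure_dilate_le hC.ne_top (hψ.indicator hQ)
    ((measurable_descSup (Y := fun P => c.withDensity ψ P.toSet / c P.toSet) n Q).indicator hQ)
    Q.side (fun x t ht => by
      have hx : x ∈ Q.toSet := by
        by_contra hx
        rw [Set.indicator_of_notMem hx] at ht
        exact not_lt_zero ht
      rw [Set.indicator_of_mem hx] at ht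
      obtain ⟨j, -, hj⟩ := exists_descSup_eq (Y := fun P => c.withDensity ψ P.toSet / c P.toSet)
        n Q x
      rw [hj, ENNReal.lt_div_iff_mul_lt (Or.inl (hC.ne_zero _)) (Or.inl (hC.ne_top _)),
        withDensity_apply _ (measurableSet_toSet _)] at ht
      refine ⟨desc j Q x, mem_desc hx j, ?_, ht.trans_le (le_of_eq ?_)⟩
      · rw [side_desc]
        exact div_le_self Q.side_pos.le (one_le_pow₀ (by norm_num))
      · refine setLIntegral_congr_fun (measurableSet_toSet _) fun y hy => ?_
        simp only [Set.indicator_of_mem (desc_subset Q x j hy)]) hr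
  have hind : ∀ f : Rd d → ℝ≥0∞, ∫⁻ x, Q.toSet.indicator f x ^ r ∂c =
      ∫⁻ x in Q.toSet, f x ^ r ∂c := fun f => by
    rw [← lintegral_indicator hQ]
    refine lintegral_congr fun x => ?_
    by_cases hx : x ∈ Q.toSet <;> simp [hx, hr0]
  rwa [hind, hind] at key

/-- The local estimate: the weighted mean oscillation on a cube whose dyadic subcubes either have
small oscillation, or lie in a given set `B` and obey the bound `Z`. -/
theorem exists_local_estimate (hA : ApPair p p' K a s) (hC : ApPair q q' K c k) (hpq : p ≤ q)
    {b : Rd d → ℂ} (hb : LocallyIntegrable b volume) :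
    ∃ r : ℝ, 1 < r ∧ r < q' ∧ ∃ C : ℝ≥0∞, C ≠ ∞ ∧ ∀ (ε Z : ℝ≥0∞) (B : Set (Rd d)),
      MeasurableSet B → ∀ (ψ : Rd d → ℝ≥0∞), Measurable ψ → ∀ Q : Cube d,
      (∀ P : Cube d, P.toSet ⊆ Q.toSet →
        oscInt b P ≤ ε * (a P.toSet ^ (1 / p) * k P.toSet ^ (1 / q')) ∨
        (P.toSet ⊆ B ∧
          oscInt b P / volume P.toSet * (c.withDensity ψ P.toSet / c P.toSet) ≤ Z)) →
      ∫⁻ x in Q.toSet, ‖b x - avg b Q‖ₑ ∂(c.withDensity ψ) ≤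
        C * (ε * (a Q.toSet ^ (1 / p) * c Q.toSet ^ (1 / q') *
          ((∫⁻ x in Q.toSet, ψ x ^ r ∂c) / c Q.toSet) ^ (1 / r)) + Z * c B) := by
  obtain ⟨η, hη, C₁, hC₁, hRH⟩ := exists_reverseHolder hA hC
  have hq0 := hC.conj.pos
  have hq1 := hC.conj.lt
  have hp0 := hA.conj.pos
  -- With this `u`, the power `(X ^ (1 / q)) ^ u` is the `X ^ (1 + η)` of the reverse Hölder
  -- inequality. Since `u > q`, the conjugate `r` is strictly below `q'`.
  set u : ℝ := q * (1 + η) with hu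
  have hqu : q < u := by rw [hu]; nlinarith
  have hu1 : 1 < u := hq1.trans hqu
  set r : ℝ := u.conjExponent with hr
  have hur : u.HolderConjugate r := Real.HolderConjugate.conjExponent hu1
  have hr1 : 1 < r := hur.symm.lt
  have hr0 : 0 < r := by linarith
  have hrinv : 1 / r = 1 - 1 / u := by
    have := hur.inv_add_inv_eq_one; rw [one_div, one_div]; linarith
  have hq'inv : 1 / q' = 1 - 1 / q := by
    have := hC.conj.inv_add_inv_eq_one; rw [one_div, one_div]; linarith
  have hrq : r < q' := by
    rw [← one_div_lt_one_div hC.conj.symm.pos hr0, hrinv, hq'inv]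
    have := one_div_lt_one_div_of_lt hq0 hqu
    linarith
  set C₀ : ℝ≥0∞ := (K * 2) ^ q with hC₀
  set C₂ : ℝ≥0∞ := maxConst ((K * 5 ^ d) ^ q) r with hC₂
  have hC₀t : C₀ ≠ ∞ := ENNReal.rpow_ne_top_of_nonneg hq0.le
    (ENNReal.mul_ne_top hC.K_ne_top (by simp))
  have hC₂t : C₂ ≠ ∞ := maxConst_ne_top (ENNReal.rpow_ne_top_of_nonneg hq0.le
    (ENNReal.mul_ne_top hC.K_ne_top (by simp))) hr1
  set C₃ : ℝ≥0∞ := max 1 (K * (C₁ ^ (1 / u) * C₂ ^ (1 / r))) with hC₃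
  have hC₃t : C₃ ≠ ∞ := (max_lt ENNReal.one_lt_top (ENNReal.mul_lt_top hC.K_ne_top.lt_top
    (ENNReal.mul_lt_top (ENNReal.rpow_ne_top_of_nonneg (by positivity) hC₁).lt_top
      (ENNReal.rpow_ne_top_of_nonneg (by positivity) hC₂t).lt_top))).ne
  refine ⟨r, hr1, hrq, 2 ^ (d + 1) * C₀ * C₃, ENNReal.mul_ne_top (ENNReal.mul_ne_top (by simp)
    hC₀t) hC₃t, fun ε Z B hB ψ hψ Q hQ => ?_⟩
  set h := c.withDensity ψ with hh
  set X : Cube d → ℝ≥0∞ := fun P => a P.toSet / c P.toSet with hX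
  set V : Cube d → ℝ≥0∞ := fun P => h P.toSet / c P.toSet with hV
  set Y : Cube d → ℝ≥0∞ := fun P => oscInt b P / volume P.toSet * V P with hY
  -- By Lebesgue differentiation and Fatou's lemma it suffices to bound the dyadic approximations
  -- uniformly in `n`.
  have hfatou : ∀ W : ℝ≥0∞, (∀ n, ∫⁻ x in Q.toSet, descSup Y n Q x ∂c ≤ W) →
      ∫⁻ x in Q.toSet, ‖b x - avg b Q‖ₑ ∂h ≤ 2 ^ (d + 1) * C₀ * W := by
    intro W hW
    have hae : ∀ᵐ x ∂(h.restrict Q.toSet),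
        ‖b x - avg b Q‖ₑ = liminf (fun n => ‖avg b (desc n Q x) - avg b Q‖ₑ) atTop := by
      have hac : h ≪ volume := (withDensity_absolutelyContinuous c ψ).trans hC.ac_left
      filter_upwards [ae_restrict_of_ae (hac.ae_le (ae_tendsto_avg_desc hb Q)),
        ae_restrict_mem Q.measurableSet_toSet] with x hx hxQ
      exact ((hx hxQ).sub_const _).enorm.liminf_eq.symm
    rw [lintegral_congr_ae hae]
    refine (lintegral_liminf_le fun n => ?_).trans ?_
    · exact measurable_desc (fun P => ‖avg b P - avg b Q‖ₑ) n Q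
    · refine liminf_le_of_frequently_le' (Frequently.of_forall fun n => ?_)
      refine (lintegral_avg_desc_sub_le hb hC.ne_zero hC.ne_top (C₀ := C₀) (fun Q U hU hUQ h2 =>
        hC.measure_le (Q.measurableSet_toSet.diff hU) Set.sdiff_subset
          (volume_le_two_mul_diff hU hUQ h2)) n Q).trans ?_
      gcongr
      exact hW n
  rw [mul_assoc (2 ^ (d + 1) * C₀)]
  refine hfatou _ fun n => ?_
  have hae0 : a Q.toSet ≠ 0 := hA.ne_zero Q
  have haet : a Q.toSet ≠ ∞ := hA.ne_top Q
  -- The `A_q` bound turns `k(P)^(1/q') / |P|` into `K c(P)^(-1/q)`, and `p ≤ q` lets the surplus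
  -- power of `a(P)` be replaced by that of `a(Q)`.
  have hgood : ∀ P : Cube d, P.toSet ⊆ Q.toSet →
      oscInt b P ≤ ε * (a P.toSet ^ (1 / p) * k P.toSet ^ (1 / q')) →
      Y P ≤ ε * K * a Q.toSet ^ (1 / p - 1 / q) * (X P ^ (1 / q) * V P) := by
    intro P hPQ hP
    have h1 : k P.toSet ^ (1 / q') / volume P.toSet ≤ K * (c P.toSet ^ (1 / q))⁻¹ := by
      have h0 : c P.toSet ^ (1 / q) ≠ 0 := by
        simp [ENNReal.rpow_eq_zero_iff, hC.ne_zero P, hC.ne_top P]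
      have ht : c P.toSet ^ (1 / q) ≠ ∞ :=
        ENNReal.rpow_ne_top_of_nonneg (by positivity) (hC.ne_top P)
      rw [← ENNReal.div_eq_inv_mul.trans (mul_comm _ _),
        ENNReal.le_div_iff_mul_le (Or.inl h0) (Or.inl ht), ENNReal.div_eq_inv_mul, mul_assoc,
        ← ENNReal.div_eq_inv_mul]
      refine ENNReal.div_le_of_le_mul ?_
      rw [mul_comm]
      exact hC.prod_le P
    have h2 : a P.toSet ^ (1 / p) ≤ a Q.toSet ^ (1 / p - 1 / q) * a P.toSet ^ (1 / q) := by
      rw [show 1 / p = (1 / p - 1 / q) + 1 / q by ring,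
        ENNReal.rpow_add _ _ (hA.ne_zero P) (hA.ne_top P), add_sub_cancel_right]
      gcongr
      exact sub_nonneg.2 (one_div_le_one_div_of_le hp0 hpq)
    calc Y P ≤ ε * (a P.toSet ^ (1 / p) * k P.toSet ^ (1 / q')) / volume P.toSet * V P := by
          simp only [hY]; gcongr
      _ = ε * (a P.toSet ^ (1 / p) * (k P.toSet ^ (1 / q') / volume P.toSet)) * V P := by
          simp only [ENNReal.div_eq_inv_mul]; ring
      _ ≤ ε * ((a Q.toSet ^ (1 / p - 1 / q) * a P.toSet ^ (1 / q)) *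
          (K * (c P.toSet ^ (1 / q))⁻¹)) * V P := by gcongr
      _ = _ := by
          simp only [hX]
          rw [ENNReal.div_rpow_of_nonneg _ _ (by positivity), ENNReal.div_eq_inv_mul]
          ring
  have hpt : ∀ x ∈ Q.toSet, descSup Y n Q x ≤
      ε * K * a Q.toSet ^ (1 / p - 1 / q) * ((fun y => descSup X n Q y ^ (1 / q)) * descSup V n Q) x
        + B.indicator (fun _ => Z) x := by
    intro x hx
    obtain ⟨j, hj, hjY⟩ := exists_descSup_eq (Y := Y) n Q x
    rw [hjY]
    rcases hQ _ (desc_subset Q x j) with hP | ⟨hPB, hPZ⟩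
    · refine (hgood _ (desc_subset Q x j) hP).trans (le_trans ?_ le_self_add)
      rw [Pi.mul_apply]
      gcongr
      · exact le_descSup_desc hj Q x
      · exact le_descSup_desc hj Q x
    · rw [Set.indicator_of_mem (hPB (mem_desc hx j))]
      exact hPZ.trans le_add_self
  have hmX := measurable_descSup (Y := X) n Q
  have hmV := measurable_descSup (Y := V) n Q
  -- Hölder's inequality in `c` with exponents `u` and `r`: reverse Hölder for the quotients `X`,
  -- the dyadic maximal inequality for the averages `V` of `ψ`.
  have hHolder : ∫⁻ x in Q.toSet, ((fun y => descSup X n Q y ^ (1 / q)) * descSup V n Q) x ∂c ≤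
      C₁ ^ (1 / u) * C₂ ^ (1 / r) * (a Q.toSet ^ (1 / q) * c Q.toSet ^ (1 / q') *
        ((∫⁻ x in Q.toSet, ψ x ^ r ∂c) / c Q.toSet) ^ (1 / r)) := by
    refine (ENNReal.lintegral_mul_le_Lp_mul_Lq _ hur (hmX.pow_const _).aemeasurable
      hmV.aemeasurable).trans ?_
    have e1 : ∀ x, (descSup X n Q x ^ (1 / q)) ^ u = descSup X n Q x ^ (1 + η) := fun x => by
      rw [← ENNReal.rpow_mul]; congr 1; rw [hu]; field_simp
    simp only [e1]
    have h1 := ENNReal.rpow_le_rpow (hRH n Q) (by positivity : 0 ≤ 1 / u)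
    have h2 := ENNReal.rpow_le_rpow (lintegral_descSup_average_le hC hψ hr1 n Q)
      (by positivity : 0 ≤ 1 / r)
    refine (mul_le_mul' h1 h2).trans (le_of_eq ?_)
    rw [ENNReal.mul_rpow_of_nonneg _ _ (by positivity),
      ENNReal.mul_rpow_of_nonneg _ _ (by positivity),
      ENNReal.mul_rpow_of_nonneg _ _ (by positivity), ← ENNReal.rpow_mul,
      ENNReal.div_rpow_of_nonneg _ _ (by positivity),
      ENNReal.div_rpow_of_nonneg _ _ (by positivity)]
    have e2 : (1 + η) * (1 / u) = 1 / q := by rw [hu]; field_simp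
    rw [e2]
    have e3 : c Q.toSet ^ (1 / q') =
        c Q.toSet ^ (1 / u) * (c Q.toSet ^ (1 / q))⁻¹ * c Q.toSet ^ (1 / r) := by
      rw [← ENNReal.rpow_neg, ← ENNReal.rpow_add _ _ (hC.ne_zero Q) (hC.ne_top Q),
        ← ENNReal.rpow_add _ _ (hC.ne_zero Q) (hC.ne_top Q)]
      congr 1
      rw [hq'inv, hrinv]; ring
    have e4 : (c Q.toSet ^ (1 / r))⁻¹ * c Q.toSet ^ (1 / r) = 1 :=
      ENNReal.inv_mul_cancel (by simp [ENNReal.rpow_eq_zero_iff, hC.ne_zero Q, hC.ne_top Q])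
        (ENNReal.rpow_ne_top_of_nonneg (by positivity) (hC.ne_top Q))
    rw [e3, ENNReal.div_eq_inv_mul, ENNReal.div_eq_inv_mul]
    set w := (∫⁻ x in Q.toSet, ψ x ^ r ∂c) ^ (1 / r)
    calc _ = C₁ ^ (1 / u) * (c Q.toSet ^ (1 / u) * ((c Q.toSet ^ (1 / q))⁻¹ *
            a Q.toSet ^ (1 / q))) * (C₂ ^ (1 / r) * w) * 1 := by rw [mul_one]
      _ = _ := by rw [← e4]; ring
  calc ∫⁻ x in Q.toSet, descSup Y n Q x ∂c
      ≤ ∫⁻ x in Q.toSet, (ε * K * a Q.toSet ^ (1 / p - 1 / q) *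
        ((fun y => descSup X n Q y ^ (1 / q)) * descSup V n Q) x
          + B.indicator (fun _ => Z) x) ∂c := setLIntegral_mono' Q.measurableSet_toSet hpt
    _ ≤ ε * K * a Q.toSet ^ (1 / p - 1 / q) * (C₁ ^ (1 / u) * C₂ ^ (1 / r) *
        (a Q.toSet ^ (1 / q) * c Q.toSet ^ (1 / q') *
        ((∫⁻ x in Q.toSet, ψ x ^ r ∂c) / c Q.toSet) ^ (1 / r))) + Z * c B := by
        rw [lintegral_add_right _ (measurable_const.indicator hB),
          lintegral_const_mul _ ((hmX.pow_const _).mul hmV)]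
        gcongr
        refine (setLIntegral_le_lintegral _ _).trans ?_
        rw [lintegral_indicator_const hB]
    _ = K * (C₁ ^ (1 / u) * C₂ ^ (1 / r)) * (ε * (a Q.toSet ^ (1 / p) * c Q.toSet ^ (1 / q') *
          ((∫⁻ x in Q.toSet, ψ x ^ r ∂c) / c Q.toSet) ^ (1 / r))) + 1 * (Z * c B) := by
        rw [show a Q.toSet ^ (1 / p) = a Q.toSet ^ (1 / p - 1 / q) * a Q.toSet ^ (1 / q) by
          rw [← ENNReal.rpow_add _ _ hae0 haet, sub_add_cancel]]
        ring
    _ ≤ _ := by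
        rw [mul_add]
        gcongr
        · exact le_max_right _ _
        · exact le_max_left _ _

end Local

/-! ### Sums over sparse families -/

lemma ENNReal.tsum_mul_le_Lp_mul_Lq {ι : Type*} {f g : ι → ℝ≥0∞} {p p' : ℝ}
    (h : p.HolderConjugate p') :
    ∑' i, f i * g i ≤ (∑' i, f i ^ p) ^ (1 / p) * (∑' i, g i ^ p') ^ (1 / p') := by
  rw [ENNReal.tsum_eq_iSup_sum]
  refine iSup_le fun F => (ENNReal.inner_le_Lp_mul_Lq F f g h).trans ?_
  gcongr
  · exact h.one_div_nonneg
  · exact ENNReal.sum_le_tsum _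
  · exact h.symm.one_div_nonneg
  · exact ENNReal.sum_le_tsum _

/-- Each `f i` is at most the `ℓ^r` norm, which takes up the surplus power `t - r`. This is applied
with `q' ≤ p'`. -/
lemma ENNReal.tsum_rpow_le {ι : Type*} {f : ι → ℝ≥0∞} {r t : ℝ} (hr : 0 < r) (hrt : r ≤ t) :
    (∑' i, f i ^ t) ^ (1 / t) ≤ (∑' i, f i ^ r) ^ (1 / r) := by
  have ht : 0 < t := hr.trans_le hrt
  set T := ∑' i, f i ^ r with hT
  have h1 : ∀ i, f i ^ t ≤ f i ^ r * T ^ ((t - r) / r) := fun i => by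
    have h2 : f i ^ t = f i ^ r * (f i ^ r) ^ ((t - r) / r) := by
      rw [← ENNReal.rpow_mul, ← ENNReal.rpow_add_of_nonneg _ _ hr.le
        (mul_nonneg hr.le (div_nonneg (by linarith) hr.le))]
      congr 1; field_simp; ring
    rw [h2]
    gcongr
    exact ENNReal.le_tsum i
  have h3 : ∑' i, f i ^ t ≤ T ^ (t / r) := by
    refine (ENNReal.tsum_le_tsum h1).trans (le_of_eq ?_)
    rw [ENNReal.tsum_mul_right, ← hT]
    nth_rw 1 [← ENNReal.rpow_one T]
    rw [← ENNReal.rpow_add_of_nonneg _ _ zero_le_one (div_nonneg (by linarith) hr.le)]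
    congr 1; field_simp; ring
  refine (ENNReal.rpow_le_rpow h3 (by positivity)).trans (le_of_eq ?_)
  rw [← ENNReal.rpow_mul]
  congr 1; field_simp

/-- The sparseness condition, for given subsets `E Q`. -/
structure SparseSets (γ : ℝ≥0∞) (S : Set (Cube d)) (E : Cube d → Set (Rd d)) : Prop where
  disj : S.PairwiseDisjoint E
  meas : ∀ Q ∈ S, MeasurableSet (E Q)
  sub : ∀ Q ∈ S, E Q ⊆ Q.toSet
  le : ∀ Q ∈ S, volume Q.toSet ≤ γ * volume (E Q)
  ne_top : γ ≠ ∞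

namespace ApPair

variable {p p' : ℝ} {K γ : ℝ≥0∞} {a s : Measure (Rd d)} {S : Set (Cube d)}
  {E : Cube d → Set (Rd d)}

lemma doubling_ne_top (h : ApPair p p' K a s) : (K * 5 ^ d) ^ p ≠ ∞ :=
  ENNReal.rpow_ne_top_of_nonneg h.conj.nonneg (ENNReal.mul_ne_top h.K_ne_top (by simp))

lemma doubling_ne_zero (h : ApPair p p' K a s) : (K * 5 ^ d) ^ p ≠ 0 := by
  intro h0
  let Q : Cube d := ⟨0, 1, one_pos⟩
  have := h.measure_dilate_le Q
  rw [h0, zero_mul] at this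
  exact h.ne_zero _ (le_zero_iff.1 this)

/-- The embedding theorem for the averages over a sparse family. -/
lemma tsum_average_rpow_le (hA : ApPair p p' K a s) (hE : SparseSets γ S E)
    {h : Rd d → ℝ≥0∞} (hh : Measurable h) {r : ℝ} (hr : 1 < r) :
    ∑' Q : S, a (Q : Cube d).toSet *
        ((∫⁻ x in (Q : Cube d).toSet, h x ∂a) / a (Q : Cube d).toSet) ^ r ≤
      (K * γ) ^ p * (maxConst ((K * 5 ^ d) ^ p) r * ∫⁻ x, h x ^ r ∂a) := by
  refine le_trans ?_ (mul_le_mul_right (BloomSparse.tsum_average_rpow_le hA.doubling_ne_zero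
    hA.doubling_ne_top hA.measure_dilate_le hA.ne_zero hA.ne_top hh hE.disj hE.meas id hE.sub hr) _)
  rw [← ENNReal.tsum_mul_left]
  refine ENNReal.tsum_le_tsum fun Q => ?_
  rw [← mul_assoc]
  exact mul_le_mul_left (hA.measure_le (hE.meas Q Q.2) (hE.sub Q Q.2) (hE.le Q Q.2)) _

/-- Large cubes of a sparse family that meet a given cube. -/
lemma tsum_large_ne_top (hA : ApPair p p' K a s) (hE : SparseSets γ S E) (B : Cube d) :
    ∑' Q : S, ({Q : Cube d | B.side ≤ Q.side ∧ (B.toSet ∩ Q.toSet).Nonempty}).indicator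
      (fun Q : Cube d => (a Q.toSet)⁻¹ ^ (p' / p)) Q ≠ ∞ := by
  have hp := hA.conj.pos
  have hp' := hA.conj.symm.pos
  set D := (K * 5 ^ d) ^ p with hD
  set N := (K * γ) ^ p with hN
  have hNt : N ≠ ∞ := ENNReal.rpow_ne_top_of_nonneg hp.le (ENNReal.mul_ne_top hA.K_ne_top hE.ne_top)
  have hB0 := hA.ne_zero B
  have hBt := hA.ne_top B
  -- The embedding is applied to the indicator of `B`, averaged over dilates. For a large cube `Q`
  -- that meets `B` the dilate contains `B`, so by doubling the average is at least a multiple of `1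
  -- / a(Q)`. As `a(E Q)` is comparable to `a(Q)`, the term is at least a multiple of `a(Q)^(1 - p')
  -- = a(Q)^(-p'/p)`.
  have key := BloomSparse.tsum_average_rpow_le hA.doubling_ne_zero
    hA.doubling_ne_top hA.measure_dilate_le hA.ne_zero hA.ne_top
    (measurable_const.indicator B.measurableSet_toSet (f := fun _ => (1 : ℝ≥0∞))) hE.disj hE.meas
    dilate (fun Q hQ => (hE.sub Q hQ).trans Q.subset_dilate) hA.conj.symm.lt
  have hfin : maxConst D p' * ∫⁻ x, B.toSet.indicator (fun _ => (1 : ℝ≥0∞)) x ^ p' ∂a ≠ ∞ := by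
    refine ENNReal.mul_ne_top (maxConst_ne_top hA.doubling_ne_top hA.conj.symm.lt) ?_
    have : ∀ x, B.toSet.indicator (fun _ => (1 : ℝ≥0∞)) x ^ p' = B.toSet.indicator (fun _ => 1) x :=
      fun x => by by_cases hx : x ∈ B.toSet <;> simp [hx, hp']
    simp only [this]
    rw [lintegral_indicator_const B.measurableSet_toSet, one_mul]
    exact hBt
  refine ne_top_of_le_ne_top (ENNReal.mul_ne_top (ENNReal.mul_ne_top hNt
    (ENNReal.rpow_ne_top_of_nonneg hp'.le (ENNReal.div_ne_top hA.doubling_ne_top hB0)))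
    (ne_top_of_le_ne_top hfin key)) ?_
  rw [← ENNReal.tsum_mul_left]
  refine ENNReal.tsum_le_tsum fun ⟨Q, hQS⟩ => ?_
  simp only
  by_cases hQ : Q ∈ {Q : Cube d | B.side ≤ Q.side ∧ (B.toSet ∩ Q.toSet).Nonempty}
  · rw [Set.indicator_of_mem hQ]
    have hBQ : B.toSet ⊆ Q.dilate.toSet := subset_dilate_of_inter hQ.2 (by
      have := hQ.1; have := Q.side_pos; linarith)
    have h1 : ∫⁻ x in Q.dilate.toSet, B.toSet.indicator (fun _ => (1 : ℝ≥0∞)) x ∂a = a B.toSet := by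
      rw [lintegral_indicator_const B.measurableSet_toSet, one_mul,
        Measure.restrict_apply B.measurableSet_toSet, Set.inter_eq_left.2 hBQ]
    rw [h1]
    have hQ0 := hA.ne_zero Q
    have hQt := hA.ne_top Q
    have h2 : (a Q.toSet)⁻¹ ≤ D / a B.toSet * (a B.toSet / a Q.dilate.toSet) := by
      rw [ENNReal.div_eq_inv_mul, ENNReal.div_eq_inv_mul]
      calc (a Q.toSet)⁻¹ ≤ D * (a Q.dilate.toSet)⁻¹ := by
            rw [← ENNReal.div_eq_inv_mul.trans (mul_comm _ _),
              ENNReal.le_div_iff_mul_le (Or.inl (hA.ne_zero _)) (Or.inl (hA.ne_top _)),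
              ← ENNReal.div_eq_inv_mul]
            exact ENNReal.div_le_of_le_mul (hA.measure_dilate_le Q)
        _ = (a B.toSet)⁻¹ * a B.toSet * (D * (a Q.dilate.toSet)⁻¹) := by
            rw [ENNReal.inv_mul_cancel hB0 hBt, one_mul]
        _ = _ := by ring
    have h3 : (1 : ℝ≥0∞) ≤ (a Q.toSet)⁻¹ * (N * a (E Q)) := by
      rw [← ENNReal.inv_mul_cancel hQ0 hQt]
      gcongr
      exact hA.measure_le (hE.meas Q hQS) (hE.sub Q hQS) (hE.le Q hQS)
    have h4 : p' = p' / p + 1 := by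
      have := hA.conj.inv_add_inv_eq_one
      field_simp at this ⊢
      linarith
    calc (a Q.toSet)⁻¹ ^ (p' / p) ≤ (a Q.toSet)⁻¹ ^ (p' / p) * ((a Q.toSet)⁻¹ * (N * a (E Q))) :=
          le_mul_of_one_le_right' h3
      _ = (a Q.toSet)⁻¹ ^ p' * (N * a (E Q)) := by
          conv_rhs => rw [h4]
          rw [ENNReal.rpow_add _ _ (ENNReal.inv_ne_zero.2 hQt) (ENNReal.inv_ne_top.2 hQ0),
            ENNReal.rpow_one, mul_assoc]
      _ ≤ (D / a B.toSet * (a B.toSet / a Q.dilate.toSet)) ^ p' * (N * a (E Q)) := by gcongr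
      _ = _ := by rw [ENNReal.mul_rpow_of_nonneg _ _ hp'.le]; ring
  · rw [Set.indicator_of_notMem hQ]; exact zero_le

/-- The averages over the cubes of a sparse family, tested against a sequence. -/
lemma tsum_average_mul_le (hA : ApPair p p' K a s) (hE : SparseSets γ S E)
    {φ : Rd d → ℝ≥0∞} (hφ : Measurable φ) (y : S → ℝ≥0∞) :
    ∑' Q : S, s.withDensity φ (Q : Cube d).toSet / volume (Q : Cube d).toSet *
        (a (Q : Cube d).toSet ^ (1 / p) * y Q) ≤
      K * ((K * γ) ^ p' * maxConst ((K * 5 ^ d) ^ p') p) ^ (1 / p) * (∫⁻ x, φ x ^ p ∂s) ^ (1 / p) *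
        (∑' Q, y Q ^ p') ^ (1 / p') := by
  have hp := hA.conj.pos
  -- The `A_p` bound trades the average over Lebesgue measure for the average over `s`, to which the
  -- embedding applies.
  have h1 : ∀ Q : Cube d, s.withDensity φ Q.toSet / volume Q.toSet * a Q.toSet ^ (1 / p) ≤
      K * (s Q.toSet ^ (1 / p) * ((∫⁻ x in Q.toSet, φ x ∂s) / s Q.toSet)) := by
    intro Q
    rw [withDensity_apply _ Q.measurableSet_toSet]
    set I := ∫⁻ x in Q.toSet, φ x ∂s
    have hs0 := hA.symm.ne_zero Q
    have hst := hA.symm.ne_top Q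
    have hv0 := Q.volume_ne_zero
    have hvt := Q.volume_ne_top
    have h2 : s Q.toSet ^ (1 / p') * s Q.toSet ^ (1 / p) = s Q.toSet := by
      rw [← ENNReal.rpow_add _ _ hs0 hst, one_div, one_div,
        hA.conj.symm.inv_add_inv_eq_one, ENNReal.rpow_one]
    calc I / volume Q.toSet * a Q.toSet ^ (1 / p) =
          I / volume Q.toSet * a Q.toSet ^ (1 / p) * ((s Q.toSet)⁻¹ * s Q.toSet) := by
            rw [ENNReal.inv_mul_cancel hs0 hst, mul_one]
      _ = (volume Q.toSet)⁻¹ * (a Q.toSet ^ (1 / p) * s Q.toSet ^ (1 / p')) *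
            (s Q.toSet ^ (1 / p) * (I / s Q.toSet)) := by
            nth_rw 2 [← h2]
            simp only [ENNReal.div_eq_inv_mul]; ring
      _ ≤ (volume Q.toSet)⁻¹ * (K * volume Q.toSet) * (s Q.toSet ^ (1 / p) * (I / s Q.toSet)) := by
            exact mul_le_mul_left (mul_le_mul_right (hA.prod_le Q) _) _
      _ = ((volume Q.toSet)⁻¹ * volume Q.toSet) * (K * (s Q.toSet ^ (1 / p) * (I / s Q.toSet))) := by
            ring
      _ = _ := by rw [ENNReal.inv_mul_cancel hv0 hvt, one_mul]
  calc _ ≤ ∑' Q : S, K * ((s (Q : Cube d).toSet ^ (1 / p) *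
          ((∫⁻ x in (Q : Cube d).toSet, φ x ∂s) / s (Q : Cube d).toSet)) * y Q) := by
        refine ENNReal.tsum_le_tsum fun Q => ?_
        rw [← mul_assoc, ← mul_assoc]
        exact mul_le_mul_left (h1 Q) _
    _ = K * ∑' Q : S, (s (Q : Cube d).toSet ^ (1 / p) *
          ((∫⁻ x in (Q : Cube d).toSet, φ x ∂s) / s (Q : Cube d).toSet)) * y Q :=
        ENNReal.tsum_mul_left
    _ ≤ K * ((∑' Q : S, (s (Q : Cube d).toSet ^ (1 / p) *
          ((∫⁻ x in (Q : Cube d).toSet, φ x ∂s) / s (Q : Cube d).toSet)) ^ p) ^ (1 / p) *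
          (∑' Q, y Q ^ p') ^ (1 / p')) := by
        gcongr
        exact ENNReal.tsum_mul_le_Lp_mul_Lq hA.conj
    _ ≤ K * (((K * γ) ^ p' * maxConst ((K * 5 ^ d) ^ p') p * ∫⁻ x, φ x ^ p ∂s) ^ (1 / p) *
          (∑' Q, y Q ^ p') ^ (1 / p')) := by
        gcongr K * (?_ ^ (1 / p) * _)
        · rw [mul_assoc]
          refine le_trans (le_of_eq ?_) (hA.symm.tsum_average_rpow_le hE hφ hA.conj.lt)
          refine tsum_congr fun Q => ?_
          rw [ENNReal.mul_rpow_of_nonneg _ _ hp.le, ← ENNReal.rpow_mul, one_div_mul_cancel hp.ne',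
            ENNReal.rpow_one]
    _ = _ := by
        rw [ENNReal.mul_rpow_of_nonneg _ _ (one_div_nonneg.2 hp.le)]
        ring

end ApPair

lemma SparseSets.mono {γ : ℝ≥0∞} {S T : Set (Cube d)} {E : Cube d → Set (Rd d)}
    (h : SparseSets γ S E) (hT : T ⊆ S) : SparseSets γ T E :=
  ⟨h.disj.subset hT, fun Q hQ => h.meas Q (hT hQ), fun Q hQ => h.sub Q (hT hQ),
    fun Q hQ => h.le Q (hT hQ), h.ne_top⟩

/-- The bilinear form of the sparse commutator on one cube. -/
def oscForm (b : Rd d → ℂ) (s c : Measure (Rd d)) (φ ψ : Rd d → ℝ≥0∞) (Q : Cube d) : ℝ≥0∞ :=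
  s.withDensity φ Q.toSet / volume Q.toSet *
    ∫⁻ x in Q.toSet, ‖b x - avg b Q‖ₑ ∂(c.withDensity ψ)

/-- The distance to a half-open cube need not be attained, whence a point within `R + 1` of the
origin; adding the side gives `2 * R + 1`. -/
lemma Cube.subset_of_distZero_le {R : ℝ} (hR : 0 < R) {P : Cube d} (hs : P.side ≤ R)
    (hd : P.distZero ≤ R) :
    P.toSet ⊆ (⟨WithLp.toLp 2 fun _ => -(2 * R + 1), 2 * (2 * R + 1), by linarith⟩ :
      Cube d).toSet := by
  obtain ⟨y, hy, hy0⟩ := (Metric.infDist_lt_iff ⟨_, P.corner_mem⟩).1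
    (show Metric.infDist (0 : Rd d) P.toSet < R + 1 from lt_of_le_of_lt hd (by linarith))
  intro x hx i
  rw [dist_comm, dist_zero_right] at hy0
  have h1 := (PiLp.norm_apply_le y i).trans_lt hy0
  rw [Real.norm_eq_abs, abs_lt] at h1
  have := hx i; have := hy i
  simp only
  constructor <;> linarith

/-! ### Boundedness, and smallness over truncated families, of the bilinear form -/

section Core

variable {p p' q q' : ℝ} {K γ : ℝ≥0∞} {a s c k : Measure (Rd d)} {S : Set (Cube d)}
  {E : Cube d → Set (Rd d)}

/-- The gain `r < q'` is used here. `ApPair.tsum_average_mul_le` leaves an `ℓ^{p'}` norm, which is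
at most the `ℓ^{q'}` norm because `q' ≤ p'`. That norm is a sum of `c(Q) ⟨ψ^r⟩^(q'/r)`, averages
taken in `c`, and the embedding applies since `q'/r > 1`. -/
lemma exists_tsum_good_le (hA : ApPair p p' K a s) (hC : ApPair q q' K c k) (hpq : p ≤ q)
    (γ : ℝ≥0∞) (hγ : γ ≠ ∞) {r : ℝ} (hr : 1 < r) (hrq : r < q') :
    ∃ C : ℝ≥0∞, C ≠ ∞ ∧ ∀ (S : Set (Cube d)) (E : Cube d → Set (Rd d)), SparseSets γ S E →
      ∀ φ ψ : Rd d → ℝ≥0∞, Measurable φ → Measurable ψ →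
      ∑' Q : S, s.withDensity φ (Q : Cube d).toSet / volume (Q : Cube d).toSet *
        (a (Q : Cube d).toSet ^ (1 / p) * (c (Q : Cube d).toSet ^ (1 / q') *
        ((∫⁻ x in (Q : Cube d).toSet, ψ x ^ r ∂c) / c (Q : Cube d).toSet) ^ (1 / r))) ≤
        C * (∫⁻ x, φ x ^ p ∂s) ^ (1 / p) * (∫⁻ x, ψ x ^ q' ∂c) ^ (1 / q') := by
  have hr0 : 0 < r := by linarith
  have hp := hA.conj.pos
  have hp' := hA.conj.symm.pos
  have hq' := hC.conj.symm.pos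
  have hqr : 1 < q' / r := (one_lt_div hr0).2 hrq
  have hqp : q' ≤ p' := by
    have h1 := hA.conj.inv_add_inv_eq_one
    have h2 := hC.conj.inv_add_inv_eq_one
    have h3 : q⁻¹ ≤ p⁻¹ := inv_anti₀ hp hpq
    rw [← inv_le_inv₀ hp' hq']
    linarith
  set C₁ := K * ((K * γ) ^ p' * maxConst ((K * 5 ^ d) ^ p') p) ^ (1 / p)
  set C₂ := ((K * γ) ^ q * maxConst ((K * 5 ^ d) ^ q) (q' / r)) ^ (1 / q')
  have hC₁ : C₁ ≠ ∞ := ENNReal.mul_ne_top hA.K_ne_top (ENNReal.rpow_ne_top_of_nonneg (by positivity)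
    (ENNReal.mul_ne_top (ENNReal.rpow_ne_top_of_nonneg hp'.le (ENNReal.mul_ne_top hA.K_ne_top hγ))
      (maxConst_ne_top hA.symm.doubling_ne_top hA.conj.lt)))
  have hC₂ : C₂ ≠ ∞ := ENNReal.rpow_ne_top_of_nonneg (by positivity)
    (ENNReal.mul_ne_top (ENNReal.rpow_ne_top_of_nonneg hC.conj.nonneg
      (ENNReal.mul_ne_top hA.K_ne_top hγ)) (maxConst_ne_top hC.doubling_ne_top hqr))
  refine ⟨C₁ * C₂, ENNReal.mul_ne_top hC₁ hC₂, fun S E hE φ ψ hφ hψ => ?_⟩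
  refine (hA.tsum_average_mul_le hE hφ _).trans ?_
  refine (mul_le_mul_right (ENNReal.tsum_rpow_le hq' hqp) _).trans ?_
  have h1 : ∀ Q : Cube d, (c Q.toSet ^ (1 / q') *
      ((∫⁻ x in Q.toSet, ψ x ^ r ∂c) / c Q.toSet) ^ (1 / r)) ^ q' =
      c Q.toSet * ((∫⁻ x in Q.toSet, ψ x ^ r ∂c) / c Q.toSet) ^ (q' / r) := fun Q => by
    rw [ENNReal.mul_rpow_of_nonneg _ _ hq'.le, ← ENNReal.rpow_mul, ← ENNReal.rpow_mul,
      one_div_mul_cancel hq'.ne', ENNReal.rpow_one, one_div_mul_eq_div]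
  simp only [h1]
  have h2 := hC.tsum_average_rpow_le hE (hψ.pow_const r) hqr
  have h3 : ∀ x, (ψ x ^ r) ^ (q' / r) = ψ x ^ q' := fun x => by
    rw [← ENNReal.rpow_mul, mul_div_cancel₀ _ hr0.ne']
  simp only [h3] at h2
  rw [← mul_assoc] at h2
  have h4 := ENNReal.rpow_le_rpow h2 (one_div_nonneg.2 hq'.le)
  rw [ENNReal.mul_rpow_of_nonneg _ _ (one_div_nonneg.2 hq'.le)] at h4
  refine (mul_le_mul_right h4 _).trans (le_of_eq ?_)
  simp only [C₁, C₂]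
  ring

/-- Boundedness of the sparse commutator, in bilinear form. -/
theorem exists_tsum_oscForm_le (hA : ApPair p p' K a s) (hC : ApPair q q' K c k) (hpq : p ≤ q)
    {b : Rd d → ℂ} (hb : LocallyIntegrable b volume) {B : ℝ≥0∞} (hBt : B ≠ ∞)
    (hB : ∀ P : Cube d, oscInt b P ≤ B * (a P.toSet ^ (1 / p) * k P.toSet ^ (1 / q')))
    (hE : SparseSets γ S E) :
    ∃ C : ℝ≥0∞, C ≠ ∞ ∧ ∀ φ ψ : Rd d → ℝ≥0∞, Measurable φ → Measurable ψ →
      ∑' Q : S, oscForm b s c φ ψ Q ≤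
        C * (∫⁻ x, φ x ^ p ∂s) ^ (1 / p) * (∫⁻ x, ψ x ^ q' ∂c) ^ (1 / q') := by
  obtain ⟨r, hr, hrq, C₁, hC₁, hloc⟩ := exists_local_estimate hA hC hpq hb
  obtain ⟨C₂, hC₂, hsum⟩ := exists_tsum_good_le hA hC hpq γ hE.ne_top hr hrq
  refine ⟨C₁ * B * C₂, ENNReal.mul_ne_top (ENNReal.mul_ne_top hC₁ hBt) hC₂,
    fun φ ψ hφ hψ => ?_⟩
  calc ∑' Q : S, oscForm b s c φ ψ Q ≤ ∑' Q : S, C₁ * B *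
        (s.withDensity φ (Q : Cube d).toSet / volume (Q : Cube d).toSet *
        (a (Q : Cube d).toSet ^ (1 / p) * (c (Q : Cube d).toSet ^ (1 / q') *
        ((∫⁻ x in (Q : Cube d).toSet, ψ x ^ r ∂c) / c (Q : Cube d).toSet) ^ (1 / r)))) := by
        refine ENNReal.tsum_le_tsum fun Q => ?_
        -- Every subcube is good for the global bound, so the exceptional set is empty and `Z = 0`.
        have h1 := hloc B 0 ∅ MeasurableSet.empty ψ hψ Q fun P _ => Or.inl (hB P)
        rw [zero_mul, add_zero] at h1
        refine (mul_le_mul_right h1 _).trans (le_of_eq ?_)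
        ring
    _ ≤ C₁ * B * (C₂ * (∫⁻ x, φ x ^ p ∂s) ^ (1 / p) * (∫⁻ x, ψ x ^ q' ∂c) ^ (1 / q')) := by
        rw [ENNReal.tsum_mul_left]
        gcongr
        exact hsum S E hE φ ψ hφ hψ
    _ = _ := by ring

lemma withDensity_cube_le (hC : ApPair q q' K c k) {ψ : Rd d → ℝ≥0∞} (hψ : Measurable ψ)
    (Q : Cube d) : c.withDensity ψ Q.toSet ≤
      (∫⁻ x, ψ x ^ q' ∂c) ^ (1 / q') * c Q.toSet ^ (1 / q) := by
  rw [withDensity_apply _ Q.measurableSet_toSet]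
  have h1 := ENNReal.lintegral_mul_le_Lp_mul_Lq (c.restrict Q.toSet) hC.conj.symm hψ.aemeasurable
    (measurable_const (a := (1 : ℝ≥0∞))).aemeasurable
  simp only [Pi.mul_apply, mul_one, ENNReal.one_rpow, lintegral_const,
    Measure.restrict_apply_univ, one_mul] at h1
  refine h1.trans ?_
  gcongr
  · exact hC.conj.symm.one_div_nonneg
  · exact Measure.restrict_le_self

lemma ENNReal.exists_ne_zero_mul_le {ε C : ℝ≥0∞} (hε : ε ≠ 0) (hC : C ≠ ∞) :
    ∃ δ : ℝ≥0∞, δ ≠ 0 ∧ C * δ ≤ ε := by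
  have hC1 : C + 1 ≠ ∞ := by simp [hC]
  refine ⟨ε / (C + 1), ENNReal.div_ne_zero.2 ⟨hε, hC1⟩, ?_⟩
  calc C * (ε / (C + 1)) ≤ (C + 1) * (ε / (C + 1)) := by gcongr; exact le_self_add
    _ ≤ ε := ENNReal.mul_div_le

/-- The bound for the oscillation of a function on cubes of controlled size and position. -/
lemma exists_bad_bound (hA : ApPair p p' K a s) (hC : ApPair q q' K c k)
    {b : Rd d → ℂ} {B : ℝ≥0∞} (hBt : B ≠ ∞)
    (hB : ∀ P : Cube d, oscInt b P ≤ B * (a P.toSet ^ (1 / p) * k P.toSet ^ (1 / q')))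
    {R : ℝ} (hR : 0 < R) (B₀ : Cube d) :
    ∃ L : ℝ≥0∞, L ≠ ∞ ∧ ∀ (h : Measure (Rd d)) (P : Cube d), P.toSet ⊆ B₀.toSet → R⁻¹ ≤ P.side →
      oscInt b P / volume P.toSet * (h P.toSet / c P.toSet) ≤ L * h B₀.toSet := by
  set v : ℝ≥0∞ := ENNReal.ofReal R⁻¹ ^ d with hv
  have hv0 : v ≠ 0 := (ENNReal.pow_pos (ENNReal.ofReal_pos.2 (inv_pos.2 hR)) _).ne'
  have hvt : v ≠ ∞ := ENNReal.pow_ne_top ENNReal.ofReal_ne_top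
  set N : ℝ≥0∞ := volume B₀.toSet / v with hN
  have hNt : N ≠ ∞ := ENNReal.div_ne_top B₀.volume_ne_top hv0
  set M : ℝ≥0∞ := (K * N) ^ q with hM
  have hMt : M ≠ ∞ := ENNReal.rpow_ne_top_of_nonneg hC.conj.nonneg
    (ENNReal.mul_ne_top hC.K_ne_top hNt)
  set A₀ : ℝ≥0∞ := a B₀.toSet ^ (1 / p) * k B₀.toSet ^ (1 / q') with hA₀
  have hA₀t : A₀ ≠ ∞ := ENNReal.mul_ne_top
    (ENNReal.rpow_ne_top_of_nonneg hA.conj.one_div_nonneg (hA.ne_top _))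
    (ENNReal.rpow_ne_top_of_nonneg hC.conj.symm.one_div_nonneg (hC.symm.ne_top _))
  refine ⟨B * A₀ / v * (M / c B₀.toSet), ENNReal.mul_ne_top
    (ENNReal.div_ne_top (ENNReal.mul_ne_top hBt hA₀t) hv0) (ENNReal.div_ne_top hMt (hC.ne_zero _)),
    fun h P hP hs => ?_⟩
  -- A lower bound on the side makes the volume of `P`, and hence `c P`, comparable to that of `B₀`,
  -- with constants depending on `R`.
  have h1 : v ≤ volume P.toSet := by
    rw [hv, Cube.volume_toSet]; gcongr
  have h2 : c B₀.toSet ≤ M * c P.toSet := by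
    refine hC.measure_le P.measurableSet_toSet hP ?_
    calc volume B₀.toSet = N * v := by rw [hN, ENNReal.div_mul_cancel hv0 hvt]
      _ ≤ _ := by gcongr
  have h3 : (c P.toSet)⁻¹ ≤ M / c B₀.toSet := by
    rw [ENNReal.le_div_iff_mul_le (Or.inl (hC.ne_zero _)) (Or.inl (hC.ne_top _)),
      ← ENNReal.div_eq_inv_mul]
    exact ENNReal.div_le_of_le_mul h2
  calc oscInt b P / volume P.toSet * (h P.toSet / c P.toSet)
      ≤ B * A₀ / v * (h B₀.toSet * (M / c B₀.toSet)) := by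
        rw [ENNReal.div_eq_inv_mul (a := h P.toSet), mul_comm (c P.toSet)⁻¹]
        gcongr
        refine (hB P).trans ?_
        rw [hA₀]
        gcongr
        · exact hA.conj.one_div_nonneg
        · exact hC.conj.symm.one_div_nonneg
    _ = _ := by ring

/-- The smallness of the sparse commutator over the cubes that are small, large or far away, in
bilinear form. -/
theorem exists_truncated_tsum_oscForm_le (hd : 0 < d) (hA : ApPair p p' K a s)
    (hC : ApPair q q' K c k) (hpq : p ≤ q)
    {b : Rd d → ℂ} (hb : LocallyIntegrable b volume) {B : ℝ≥0∞} (hBt : B ≠ ∞)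
    (hB : ∀ P : Cube d, oscInt b P ≤ B * (a P.toSet ^ (1 / p) * k P.toSet ^ (1 / q')))
    (hV : ∀ ε : ℝ≥0∞, ε ≠ 0 → ∃ R : ℝ, 0 < R ∧ ∀ P : Cube d,
      oscInt b P ≤ ε * (a P.toSet ^ (1 / p) * k P.toSet ^ (1 / q')) ∨
      (P.side ∈ Set.Icc R⁻¹ R ∧ P.distZero ≤ R))
    (hE : SparseSets γ S E) {ε : ℝ≥0∞} (hε : ε ≠ 0) :
    ∃ k₀ : ℝ, 0 < k₀ ∧ ∀ T ⊆ truncated S k₀, ∀ φ ψ : Rd d → ℝ≥0∞, Measurable φ → Measurable ψ →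
      ∑' Q : T, oscForm b s c φ ψ Q ≤
        ε * (∫⁻ x, φ x ^ p ∂s) ^ (1 / p) * (∫⁻ x, ψ x ^ q' ∂c) ^ (1 / q') := by
  have hp := hA.conj.pos
  have hp' := hA.conj.symm.pos
  obtain ⟨r, hr, hrq, C₁, hC₁, hloc⟩ := exists_local_estimate hA hC hpq hb
  obtain ⟨C₂, hC₂, hsum⟩ := exists_tsum_good_le hA hC hpq γ hE.ne_top hr hrq
  have hε2 : ε / 2 ≠ 0 := ENNReal.div_ne_zero.2 ⟨hε, by simp⟩
  obtain ⟨ε₀, hε₀, hε₀C⟩ := ENNReal.exists_ne_zero_mul_le hε2 (ENNReal.mul_ne_top hC₁ hC₂)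
  obtain ⟨R, hR, hRP⟩ := hV ε₀ hε₀
  -- A cube containing every bad cube, that is, every cube in the second case of `hRP`.
  let B₀ : Cube d := ⟨WithLp.toLp 2 fun _ => -(2 * R + 1), 2 * (2 * R + 1), by linarith⟩
  obtain ⟨L, hLt, hL⟩ := exists_bad_bound hA hC hBt hB hR B₀
  set C₃ : ℝ≥0∞ := K * ((K * γ) ^ p' * maxConst ((K * 5 ^ d) ^ p') p) ^ (1 / p) with hC₃
  have hC₃t : C₃ ≠ ∞ := ENNReal.mul_ne_top hA.K_ne_top (ENNReal.rpow_ne_top_of_nonneg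
    (by positivity) (ENNReal.mul_ne_top (ENNReal.rpow_ne_top_of_nonneg hp'.le
      (ENNReal.mul_ne_top hA.K_ne_top hE.ne_top))
      (maxConst_ne_top hA.symm.doubling_ne_top hA.conj.lt)))
  set C₄ : ℝ≥0∞ := C₁ * L * c B₀.toSet ^ (1 / q) * c B₀.toSet * C₃ with hC₄
  have hC₄t : C₄ ≠ ∞ := ENNReal.mul_ne_top (ENNReal.mul_ne_top (ENNReal.mul_ne_top
    (ENNReal.mul_ne_top hC₁ hLt) (ENNReal.rpow_ne_top_of_nonneg hC.conj.one_div_nonneg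
      (hC.ne_top _))) (hC.ne_top _)) hC₃t
  obtain ⟨δ, hδ, hδC⟩ := ENNReal.exists_ne_zero_mul_le hε2 hC₄t
  set G : Cube d → ℝ≥0∞ := ({Q : Cube d | B₀.side ≤ Q.side ∧ (B₀.toSet ∩ Q.toSet).Nonempty}).indicator
      (fun Q : Cube d => (a Q.toSet)⁻¹ ^ (p' / p)) with hG
  have hGt : ∑' Q, S.indicator G Q ≠ ∞ := by
    rw [← tsum_subtype]
    exact hA.tsum_large_ne_top hE B₀
  have hδp : 0 < δ ^ p' := ENNReal.rpow_pos_of_nonneg (pos_iff_ne_zero.2 hδ) hp'.le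
  -- Outside the finite set `F` the convergent sum over large cubes is below `δ ^ p'`. Adding the
  -- sides of `F` to `k₀` makes every cube of side greater than `k₀` avoid `F`.
  obtain ⟨F, hF⟩ := ((ENNReal.tendsto_tsum_compl_atTop_zero hGt).eventually_lt_const hδp).exists
  set k₀ : ℝ := R + B₀.side + ∑ Q ∈ F, Q.side with hk₀
  have hFs : 0 ≤ ∑ Q ∈ F, Q.side := Finset.sum_nonneg fun Q _ => Q.side_pos.le
  have hk₀R : R ≤ k₀ := by have := B₀.side_pos; linarith
  have hk₀B : B₀.side ≤ k₀ := by linarith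
  have hk₀0 : 0 < k₀ := hR.trans_le hk₀R
  refine ⟨k₀, hk₀0, fun T hT φ ψ hφ hψ => ?_⟩
  have hTS : T ⊆ S := hT.trans Set.sdiff_subset
  -- The only cubes of `T` that can have bad subcubes.
  set U : Set (Cube d) := {Q | k₀ < Q.side ∧ (B₀.toSet ∩ Q.toSet).Nonempty} with hU
  set nφ := (∫⁻ x, φ x ^ p ∂s) ^ (1 / p)
  set nψ := (∫⁻ x, ψ x ^ q' ∂c) ^ (1 / q')
  set Z : ℝ≥0∞ := L * c.withDensity ψ B₀.toSet with hZ
  have hZle : Z ≤ L * (nψ * c B₀.toSet ^ (1 / q)) := by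
    rw [hZ]; gcongr; exact withDensity_cube_le hC hψ B₀
  set y : T → ℝ≥0∞ := fun Q => U.indicator (fun Q => (a Q.toSet)⁻¹ ^ (1 / p)) (Q : Cube d) with hy
  have hy_sum : ∑' Q, y Q ^ p' ≤ δ ^ p' := by
    have h1 : ∀ Q : T, y Q ^ p' ≤ ((F : Set (Cube d))ᶜ).indicator (S.indicator G) (Q : Cube d) := by
      intro ⟨Q, hQ⟩
      simp only [hy]
      by_cases hQU : Q ∈ U
      · have hQF : Q ∈ (F : Set (Cube d))ᶜ := fun hQF => by
          have : Q.side ≤ ∑ Q ∈ F, Q.side := Finset.single_le_sum (f := fun Q : Cube d => Q.side)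
            (fun Q _ => Q.side_pos.le) hQF
          have := hQU.1
          have := B₀.side_pos
          linarith
        rw [Set.indicator_of_mem hQU, Set.indicator_of_mem hQF, Set.indicator_of_mem (hTS hQ), hG,
          Set.indicator_of_mem (show Q ∈ {Q : Cube d | B₀.side ≤ Q.side ∧
            (B₀.toSet ∩ Q.toSet).Nonempty} from ⟨hk₀B.trans hQU.1.le, hQU.2⟩),
          ← ENNReal.rpow_mul, one_div_mul_eq_div]
      · rw [Set.indicator_of_notMem hQU, ENNReal.zero_rpow_of_pos hp']
        exact zero_le
    refine (ENNReal.tsum_le_tsum h1).trans ((ENNReal.tsum_comp_le_tsum_of_injective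
      Subtype.val_injective _).trans ?_)
    rw [← tsum_subtype]
    exact hF.le
  have hbad : ∑' Q : T, s.withDensity φ (Q : Cube d).toSet / volume (Q : Cube d).toSet *
      (a (Q : Cube d).toSet ^ (1 / p) * y Q) ≤ C₃ * nφ * δ := by
    refine (hA.tsum_average_mul_le (hE.mono hTS) hφ y).trans ?_
    gcongr
    refine (ENNReal.rpow_le_rpow hy_sum (one_div_nonneg.2 hp'.le)).trans (le_of_eq ?_)
    rw [← ENNReal.rpow_mul, mul_one_div_cancel hp'.ne', ENNReal.rpow_one]
  have hterm : ∀ Q : T, oscForm b s c φ ψ Q ≤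
      C₁ * ε₀ * (s.withDensity φ (Q : Cube d).toSet / volume (Q : Cube d).toSet *
        (a (Q : Cube d).toSet ^ (1 / p) * (c (Q : Cube d).toSet ^ (1 / q') *
        ((∫⁻ x in (Q : Cube d).toSet, ψ x ^ r ∂c) / c (Q : Cube d).toSet) ^ (1 / r)))) +
      C₁ * Z * c B₀.toSet * (s.withDensity φ (Q : Cube d).toSet / volume (Q : Cube d).toSet *
      (a (Q : Cube d).toSet ^ (1 / p) * y Q)) := by
    intro ⟨Q, hQ⟩
    have h1 := hloc ε₀ (U.indicator (fun _ => Z) Q) B₀.toSet B₀.measurableSet_toSet ψ hψ Q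
      fun P hPQ => by
        rcases hRP P with hP | ⟨hPs, hPd⟩
        · exact Or.inl hP
        · have hPB : P.toSet ⊆ B₀.toSet := Cube.subset_of_distZero_le hR hPs.2 hPd
          refine Or.inr ⟨hPB, ?_⟩
          have hQU : Q ∈ U := by
            have hPQs := side_le_of_subset hd hPQ
            refine ⟨?_, ⟨_, hPB P.corner_mem, hPQ P.corner_mem⟩⟩
            by_contra hlt
            -- If `Q` were not larger than `k₀`, the bad subcube `P` would force its side and
            -- position into the range removed by the truncation.
            refine (hT hQ).2 ⟨hTS hQ, ⟨?_, not_lt.1 hlt⟩, ?_⟩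
            · exact (inv_anti₀ hR hk₀R).trans (hPs.1.trans hPQs)
            · exact (distZero_anti hPQ).trans (hPd.trans hk₀R)
          rw [Set.indicator_of_mem hQU]
          exact hL _ P hPB hPs.1
    refine (mul_le_mul_right h1 _).trans (le_of_eq ?_)
    -- The factor `a(Q)^(1/p) * a(Q)^(-1/p) = 1` is inserted to give the bad part the shape required
    -- by `ApPair.tsum_average_mul_le`.
    have h2 : U.indicator (fun _ => Z) Q = Z * (a Q.toSet ^ (1 / p) *
        U.indicator (fun Q => (a Q.toSet)⁻¹ ^ (1 / p)) Q) := by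
      by_cases hQU : Q ∈ U
      · rw [Set.indicator_of_mem hQU, Set.indicator_of_mem hQU, ENNReal.inv_rpow,
          ENNReal.mul_inv_cancel, mul_one]
        · simp [ENNReal.rpow_eq_zero_iff, hA.ne_zero Q, hA.ne_top Q]
        · exact ENNReal.rpow_ne_top_of_nonneg (by positivity) (hA.ne_top Q)
      · rw [Set.indicator_of_notMem hQU, Set.indicator_of_notMem hQU, mul_zero, mul_zero]
    rw [h2]
    simp only [hy]
    ring
  calc ∑' Q : T, oscForm b s c φ ψ Q ≤ C₁ * ε₀ * (C₂ * nφ * nψ) +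
        C₁ * Z * c B₀.toSet * (C₃ * nφ * δ) := by
        refine (ENNReal.tsum_le_tsum hterm).trans ?_
        rw [ENNReal.tsum_add, ENNReal.tsum_mul_left, ENNReal.tsum_mul_left]
        gcongr
        exact hsum T E (hE.mono hTS) φ ψ hφ hψ
    _ ≤ C₁ * ε₀ * (C₂ * nφ * nψ) +
        C₁ * (L * (nψ * c B₀.toSet ^ (1 / q))) * c B₀.toSet * (C₃ * nφ * δ) := by gcongr
    _ = C₁ * C₂ * ε₀ * (nφ * nψ) + C₄ * δ * (nφ * nψ) := by rw [hC₄]; ring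
    _ ≤ ε / 2 * (nφ * nψ) + ε / 2 * (nφ * nψ) := by gcongr
    _ = ε * nφ * nψ := by rw [← add_mul, ENNReal.add_halves, mul_assoc]

end Core

lemma ApPair.mono {p p' : ℝ} {K K' : ℝ≥0∞} {a s : Measure (Rd d)} (h : ApPair p p' K a s)
    (hK : K ≤ K') (hK' : K' ≠ ∞) : ApPair p p' K' a s where
  conj := h.conj
  K_ne_top := hK'
  ac_left := h.ac_left
  ac_right := h.ac_right
  vol_le := h.vol_le
  prod_le Q := (h.prod_le Q).trans (by gcongr)

/-! ### From weights to pairs of measures -/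

section Weights

variable {p q : ℝ} {w mu lam : Rd d → ℝ}

lemma IsWeight.aemeasurable (hw : IsWeight w) : AEMeasurable w :=
  hw.2.aestronglyMeasurable.aemeasurable

lemma IsWeight.aemeasurable_rpow (hw : IsWeight w) (r : ℝ) :
    AEMeasurable fun x => ENNReal.ofReal (w x ^ r) :=
  (hw.aemeasurable.pow_const r).ennreal_ofReal

lemma IsWeight.absolutelyContinuous (hw : IsWeight w) (r : ℝ) : volume ≪ powMeasure r w :=
  withDensity_absolutelyContinuous' (hw.aemeasurable_rpow r)
    (Eventually.of_forall fun x => (ENNReal.ofReal_pos.2 (Real.rpow_pos_of_pos (hw.1 x) r)).ne')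

lemma powMeasure_ac (r : ℝ) (w : Rd d → ℝ) : powMeasure r w ≪ volume :=
  withDensity_absolutelyContinuous _ _

/-- The lower bound for the volume is Hölder's inequality for `1 = w * w⁻¹`. The upper bound is the
weight condition with the averages multiplied out, as `1/p + 1/p' = 1`. -/
lemma MemApp.apPair (hp : 1 < p) (hw : MemApp p w) :
    ApPair p p.conjExponent (appConst p w) (powMeasure p w) (powMeasure (-p.conjExponent) w) := by
  have hc := Real.HolderConjugate.conjExponent hp
  have hp0 : 0 < p := hc.pos
  have hp'0 := hc.symm.pos
  refine ⟨hc, hw.2.ne, powMeasure_ac _ _, powMeasure_ac _ _, fun E hE => ?_, fun Q => ?_⟩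
  · have h1 := ENNReal.lintegral_mul_le_Lp_mul_Lq (volume.restrict E) hc
      (f := fun x => ENNReal.ofReal (w x)) (g := fun x => ENNReal.ofReal ((w x)⁻¹))
      hw.1.aemeasurable.ennreal_ofReal.restrict hw.1.aemeasurable.inv.ennreal_ofReal.restrict
    have e0 : ∀ x, ENNReal.ofReal (w x) * ENNReal.ofReal ((w x)⁻¹) = 1 := fun x => by
      rw [← ENNReal.ofReal_mul (hw.1.1 x).le, mul_inv_cancel₀ (hw.1.1 x).ne', ENNReal.ofReal_one]
    have e1 : ∀ x, ENNReal.ofReal (w x) ^ p = ENNReal.ofReal (w x ^ p) := fun x =>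
      ENNReal.ofReal_rpow_of_pos (hw.1.1 x)
    have e2 : ∀ x, ENNReal.ofReal ((w x)⁻¹) ^ p.conjExponent =
        ENNReal.ofReal (w x ^ (-p.conjExponent)) := fun x => by
      rw [ENNReal.ofReal_rpow_of_pos (inv_pos.2 (hw.1.1 x)), Real.inv_rpow (hw.1.1 x).le,
        Real.rpow_neg (hw.1.1 x).le]
    simp only [Pi.mul_apply, e0, e1, e2, lintegral_const, Measure.restrict_apply_univ,
      one_mul] at h1
    rwa [powMeasure, powMeasure, withDensity_apply _ hE, withDensity_apply _ hE]
  · have h1 := le_iSup (fun Q : Cube d => avgPos (fun x => w x ^ p) Q ^ (1 / p) *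
      avgPos (fun x => w x ^ (-p.conjExponent)) Q ^ (1 / p.conjExponent)) Q
    have h2 : avgPos (fun x => w x ^ p) Q ^ (1 / p) *
      avgPos (fun x => w x ^ (-p.conjExponent)) Q ^ (1 / p.conjExponent) ≤ appConst p w := h1
    rw [avgPos, avgPos, ENNReal.div_rpow_of_nonneg _ _ (by positivity),
      ENNReal.div_rpow_of_nonneg _ _ (by positivity)] at h2
    rw [powMeasure, powMeasure, withDensity_apply _ Q.measurableSet_toSet,
      withDensity_apply _ Q.measurableSet_toSet]
    set A := (∫⁻ x in Q.toSet, ENNReal.ofReal (w x ^ p)) ^ (1 / p)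
    set B := (∫⁻ x in Q.toSet, ENNReal.ofReal (w x ^ (-p.conjExponent))) ^ (1 / p.conjExponent)
    have h3 : volume Q.toSet ^ (1 / p) * volume Q.toSet ^ (1 / p.conjExponent) =
        volume Q.toSet := by
      rw [← ENNReal.rpow_add _ _ Q.volume_ne_zero Q.volume_ne_top, one_div, one_div,
        hc.inv_add_inv_eq_one, ENNReal.rpow_one]
    have h4 : A / volume Q.toSet ^ (1 / p) * (B / volume Q.toSet ^ (1 / p.conjExponent)) =
        A * B / volume Q.toSet := by
      rw [← h3, ENNReal.div_eq_inv_mul, ENNReal.div_eq_inv_mul, ENNReal.div_eq_inv_mul, h3,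
        ← ENNReal.rpow_neg, ← ENNReal.rpow_neg]
      have h5 : (volume Q.toSet)⁻¹ =
          volume Q.toSet ^ (-(1 / p)) * volume Q.toSet ^ (-(1 / p.conjExponent)) := by
        rw [← ENNReal.rpow_add _ _ Q.volume_ne_zero Q.volume_ne_top, ← ENNReal.rpow_neg_one]
        congr 1
        have := hc.inv_add_inv_eq_one
        rw [one_div, one_div]; linarith
      rw [h5]; ring
    rw [h4, ENNReal.div_le_iff_le_mul (Or.inl Q.volume_ne_zero) (Or.inl Q.volume_ne_top)] at h2
    exact h2

lemma mass_bloomWeight_ne_zero (hmu : IsWeight mu) (hlam : IsWeight lam) (Q : Cube d) : mass (bloomWeight p q mu lam) Q ≠ 0 := by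
  intro h0
  have hm : AEMeasurable fun x => ENNReal.ofReal (bloomWeight p q mu lam x) :=
    ((hmu.aemeasurable.div hlam.aemeasurable).pow_const _).ennreal_ofReal
  have hac : volume ≪ volume.withDensity fun x => ENNReal.ofReal (bloomWeight p q mu lam x) :=
    withDensity_absolutelyContinuous' hm (Eventually.of_forall fun x =>
      (ENNReal.ofReal_pos.2 (Real.rpow_pos_of_pos (div_pos (hmu.1 x) (hlam.1 x)) _)).ne')
  refine Q.volume_ne_zero (hac ?_)
  rwa [withDensity_apply _ Q.measurableSet_toSet]

/-- Hölder's inequality for `ν = μ^(1/u) λ^(-1/u)`, where `u = 1/p + 1/q'`, with the conjugate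
exponents `p u` and `q' u`. -/
lemma mass_bloomWeight_le (hp : 1 < p) (hpq : p ≤ q) (hmu : IsWeight mu) (hlam : IsWeight lam)
    (Q : Cube d) :
    mass (bloomWeight p q mu lam) Q ^ (1 / p + 1 / q.conjExponent) ≤
      powMeasure p mu Q.toSet ^ (1 / p) *
        powMeasure (-q.conjExponent) lam Q.toSet ^ (1 / q.conjExponent) := by
  have hq : 1 < q := hp.trans_le hpq
  have hp0 : 0 < p := by linarith
  have hq'0 : 0 < q.conjExponent := (Real.HolderConjugate.conjExponent hq).symm.pos
  set q' := q.conjExponent with hq'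
  set u : ℝ := 1 / p + 1 / q' with hu
  have hu0 : 0 < u := by positivity
  have hconj : (p * u).HolderConjugate (q' * u) := by
    refine Real.holderConjugate_iff.2 ⟨?_, ?_⟩
    · rw [hu]; field_simp; linarith
    · rw [hu]; field_simp
  have h1 := ENNReal.lintegral_mul_le_Lp_mul_Lq (volume.restrict Q.toSet) hconj
    (f := fun x => ENNReal.ofReal (mu x ^ (1 / u)))
    (g := fun x => ENNReal.ofReal ((lam x)⁻¹ ^ (1 / u)))
    (hmu.aemeasurable_rpow _).restrict
    (hlam.aemeasurable.inv.pow_const _).ennreal_ofReal.restrict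
  have e0 : ∀ x, ENNReal.ofReal (mu x ^ (1 / u)) * ENNReal.ofReal ((lam x)⁻¹ ^ (1 / u)) =
      ENNReal.ofReal (bloomWeight p q mu lam x) := fun x => by
    rw [← ENNReal.ofReal_mul (Real.rpow_nonneg (hmu.1 x).le _),
      ← Real.mul_rpow (hmu.1 x).le (inv_nonneg.2 (hlam.1 x).le), ← div_eq_mul_inv, bloomWeight]
  have e1 : ∀ x, ENNReal.ofReal (mu x ^ (1 / u)) ^ (p * u) = ENNReal.ofReal (mu x ^ p) := fun x => by
    rw [ENNReal.ofReal_rpow_of_pos (Real.rpow_pos_of_pos (hmu.1 x) _), ← Real.rpow_mul (hmu.1 x).le]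
    congr 2; field_simp
  have e2 : ∀ x, ENNReal.ofReal ((lam x)⁻¹ ^ (1 / u)) ^ (q' * u) =
      ENNReal.ofReal (lam x ^ (-q')) := fun x => by
    rw [ENNReal.ofReal_rpow_of_pos (Real.rpow_pos_of_pos (inv_pos.2 (hlam.1 x)) _),
      ← Real.rpow_mul (inv_nonneg.2 (hlam.1 x).le), Real.inv_rpow (hlam.1 x).le,
      ← Real.rpow_neg (hlam.1 x).le]
    congr 2; field_simp
  simp only [Pi.mul_apply, e0, e1, e2] at h1
  have h2 := ENNReal.rpow_le_rpow h1 hu0.le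
  rw [ENNReal.mul_rpow_of_nonneg _ _ hu0.le, ← ENNReal.rpow_mul, ← ENNReal.rpow_mul,
    show 1 / (p * u) * u = 1 / p by field_simp, show 1 / (q' * u) * u = 1 / q' by field_simp] at h2
  rwa [powMeasure, powMeasure, withDensity_apply _ Q.measurableSet_toSet,
    withDensity_apply _ Q.measurableSet_toSet]

end Weights

/-! ### From vanishing mean oscillation to good and bad cubes -/

section Oscillation

variable {p q α : ℝ} {mu lam : Rd d → ℝ} {b : Rd d → ℂ}

/-- Since `1 + α/d = 1/p + 1/q'`, the integral of the oscillation is `osc` times `ν(Q)^(1/p +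
1/q')`, and `mass_bloomWeight_le` applies. -/
lemma oscInt_le_osc (hp : 1 < p) (hpq : p ≤ q) (hα : α / d = 1 / p - 1 / q) (hmu : MemApp p mu)
    (hlam : MemApp q lam) (b : Rd d → ℂ) (Q : Cube d) :
    oscInt b Q ≤ osc α (bloomWeight p q mu lam) b Q * (powMeasure p mu Q.toSet ^ (1 / p) *
        powMeasure (-q.conjExponent) lam Q.toSet ^ (1 / q.conjExponent)) := by
  have hq : 1 < q := hp.trans_le hpq
  have hc := Real.HolderConjugate.conjExponent hq
  have h0 := mass_bloomWeight_ne_zero (p := p) (q := q) hmu.1 hlam.1 Q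
  have hle := mass_bloomWeight_le hp hpq hmu.1 hlam.1 Q
  have hu0 : 0 < 1 / p + 1 / q.conjExponent := by
    have := hc.symm.pos
    have : 0 < p := by linarith
    positivity
  have ht : mass (bloomWeight p q mu lam) Q ≠ ∞ := by
    intro h
    rw [h, ENNReal.top_rpow_of_pos hu0, top_le_iff] at hle
    exact ENNReal.mul_ne_top (ENNReal.rpow_ne_top_of_nonneg (by positivity)
      ((hmu.apPair hp).ne_top Q)) (ENNReal.rpow_ne_top_of_nonneg hc.symm.one_div_nonneg
      ((hlam.apPair hq).symm.ne_top Q)) hle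
  refine le_trans (le_of_eq ?_) (mul_le_mul_right hle _)
  rw [osc]
  set ν := mass (bloomWeight p q mu lam) Q
  have hexp : 1 / p + 1 / q.conjExponent = α / d + 1 := by
    have := hc.inv_add_inv_eq_one
    rw [hα, one_div q.conjExponent, one_div q]; linarith
  rw [hexp, ENNReal.rpow_add _ _ h0 ht, ENNReal.rpow_one, ENNReal.rpow_neg]
  have h1 : (ν ^ (α / d))⁻¹ * ν ^ (α / d) = 1 :=
    ENNReal.inv_mul_cancel (by simp [ENNReal.rpow_eq_zero_iff, h0, ht])
      (by simp [ENNReal.rpow_eq_top_iff, h0, ht])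
  have h2 : (∫⁻ x in Q.toSet, ‖b x - avg b Q‖ₑ) / ν * ν = oscInt b Q :=
    ENNReal.div_mul_cancel h0 ht
  calc oscInt b Q = ((ν ^ (α / d))⁻¹ * ν ^ (α / d)) *
        ((∫⁻ x in Q.toSet, ‖b x - avg b Q‖ₑ) / ν * ν) := by rw [h1, h2, one_mul]
    _ = _ := by ring

lemma oscInt_le_two_mul {P Q : Cube d} (hb : LocallyIntegrable b volume)
    (hPQ : P.toSet ⊆ Q.toSet) : oscInt b P ≤ 2 * oscInt b Q := by
  have h1 : ∫⁻ x in P.toSet, ‖b x - avg b Q‖ₑ ≤ oscInt b Q := lintegral_mono_set hPQ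
  have h2 : ∀ x, ‖b x - avg b P‖ₑ ≤ ‖b x - avg b Q‖ₑ + ‖avg b P - avg b Q‖ₑ := fun x => by
    rw [show b x - avg b P = (b x - avg b Q) - (avg b P - avg b Q) by ring]
    exact enorm_sub_le
  calc oscInt b P ≤ ∫⁻ x in P.toSet, (‖b x - avg b Q‖ₑ + ‖avg b P - avg b Q‖ₑ) :=
        lintegral_mono fun x => h2 x
    _ = (∫⁻ x in P.toSet, ‖b x - avg b Q‖ₑ) + ‖avg b P - avg b Q‖ₑ * volume P.toSet := by
        rw [lintegral_add_right _ measurable_const, setLIntegral_const]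
    _ ≤ oscInt b Q + oscInt b Q := by
        refine add_le_add h1 ?_
        refine (mul_le_mul_left (enorm_avg_sub_le (integrableOn_cube hb P) _) _).trans ?_
        rwa [ENNReal.div_mul_cancel P.volume_ne_zero P.volume_ne_top]
    _ = _ := (two_mul _).symm

/-- For a function of `VMO`, the oscillation is small except on cubes of controlled size and
position. -/
theorem MemVMO.exists_oscInt_le (hp : 1 < p) (hpq : p ≤ q) (hα : α / d = 1 / p - 1 / q)
    (hmu : MemApp p mu) (hlam : MemApp q lam) (hb : MemVMO α (bloomWeight p q mu lam) b)
    {ε : ℝ≥0∞} (hε : ε ≠ 0) :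
    ∃ R : ℝ, 0 < R ∧ ∀ P : Cube d,
      oscInt b P ≤ ε * (powMeasure p mu P.toSet ^ (1 / p) *
        powMeasure (-q.conjExponent) lam P.toSet ^ (1 / q.conjExponent)) ∨
      (P.side ∈ Set.Icc R⁻¹ R ∧ P.distZero ≤ R) := by
  have hq : 1 < q := hp.trans_le hpq
  have hε0 : 0 < ε := pos_iff_ne_zero.2 hε
  have hosc := oscInt_le_osc hp hpq hα hmu hlam b
  have hA := hmu.apPair hp
  have hC := (hlam.apPair hq).symm
  set a := powMeasure p mu
  set k := powMeasure (-q.conjExponent) lam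
  obtain ⟨δ, hδ, hδ0⟩ := ((hb.small.eventually_lt_const hε0).and self_mem_nhdsWithin).exists
  obtain ⟨Λ, hΛ, hΛ0⟩ := ((hb.large.eventually_lt_const hε0).and (eventually_gt_atTop 0)).exists
  have hδ0 : 0 < δ := hδ0
  set N : ℝ≥0∞ := ENNReal.ofReal Λ ^ d / ENNReal.ofReal δ ^ d with hN
  have hδd : ENNReal.ofReal δ ^ d ≠ 0 := (ENNReal.pow_pos (ENNReal.ofReal_pos.2 hδ0) _).ne'
  have hδt : ENNReal.ofReal δ ^ d ≠ ∞ := ENNReal.pow_ne_top ENNReal.ofReal_ne_top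
  have hNt : N ≠ ∞ := ENNReal.div_ne_top (ENNReal.pow_ne_top ENNReal.ofReal_ne_top) hδd
  -- The `2` comes from enlarging the cube in `oscInt_le_two_mul`, the other two factors from
  -- doubling of the measures `a` and `k`.
  have hCt : 2 * (appConst p mu * N) * (appConst q lam * N) ≠ ∞ :=
    ENNReal.mul_ne_top (ENNReal.mul_ne_top (by simp) (ENNReal.mul_ne_top hA.K_ne_top hNt))
      (ENNReal.mul_ne_top hC.K_ne_top hNt)
  obtain ⟨ε', hε', hεC⟩ := ENNReal.exists_ne_zero_mul_le hε hCt
  -- The decay along translates is not uniform in the cube, but one reference cube suffices: a cube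
  -- with side in `(δ, Λ)` lies in the translate of `Q₀` to its corner, and the volumes have ratio
  -- at most `N`.
  let Q₀ : Cube d := ⟨0, Λ, hΛ0⟩
  have hfar := (hb.far Q₀).eventually_lt_const (pos_iff_ne_zero.2 hε')
  rw [← Metric.cobounded_eq_cocompact,
    (Metric.hasBasis_cobounded_compl_closedBall (0 : Rd d)).eventually_iff] at hfar
  obtain ⟨ρ, -, hρ⟩ := hfar
  refine ⟨max (max δ⁻¹ Λ) ρ, lt_max_of_lt_left (lt_max_of_lt_right hΛ0), fun P => ?_⟩
  have hRδ : δ⁻¹ ≤ max (max δ⁻¹ Λ) ρ := (le_max_left _ _).trans (le_max_left _ _)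
  have hRΛ : Λ ≤ max (max δ⁻¹ Λ) ρ := (le_max_right _ _).trans (le_max_left _ _)
  have hRρ : ρ ≤ max (max δ⁻¹ Λ) ρ := le_max_right _ _
  by_cases h1 : P.side ≤ δ
  · left
    refine (hosc P).trans ?_
    gcongr
    exact (le_iSup₂ (f := fun (Q : Cube d) (_ : Q.side ≤ δ) =>
      osc α (bloomWeight p q mu lam) b Q) P h1).trans hδ.le
  by_cases h2 : Λ ≤ P.side
  · left
    refine (hosc P).trans ?_
    gcongr
    exact (le_iSup₂ (f := fun (Q : Cube d) (_ : Λ ≤ Q.side) =>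
      osc α (bloomWeight p q mu lam) b Q) P h2).trans hΛ.le
  rw [not_le] at h1 h2
  by_cases h3 : P.distZero ≤ ρ
  · right
    refine ⟨⟨?_, h2.le.trans hRΛ⟩, h3.trans hRρ⟩
    rw [← inv_inv δ] at h1
    exact (inv_anti₀ (inv_pos.2 hδ0) hRδ).trans h1.le
  left
  set P' := Q₀.translate P.corner with hP'
  have hside : P'.side = Λ := rfl
  have hcor : P'.corner = P.corner := by simp [hP', Cube.translate, Q₀]
  have hPP' : P.toSet ⊆ P'.toSet := by
    intro x hx i
    rw [hside, hcor]
    have := hx i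
    exact ⟨this.1, by linarith⟩
  have hvol : volume P'.toSet ≤ N * volume P.toSet := by
    rw [volume_toSet, volume_toSet, hside, hN]
    calc ENNReal.ofReal Λ ^ d = ENNReal.ofReal Λ ^ d / ENNReal.ofReal δ ^ d *
          ENNReal.ofReal δ ^ d := (ENNReal.div_mul_cancel hδd hδt).symm
      _ ≤ _ := by gcongr
  have hosc' : osc α (bloomWeight p q mu lam) b P' ≤ ε' := by
    refine (hρ ?_).le
    rw [Set.mem_compl_iff, Metric.mem_closedBall, dist_comm, not_le]
    exact (not_le.1 h3).trans_le (Metric.infDist_le_dist_of_mem P.corner_mem)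
  have hdbl : ∀ {r r' : ℝ} {K : ℝ≥0∞} {m m' : Measure (Rd d)}, ApPair r r' K m m' →
      m P'.toSet ^ (1 / r) ≤ K * N * m P.toSet ^ (1 / r) := fun {r r' K m m'} h => by
    refine (ENNReal.rpow_le_rpow (h.measure_le P.measurableSet_toSet hPP' hvol)
      h.conj.one_div_nonneg).trans (le_of_eq ?_)
    rw [ENNReal.mul_rpow_of_nonneg _ _ h.conj.one_div_nonneg, ← ENNReal.rpow_mul,
      mul_one_div_cancel h.conj.ne_zero, ENNReal.rpow_one]
  calc oscInt b P ≤ 2 * oscInt b P' := oscInt_le_two_mul hb.memBMO.1 hPP'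
    _ ≤ 2 * (ε' * ((appConst p mu * N * a P.toSet ^ (1 / p)) *
          (appConst q lam * N * k P.toSet ^ (1 / q.conjExponent)))) := by
        gcongr
        refine (hosc P').trans ?_
        gcongr
        · exact hdbl hA
        · exact hdbl hC
    _ = 2 * (appConst p mu * N) * (appConst q lam * N) * ε' *
          (a P.toSet ^ (1 / p) * k P.toSet ^ (1 / q.conjExponent)) := by ring
    _ ≤ _ := by gcongr

end Oscillation

/-! ### Norms by duality -/

section Duality

variable {α : Type*} [MeasurableSpace α] {c : Measure α} {q q' : ℝ}

/-- The converse of Hölder's inequality. -/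
lemma lintegral_rpow_le_of_forall_lintegral_mul_le [SigmaFinite c] (hq : q.HolderConjugate q')
    {H : α → ℝ≥0∞} (hH : AEMeasurable H c) {W : ℝ≥0∞}
    (h : ∀ ψ : α → ℝ≥0∞, Measurable ψ →
      ∫⁻ x, H x * ψ x ∂c ≤ W * (∫⁻ x, ψ x ^ q' ∂c) ^ (1 / q')) :
    (∫⁻ x, H x ^ q ∂c) ^ (1 / q) ≤ W := by
  have hq0 := hq.pos
  have hq1 := hq.lt
  set H' := hH.mk H with hH'
  have hH'm : Measurable H' := hH.measurable_mk
  -- Truncation in size and to sets of finite measure makes the integral of `F n ^ q` finite, so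
  -- that it can be cancelled after testing with `F n ^ (q - 1)`.
  set F : ℕ → α → ℝ≥0∞ := fun n => (spanningSets c n).indicator fun x => min (H' x) n with hF
  have hFm : ∀ n, Measurable (F n) := fun n =>
    (hH'm.min measurable_const).indicator (measurableSet_spanningSets c n)
  have hFle : ∀ n x, F n x ≤ H' x := fun n x => by
    by_cases hx : x ∈ spanningSets c n <;> simp [hF, hx]
  have hFn : ∀ n x, F n x ^ q ≤ (spanningSets c n).indicator (fun _ => (n : ℝ≥0∞) ^ q) x :=
    fun n x => by
      by_cases hx : x ∈ spanningSets c n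
      · simp only [hF, Set.indicator_of_mem hx]
        gcongr
        exact min_le_right _ _
      · simp [hF, hx, hq0]
  have hI : ∀ n, ∫⁻ x, F n x ^ q ∂c ≠ ∞ := fun n => by
    refine ne_top_of_le_ne_top ?_ (lintegral_mono (hFn n))
    rw [lintegral_indicator_const (measurableSet_spanningSets c n)]
    exact ENNReal.mul_ne_top (ENNReal.rpow_ne_top_of_nonneg hq0.le (by simp))
      (measure_spanningSets_lt_top c n).ne
  have hle : ∀ n, ∫⁻ x, F n x ^ q ∂c ≤ W ^ q := fun n => by
    set I := ∫⁻ x, F n x ^ q ∂c with hIdef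
    have e1 : ∀ x, F n x ^ q = F n x * F n x ^ (q - 1) := fun x => by
      nth_rw 2 [← ENNReal.rpow_one (F n x)]
      rw [← ENNReal.rpow_add_of_nonneg _ _ zero_le_one (by linarith)]
      congr 1; ring
    have e2 : ∀ x, (F n x ^ (q - 1)) ^ q' = F n x ^ q := fun x => by
      rw [← ENNReal.rpow_mul, hq.sub_one_mul_conj]
    have h1 : I ≤ W * I ^ (1 / q') := by
      have h2 := h (fun x => F n x ^ (q - 1)) ((hFm n).pow_const _)
      simp only [e2] at h2
      refine le_trans ?_ h2
      rw [hIdef]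
      refine lintegral_mono_ae ?_
      filter_upwards [hH.ae_eq_mk] with x hx
      rw [e1, hx]
      gcongr
      exact hFle n x
    rcases eq_or_ne I 0 with h0 | h0
    · rw [h0]; exact zero_le
    · have h3 : I ^ (1 / q) ≤ W := by
        have h4 : I = I ^ (1 / q) * I ^ (1 / q') := by
          rw [← ENNReal.rpow_add _ _ h0 (hI n), one_div, one_div, hq.inv_add_inv_eq_one,
            ENNReal.rpow_one]
        rw [h4, ← h4] at h1
        nth_rw 1 [h4] at h1
        exact (ENNReal.mul_le_mul_iff_left
          (ENNReal.rpow_pos (pos_iff_ne_zero.2 h0) (hI n)).ne' (ENNReal.rpow_ne_top_of_nonneg hq.symm.one_div_nonneg (hI n))).1 h1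
      calc I = (I ^ (1 / q)) ^ q := by
            rw [← ENNReal.rpow_mul, one_div_mul_cancel hq0.ne', ENNReal.rpow_one]
        _ ≤ W ^ q := by gcongr
  have hlim : ∀ x, Tendsto (fun n => F n x ^ q) atTop (𝓝 (H' x ^ q)) := fun x => by
    refine (ENNReal.continuous_rpow_const.tendsto (H' x)).comp ?_
    have h1 : Tendsto (fun n : ℕ => min (H' x) (n : ℝ≥0∞)) atTop (𝓝 (min (H' x) ∞)) :=
      tendsto_const_nhds.min ENNReal.tendsto_nat_nhds_top
    rw [min_eq_left le_top] at h1
    refine h1.congr' ?_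
    filter_upwards [eventually_ge_atTop (spanningSetsIndex c x)] with n hn
    simp only [hF]
    rw [Set.indicator_of_mem (mem_spanningSets_of_index_le c x hn)]
  have hfin : ∫⁻ x, H x ^ q ∂c ≤ W ^ q := by
    calc ∫⁻ x, H x ^ q ∂c = ∫⁻ x, liminf (fun n => F n x ^ q) atTop ∂c := by
          refine lintegral_congr_ae ?_
          filter_upwards [hH.ae_eq_mk] with x hx
          rw [(hlim x).liminf_eq, hx]
      _ ≤ liminf (fun n => ∫⁻ x, F n x ^ q ∂c) atTop :=
          lintegral_liminf_le fun n => (hFm n).pow_const q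
      _ ≤ liminf (fun _ : ℕ => W ^ q) atTop :=
          liminf_le_liminf (Eventually.of_forall hle)
      _ = W ^ q := liminf_const _
  calc (∫⁻ x, H x ^ q ∂c) ^ (1 / q) ≤ (W ^ q) ^ (1 / q) := by gcongr
    _ = W := by rw [← ENNReal.rpow_mul, mul_one_div_cancel hq0.ne', ENNReal.rpow_one]

lemma lintegral_tsum_rpow_le_of_forall [SigmaFinite c] (hq : q.HolderConjugate q')
    {ι : Type*} [Countable ι] {H : ι → α → ℝ≥0∞} (hH : ∀ i, AEMeasurable (H i) c) {W : ℝ≥0∞}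
    (h : ∀ ψ : α → ℝ≥0∞, Measurable ψ →
      ∑' i, ∫⁻ x, H i x * ψ x ∂c ≤ W * (∫⁻ x, ψ x ^ q' ∂c) ^ (1 / q')) :
    (∫⁻ x, (∑' i, H i x) ^ q ∂c) ^ (1 / q) ≤ W := by
  refine lintegral_rpow_le_of_forall_lintegral_mul_le hq (AEMeasurable.tsum hH)
    fun ψ hψ => ?_
  refine le_trans (le_of_eq ?_) (h ψ hψ)
  simp_rw [← ENNReal.tsum_mul_right]
  exact lintegral_tsum fun i => (hH i).mul hψ.aemeasurable

end Duality

/-! ### Functions as densities of the dual weight -/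

section Density

variable {p : ℝ} {w : Rd d → ℝ} {f : Rd d → ℂ}

lemma MemLpw.aestronglyMeasurable (hw : IsWeight w) (hf : MemLpw p w f) :
    AEStronglyMeasurable f volume :=
  hf.1.mono_ac (hw.absolutelyContinuous p)

lemma normLpw_eq (hp : 0 < p) (f : Rd d → ℂ) :
    normLpw p w f = (∫⁻ x, ‖f x‖ₑ ^ p ∂powMeasure p w) ^ (1 / p) := by
  rw [normLpw, eLpNorm_eq_lintegral_rpow_enorm_toReal (by simpa using hp) ENNReal.ofReal_ne_top,
    ENNReal.toReal_ofReal hp.le]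

/-- A function of `L^p_w` as a density with respect to the dual weight. -/
lemma MemLpw.exists_density (hp : 1 < p) (hw : IsWeight w) (hf : MemLpw p w f) :
    ∃ φ : Rd d → ℝ≥0∞, Measurable φ ∧
      (powMeasure (-p.conjExponent) w).withDensity φ = volume.withDensity (fun x => ‖f x‖ₑ) ∧
      (∫⁻ x, φ x ^ p ∂powMeasure (-p.conjExponent) w) ^ (1 / p) = normLpw p w f := by
  have hc := Real.HolderConjugate.conjExponent hp
  set p' := p.conjExponent
  have hfm := (hf.aestronglyMeasurable hw).enorm
  -- The density is `|f| w^p'`. The norms agree because `p p' - p' = p`.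
  have hφ₀ : AEMeasurable fun x => ‖f x‖ₑ * ENNReal.ofReal (w x ^ p') :=
    hfm.mul (hw.aemeasurable_rpow p')
  have hpos := fun x => Real.rpow_pos_of_pos (hw.1 x)
  refine ⟨hφ₀.mk _, hφ₀.measurable_mk, ?_, ?_⟩
  · rw [powMeasure, ← withDensity_mul₀ (hw.aemeasurable_rpow _) hφ₀.measurable_mk.aemeasurable]
    refine withDensity_congr_ae ?_
    filter_upwards [hφ₀.ae_eq_mk] with x hx
    rw [Pi.mul_apply, ← hx, mul_comm, mul_assoc, ← ENNReal.ofReal_mul (hpos x p').le,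
      ← Real.rpow_add (hw.1 x), add_neg_cancel, Real.rpow_zero, ENNReal.ofReal_one, mul_one]
  · rw [normLpw_eq hc.pos]
    congr 1
    rw [powMeasure, powMeasure, lintegral_withDensity_eq_lintegral_mul₀ (hw.aemeasurable_rpow _)
      (hφ₀.measurable_mk.pow_const _).aemeasurable,
      lintegral_withDensity_eq_lintegral_mul₀ (hw.aemeasurable_rpow _) (hfm.pow_const _)]
    refine lintegral_congr_ae ?_
    filter_upwards [hφ₀.ae_eq_mk] with x hx
    rw [Pi.mul_apply, Pi.mul_apply, ← hx, ENNReal.mul_rpow_of_nonneg _ _ hc.nonneg,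
      mul_left_comm, mul_comm]
    congr 1
    rw [ENNReal.ofReal_rpow_of_pos (hpos x p'), ← ENNReal.ofReal_mul (hpos x _).le,
      ← Real.rpow_mul (hw.1 x).le, ← Real.rpow_add (hw.1 x)]
    congr 2
    have := hc.symm.sub_one_mul_conj
    have := hc.mul_eq_add
    linarith

end Density

/-! ### Pointwise majorants and their norms -/

section Majorants

variable {p p' q q' : ℝ} {K : ℝ≥0∞} {a s c k : Measure (Rd d)} {b f : Rd d → ℂ}
  {φ : Rd d → ℝ≥0∞} {W : ℝ≥0∞} {T : Set (Cube d)} {γ : ℝ≥0∞} {E : Cube d → Set (Rd d)}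

/-- The bound of the bilinear form of the sparse commutator over the family `T`. -/
def OscFormBound (p q' : ℝ) (b : Rd d → ℂ) (s c : Measure (Rd d)) (T : Set (Cube d))
    (W : ℝ≥0∞) : Prop :=
  ∀ φ ψ : Rd d → ℝ≥0∞, Measurable φ → Measurable ψ →
    ∑' Q : T, oscForm b s c φ ψ Q ≤
      W * (∫⁻ x, φ x ^ p ∂s) ^ (1 / p) * (∫⁻ x, ψ x ^ q' ∂c) ^ (1 / q')

/-- The pointwise majorant of `sparseTerm`. -/
def sparseMaj (f : Rd d → ℂ) (Q : Cube d) : Rd d → ℝ≥0∞ :=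
  Q.toSet.indicator fun _ => (∫⁻ y in Q.toSet, ‖f y‖ₑ) / volume Q.toSet

/-- The pointwise majorant of `commTerm`. -/
def commMaj (b f : Rd d → ℂ) (Q : Cube d) : Rd d → ℝ≥0∞ :=
  Q.toSet.indicator fun x => ‖b x - avg b Q‖ₑ * ((∫⁻ y in Q.toSet, ‖f y‖ₑ) / volume Q.toSet)

/-- The pointwise majorant of `commAdjTerm`. -/
def adjMaj (b f : Rd d → ℂ) (Q : Cube d) : Rd d → ℝ≥0∞ :=
  Q.toSet.indicator fun _ =>
    (∫⁻ y in Q.toSet, ‖b y - avg b Q‖ₑ * ‖f y‖ₑ) / volume Q.toSet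

lemma aemeasurable_enorm_sub_avg (hb : LocallyIntegrable b volume) (Q : Cube d) :
    AEMeasurable fun x => ‖b x - avg b Q‖ₑ :=
  (hb.aestronglyMeasurable.sub aestronglyMeasurable_const).enorm

lemma withDensity_enorm_cube (hφ : s.withDensity φ = volume.withDensity fun x => ‖f x‖ₑ)
    (Q : Cube d) : s.withDensity φ Q.toSet = ∫⁻ y in Q.toSet, ‖f y‖ₑ := by
  rw [hφ, withDensity_apply _ Q.measurableSet_toSet]

lemma setLIntegral_withDensity_enorm (hf : AEStronglyMeasurable f volume)
    (hφ : s.withDensity φ = volume.withDensity fun x => ‖f x‖ₑ)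
    (hb : LocallyIntegrable b volume) (Q : Cube d) :
    ∫⁻ x in Q.toSet, ‖b x - avg b Q‖ₑ ∂s.withDensity φ =
      ∫⁻ y in Q.toSet, ‖b y - avg b Q‖ₑ * ‖f y‖ₑ := by
  rw [hφ, restrict_withDensity Q.measurableSet_toSet,
    lintegral_withDensity_eq_lintegral_mul₀ hf.enorm.restrict
      (aemeasurable_enorm_sub_avg hb Q).restrict]
  simp_rw [Pi.mul_apply, mul_comm]

lemma lintegral_commMaj_mul (hc : c ≪ volume) (hb : LocallyIntegrable b volume)
    (hφ : s.withDensity φ = volume.withDensity fun x => ‖f x‖ₑ)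
    {ψ : Rd d → ℝ≥0∞} (hψ : Measurable ψ) (Q : Cube d) :
    ∫⁻ x, commMaj b f Q x * ψ x ∂c = oscForm b s c φ ψ Q := by
  have hbm := (aemeasurable_enorm_sub_avg hb Q).mono_ac hc
  have h1 : ∀ x, commMaj b f Q x * ψ x = Q.toSet.indicator (fun x =>
      (∫⁻ y in Q.toSet, ‖f y‖ₑ) / volume Q.toSet * (ψ x * ‖b x - avg b Q‖ₑ)) x := fun x => by
    by_cases hx : x ∈ Q.toSet
    · simp only [commMaj, Set.indicator_of_mem hx]; ring
    · simp [commMaj, hx]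
  simp_rw [h1]
  rw [lintegral_indicator Q.measurableSet_toSet,
    lintegral_const_mul'' _ (by exact (hψ.aemeasurable.mul hbm).restrict), oscForm,
    withDensity_enorm_cube hφ, restrict_withDensity Q.measurableSet_toSet,
    lintegral_withDensity_eq_lintegral_mul₀ hψ.aemeasurable hbm.restrict]
  rfl

/-- Pairing with the adjoint majorant exchanges the two sides of the form, so the adjoint operator
is covered by the same theorems for the dual data. -/
lemma lintegral_adjMaj_mul (hb : LocallyIntegrable b volume) (hf : AEStronglyMeasurable f volume)
    (hφ : s.withDensity φ = volume.withDensity fun x => ‖f x‖ₑ)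
    {ψ : Rd d → ℝ≥0∞} (hψ : Measurable ψ) (Q : Cube d) :
    ∫⁻ x, adjMaj b f Q x * ψ x ∂c = oscForm b c s ψ φ Q := by
  have h1 : ∀ x, adjMaj b f Q x * ψ x = Q.toSet.indicator (fun x =>
      (∫⁻ y in Q.toSet, ‖b y - avg b Q‖ₑ * ‖f y‖ₑ) / volume Q.toSet * ψ x) x := fun x => by
    by_cases hx : x ∈ Q.toSet <;> simp [adjMaj, hx]
  simp_rw [h1]
  rw [lintegral_indicator Q.measurableSet_toSet, lintegral_const_mul _ hψ, oscForm,
    setLIntegral_withDensity_enorm hf hφ hb, withDensity_apply _ Q.measurableSet_toSet,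
    ENNReal.mul_comm_div, mul_comm]

lemma lintegral_sparseMaj_mul
    (hφ : s.withDensity φ = volume.withDensity fun x => ‖f x‖ₑ)
    {ψ : Rd d → ℝ≥0∞} (hψ : Measurable ψ) (Q : Cube d) :
    ∫⁻ x, sparseMaj f Q x * ψ x ∂c =
      s.withDensity φ Q.toSet / volume Q.toSet * ∫⁻ x in Q.toSet, ψ x ∂c := by
  have h1 : ∀ x, sparseMaj f Q x * ψ x = Q.toSet.indicator (fun x =>
      (∫⁻ y in Q.toSet, ‖f y‖ₑ) / volume Q.toSet * ψ x) x := fun x => by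
    by_cases hx : x ∈ Q.toSet <;> simp [sparseMaj, hx]
  simp_rw [h1]
  rw [lintegral_indicator Q.measurableSet_toSet, lintegral_const_mul _ hψ,
    withDensity_enorm_cube hφ]

lemma lintegral_tsum_commMaj_le (hC : ApPair q q' K c k) (hT : T.Countable)
    (hb : LocallyIntegrable b volume) (hφm : Measurable φ)
    (hφ : s.withDensity φ = volume.withDensity fun x => ‖f x‖ₑ)
    (hW : OscFormBound p q' b s c T W) :
    (∫⁻ x, (∑' Q : T, commMaj b f Q x) ^ q ∂c) ^ (1 / q) ≤
      W * (∫⁻ x, φ x ^ p ∂s) ^ (1 / p) := by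
  have := hT.to_subtype
  have := hC.sigmaFinite
  refine lintegral_tsum_rpow_le_of_forall hC.conj (fun Q => ?_) fun ψ hψ => ?_
  · exact (((aemeasurable_enorm_sub_avg hb Q).mono_ac hC.ac_left).mul_const _).indicator
      Q.1.measurableSet_toSet
  · simp_rw [lintegral_commMaj_mul hC.ac_left hb hφ hψ]
    exact hW φ ψ hφm hψ

lemma lintegral_tsum_adjMaj_le (hC : ApPair q q' K c k) (hT : T.Countable)
    (hb : LocallyIntegrable b volume) (hf : AEStronglyMeasurable f volume) (hφm : Measurable φ)
    (hφ : s.withDensity φ = volume.withDensity fun x => ‖f x‖ₑ)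
    (hW : OscFormBound q' p b c s T W) :
    (∫⁻ x, (∑' Q : T, adjMaj b f Q x) ^ q ∂c) ^ (1 / q) ≤
      W * (∫⁻ x, φ x ^ p ∂s) ^ (1 / p) := by
  have := hT.to_subtype
  have := hC.sigmaFinite
  refine lintegral_tsum_rpow_le_of_forall hC.conj (fun Q => ?_) fun ψ hψ => ?_
  · exact (measurable_const.indicator Q.1.measurableSet_toSet).aemeasurable
  · simp_rw [lintegral_adjMaj_mul hb hf hφ hψ]
    exact (hW ψ φ hψ hφm).trans (le_of_eq (by ring))

/-- The sparse operator is bounded on `L^p_μ`: pair with `ψ` and use the embedding for `φ` over `s`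
and for `ψ` over `a`. It serves only for the convergence of the series. -/
lemma lintegral_tsum_sparseMaj_ne_top (hA : ApPair p p' K a s) (hT : T.Countable)
    (hE : SparseSets γ T E) (hφm : Measurable φ)
    (hφ : s.withDensity φ = volume.withDensity fun x => ‖f x‖ₑ)
    (hfin : (∫⁻ x, φ x ^ p ∂s) ^ (1 / p) ≠ ∞) :
    (∫⁻ x, (∑' Q : T, sparseMaj f Q x) ^ p ∂a) ^ (1 / p) ≠ ∞ := by
  have := hT.to_subtype
  have := hA.sigmaFinite
  have hp' := hA.conj.symm.pos
  set C₁ := K * ((K * γ) ^ p' * maxConst ((K * 5 ^ d) ^ p') p) ^ (1 / p)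
  set C₂ := ((K * γ) ^ p * maxConst ((K * 5 ^ d) ^ p) p') ^ (1 / p')
  have hKγ : K * γ ≠ ∞ := ENNReal.mul_ne_top hA.K_ne_top hE.ne_top
  have hC₁ : C₁ ≠ ∞ := ENNReal.mul_ne_top hA.K_ne_top <|
    ENNReal.rpow_ne_top_of_nonneg hA.conj.one_div_nonneg <|
    ENNReal.mul_ne_top (ENNReal.rpow_ne_top_of_nonneg hp'.le hKγ)
    (maxConst_ne_top hA.symm.doubling_ne_top hA.conj.lt)
  have hC₂ : C₂ ≠ ∞ := ENNReal.rpow_ne_top_of_nonneg hA.conj.symm.one_div_nonneg <|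
    ENNReal.mul_ne_top (ENNReal.rpow_ne_top_of_nonneg hA.conj.nonneg hKγ)
    (maxConst_ne_top hA.doubling_ne_top hA.conj.symm.lt)
  refine ne_top_of_le_ne_top (ENNReal.mul_ne_top (ENNReal.mul_ne_top hC₁ hfin) hC₂)
    (lintegral_tsum_rpow_le_of_forall hA.conj (fun Q => ?_) fun ψ hψ => ?_)
  · exact (measurable_const.indicator Q.1.measurableSet_toSet).aemeasurable
  · simp_rw [lintegral_sparseMaj_mul hφ hψ]
    have h1 : ∀ Q : Cube d, ∫⁻ x in Q.toSet, ψ x ∂a = a Q.toSet ^ (1 / p) *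
        (a Q.toSet ^ (1 / p') * ((∫⁻ x in Q.toSet, ψ x ∂a) / a Q.toSet)) := fun Q => by
      rw [← mul_assoc, ← ENNReal.rpow_add _ _ (hA.ne_zero Q) (hA.ne_top Q), one_div, one_div,
        hA.conj.inv_add_inv_eq_one, ENNReal.rpow_one,
        ENNReal.mul_div_cancel (hA.ne_zero Q) (hA.ne_top Q)]
    have h2 : ∀ Q : Cube d, (a Q.toSet ^ (1 / p') * ((∫⁻ x in Q.toSet, ψ x ∂a) / a Q.toSet)) ^ p' =
        a Q.toSet * ((∫⁻ x in Q.toSet, ψ x ∂a) / a Q.toSet) ^ p' := fun Q => by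
      rw [ENNReal.mul_rpow_of_nonneg _ _ hp'.le, ← ENNReal.rpow_mul, one_div_mul_cancel hp'.ne',
        ENNReal.rpow_one]
    calc _ = ∑' Q : T, s.withDensity φ (Q : Cube d).toSet / volume (Q : Cube d).toSet *
          (a (Q : Cube d).toSet ^ (1 / p) * (a (Q : Cube d).toSet ^ (1 / p') *
            ((∫⁻ x in (Q : Cube d).toSet, ψ x ∂a) / a (Q : Cube d).toSet))) :=
          tsum_congr fun Q => by rw [← h1]
      _ ≤ _ := hA.tsum_average_mul_le hE hφm _
      _ ≤ C₁ * (∫⁻ x, φ x ^ p ∂s) ^ (1 / p) * (((K * γ) ^ p * maxConst ((K * 5 ^ d) ^ p) p') *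
            ∫⁻ x, ψ x ^ p' ∂a) ^ (1 / p') := by
          simp_rw [h2]
          gcongr
          · rw [mul_assoc]
            exact hA.tsum_average_rpow_le hE hψ hA.conj.symm.lt
      _ = _ := by
          rw [ENNReal.mul_rpow_of_nonneg _ _ hA.conj.symm.one_div_nonneg]
          ring

end Majorants

/-! ### The terms of the series, one cube at a time -/

section Terms

variable {b f : Rd d → ℂ} {Q : Cube d}

lemma enorm_avg_le (f : Rd d → ℂ) (Q : Cube d) :
    ‖avg f Q‖ₑ ≤ (∫⁻ y in Q.toSet, ‖f y‖ₑ) / volume Q.toSet := by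
  rw [avg, setAverage_eq, enorm_smul, ENNReal.div_eq_inv_mul]
  gcongr
  · rw [Measure.real, ← ENNReal.toReal_inv, Real.enorm_eq_ofReal ENNReal.toReal_nonneg]
    exact ENNReal.ofReal_toReal_le
  · exact enorm_integral_le_lintegral_enorm _

lemma avg_add {f g : Rd d → ℂ} (hf : IntegrableOn f Q.toSet) (hg : IntegrableOn g Q.toSet) :
    avg (fun x => f x + g x) Q = avg f Q + avg g Q := by
  rw [avg, avg, avg, setAverage_eq, setAverage_eq, setAverage_eq, integral_add hf hg, smul_add]

lemma avg_const_mul (z : ℂ) (f : Rd d → ℂ) (Q : Cube d) :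
    avg (fun x => z * f x) Q = z * avg f Q := by
  rw [avg, avg, setAverage_eq, setAverage_eq, integral_const_mul, mul_smul_comm]

lemma avg_mul_eq (hf : IntegrableOn f Q.toSet)
    (hbf : IntegrableOn (fun y => (b y - avg b Q) * f y) Q.toSet) :
    avg (fun y => b y * f y) Q = avg (fun y => (b y - avg b Q) * f y) Q + avg b Q * avg f Q := by
  rw [← avg_const_mul, ← avg_add hbf (hf.const_mul _)]
  congr 1; ext y; ring

lemma enorm_sparseTerm_le (f : Rd d → ℂ) (Q : Cube d) (x : Rd d) :
    ‖sparseTerm f Q x‖ₑ ≤ sparseMaj f Q x := by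
  by_cases hx : x ∈ Q.toSet
  · simpa [sparseTerm, sparseMaj, hx] using enorm_avg_le f Q
  · simp [sparseTerm, sparseMaj, hx]

lemma enorm_ofReal_norm (z : ℂ) : ‖(‖z‖ : ℂ)‖ₑ = ‖z‖ₑ := by
  rw [← ofReal_norm, Complex.norm_real, norm_norm, ofReal_norm]

lemma enorm_commTerm_le (b f : Rd d → ℂ) (Q : Cube d) (x : Rd d) :
    ‖commTerm b f Q x‖ₑ ≤ commMaj b f Q x := by
  by_cases hx : x ∈ Q.toSet
  · simp only [commTerm, commMaj, Set.indicator_of_mem hx, enorm_mul, enorm_ofReal_norm]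
    gcongr
    exact enorm_avg_le f Q
  · simp [commTerm, commMaj, hx]

lemma enorm_commAdjTerm_le (b f : Rd d → ℂ) (Q : Cube d) (x : Rd d) :
    ‖commAdjTerm b f Q x‖ₑ ≤ adjMaj b f Q x := by
  by_cases hx : x ∈ Q.toSet
  · simp only [commAdjTerm, adjMaj, Set.indicator_of_mem hx]
    refine (enorm_avg_le _ Q).trans (le_of_eq ?_)
    simp_rw [enorm_mul, enorm_ofReal_norm]
  · simp [commAdjTerm, adjMaj, hx]

/-- Subtracting `avg b Q` from `b` in both places leaves the difference unchanged; the two resulting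
terms are those of the two sparse commutators. -/
lemma enorm_mul_sparseTerm_sub_le (hf : IntegrableOn f Q.toSet)
    (hbf : IntegrableOn (fun y => (b y - avg b Q) * f y) Q.toSet) (x : Rd d) :
    ‖b x * sparseTerm f Q x - sparseTerm (fun y => b y * f y) Q x‖ₑ ≤
      commMaj b f Q x + adjMaj b f Q x := by
  by_cases hx : x ∈ Q.toSet
  · simp only [sparseTerm, commMaj, adjMaj, Set.indicator_of_mem hx]
    rw [avg_mul_eq hf hbf, show b x * avg f Q - (avg (fun y => (b y - avg b Q) * f y) Q +
      avg b Q * avg f Q) = (b x - avg b Q) * avg f Q - avg (fun y => (b y - avg b Q) * f y) Q by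
      ring]
    refine enorm_sub_le.trans (add_le_add ?_ ?_)
    · rw [enorm_mul]
      gcongr
      exact enorm_avg_le f Q
    · refine (enorm_avg_le _ Q).trans (le_of_eq ?_)
      simp_rw [enorm_mul]
  · simp [sparseTerm, commMaj, adjMaj, hx]

lemma enorm_sparseTerm_mul_le (hf : IntegrableOn f Q.toSet)
    (hbf : IntegrableOn (fun y => (b y - avg b Q) * f y) Q.toSet) (x : Rd d) :
    ‖sparseTerm (fun y => b y * f y) Q x‖ₑ ≤
      ‖b x‖ₑ * sparseMaj f Q x + (commMaj b f Q x + adjMaj b f Q x) := by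
  rw [show sparseTerm (fun y => b y * f y) Q x = b x * sparseTerm f Q x -
    (b x * sparseTerm f Q x - sparseTerm (fun y => b y * f y) Q x) by ring]
  refine enorm_sub_le.trans (add_le_add ?_ (enorm_mul_sparseTerm_sub_le hf hbf x))
  rw [enorm_mul]
  gcongr
  exact enorm_sparseTerm_le f Q x

lemma commSparseOp_eq_tsum {S : Set (Cube d)} {x : Rd d}
    (h₁ : Summable fun Q : S => ‖sparseTerm f Q x‖)
    (h₂ : Summable fun Q : S => ‖sparseTerm (fun y => b y * f y) Q x‖) :
    commSparseOp b S f x =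
      ∑' Q : S, (b x * sparseTerm f Q x - sparseTerm (fun y => b y * f y) Q x) := by
  rw [commSparseOp, sparseOp, sparseOp, ← tsum_mul_left,
    (h₁.of_norm.mul_left (b x)).tsum_sub h₂.of_norm]

end Terms

/-! ### Integrability on a single cube -/

section Duality

variable {p p' q q' : ℝ} {K : ℝ≥0∞} {a s c k : Measure (Rd d)} {b f : Rd d → ℂ}
  {φ : Rd d → ℝ≥0∞} {W : ℝ≥0∞} {T : Set (Cube d)} {γ : ℝ≥0∞} {E : Cube d → Set (Rd d)}

lemma OscFormBound.mono {S T : Set (Cube d)} (h : OscFormBound p q' b s c S W) (hT : T ⊆ S) :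
    OscFormBound p q' b s c T W := fun φ ψ hφ hψ =>
  (ENNReal.tsum_comp_le_tsum_of_injective (Set.inclusion_injective hT)
    fun Q : S => oscForm b s c φ ψ Q).trans (h φ ψ hφ hψ)

/-- On a single cube of the family, the oscillation is integrable against densities. -/
lemma OscFormBound.exists_cube_le (hA : ApPair p p' K a s) (hW : OscFormBound p q' b s c T W)
    (hWt : W ≠ ∞) {Q : Cube d} (hQ : Q ∈ T) :
    ∃ C : ℝ≥0∞, C ≠ ∞ ∧ ∀ ψ : Rd d → ℝ≥0∞, Measurable ψ →
      ∫⁻ x in Q.toSet, ‖b x - avg b Q‖ₑ ∂c.withDensity ψ ≤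
        C * (∫⁻ x, ψ x ^ q' ∂c) ^ (1 / q') := by
  have hs0 := hA.symm.ne_zero Q
  have hst := hA.symm.ne_top Q
  have hp := hA.conj.pos
  refine ⟨volume Q.toSet / s Q.toSet * (W * s Q.toSet ^ (1 / p)),
    ENNReal.mul_ne_top (ENNReal.div_ne_top Q.volume_ne_top hs0)
      (ENNReal.mul_ne_top hWt (ENNReal.rpow_ne_top_of_nonneg hA.conj.one_div_nonneg hst)),
    fun ψ hψ => ?_⟩
  -- With the indicator of `Q` as `φ`, the first factor of the form is `s Q / volume Q`, positive
  -- and finite, and can be divided out.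
  set φ : Rd d → ℝ≥0∞ := Q.toSet.indicator fun _ => 1 with hφ
  have hφm : Measurable φ := measurable_const.indicator Q.measurableSet_toSet
  have h1 : ∀ x, φ x ^ p = φ x := fun x => by
    by_cases hx : x ∈ Q.toSet <;> simp [hφ, hx, hp]
  have h2 := (ENNReal.le_tsum (⟨Q, hQ⟩ : T)).trans (hW φ ψ hφm hψ)
  simp only [h1] at h2
  have h3 : s.withDensity φ Q.toSet = s Q.toSet := by
    rw [withDensity_apply _ Q.measurableSet_toSet,
      setLIntegral_congr_fun Q.measurableSet_toSet (g := fun _ => 1) fun x hx => by simp [hφ, hx],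
      setLIntegral_one]
  have h4 : ∫⁻ x, φ x ∂s = s Q.toSet := by
    rw [lintegral_indicator_const Q.measurableSet_toSet, one_mul]
  rw [oscForm, h3, h4] at h2
  set J := ∫⁻ x in Q.toSet, ‖b x - avg b Q‖ₑ ∂c.withDensity ψ
  calc J = volume Q.toSet / s Q.toSet * (s Q.toSet / volume Q.toSet * J) := by
        rw [← mul_assoc, div_eq_mul_inv, div_eq_mul_inv, mul_assoc (volume Q.toSet),
          ← mul_assoc (s Q.toSet)⁻¹, ENNReal.inv_mul_cancel hs0 hst, one_mul,
          ENNReal.mul_inv_cancel Q.volume_ne_zero Q.volume_ne_top, one_mul]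
    _ ≤ _ := by
        rw [mul_assoc]
        gcongr

/-- The converse of Hölder's inequality applied to the bound on a single cube: the oscillation on a
cube of the family lies in `L^q_λ`, although `b` is only assumed locally integrable. -/
lemma OscFormBound.indicator_rpow_ne_top (hA : ApPair p p' K a s) (hC : ApPair q q' K c k)
    (hb : LocallyIntegrable b volume) (hW : OscFormBound p q' b s c T W)
    (hWt : W ≠ ∞) {Q : Cube d} (hQ : Q ∈ T) :
    (∫⁻ x, Q.toSet.indicator (fun x => ‖b x - avg b Q‖ₑ) x ^ q ∂c) ^ (1 / q) ≠ ∞ := by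
  obtain ⟨C, hCt, h⟩ := hW.exists_cube_le hA hWt hQ
  have := hC.sigmaFinite
  have hbm := (aemeasurable_enorm_sub_avg hb Q).mono_ac hC.ac_left
  refine ne_top_of_le_ne_top hCt (lintegral_rpow_le_of_forall_lintegral_mul_le hC.conj
    (hbm.indicator Q.measurableSet_toSet) fun ψ hψ => le_trans (le_of_eq ?_) (h ψ hψ))
  rw [restrict_withDensity Q.measurableSet_toSet,
    lintegral_withDensity_eq_lintegral_mul₀ hψ.aemeasurable hbm.restrict,
    ← lintegral_indicator Q.measurableSet_toSet]
  congr 1; ext x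
  by_cases hx : x ∈ Q.toSet <;> simp [hx, mul_comm]

end Duality

/-! ### Countability and local finiteness of sparse families -/

section Sparse

variable {S : Set (Cube d)}

lemma IsSparse.exists_sparseSets (hS : IsSparse S) : ∃ γ E, SparseSets (d := d) γ S E := by
  obtain ⟨γ, hγ, -, E, hE, h⟩ := hS
  have h0 : ENNReal.ofReal γ ≠ 0 := (ENNReal.ofReal_pos.2 hγ).ne'
  refine ⟨(ENNReal.ofReal γ)⁻¹, E, hE, fun Q hQ => (h Q hQ).1, fun Q hQ => (h Q hQ).2.1,
    fun Q hQ => ?_, ENNReal.inv_ne_top.2 h0⟩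
  rw [← ENNReal.mul_le_iff_le_inv h0 ENNReal.ofReal_ne_top]
  exact (h Q hQ).2.2.le

lemma SparseSets.measure_pos {γ : ℝ≥0∞} {E : Cube d → Set (Rd d)} (h : SparseSets γ S E)
    {Q : Cube d} (hQ : Q ∈ S) : 0 < volume (E Q) := by
  refine pos_iff_ne_zero.2 fun h0 => Q.volume_ne_zero ?_
  simpa [h0] using h.le Q hQ

lemma SparseSets.pairwise {γ : ℝ≥0∞} {E : Cube d → Set (Rd d)} (h : SparseSets γ S E) :
    Pairwise (Function.onFun Disjoint fun Q : S => E Q) := fun P Q hPQ =>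
  h.disj P.2 Q.2 (Subtype.coe_injective.ne hPQ)

lemma SparseSets.countable {γ : ℝ≥0∞} {E : Cube d → Set (Rd d)} (h : SparseSets γ S E) :
    S.Countable := by
  have h1 := Measure.countable_meas_pos_of_disjoint_iUnion (μ := (volume : Measure (Rd d)))
    (fun Q : S => h.meas Q Q.2) h.pairwise
  rw [show {Q : S | 0 < volume (E Q)} = Set.univ from
    Set.eq_univ_of_forall fun Q => h.measure_pos Q.2] at h1
  exact Set.countable_coe_iff.1 (Set.countable_univ_iff.1 h1)

/-- Only finitely many cubes of a sparse family have controlled size and position. -/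
lemma SparseSets.finite_sdiff_truncated {γ : ℝ≥0∞} {E : Cube d → Set (Rd d)}
    (h : SparseSets γ S E) {R : ℝ} (hR : 0 < R) : (S \ truncated S R).Finite := by
  set U := S \ truncated S R with hU
  have hUS : U ⊆ S := Set.sdiff_subset
  have hP : ∀ P ∈ U, R⁻¹ ≤ P.side ∧ P.side ≤ R ∧ P.distZero ≤ R := fun P hP => by
    by_contra hcon
    exact hP.2 ⟨hP.1, fun h' => hcon ⟨h'.2.1.1, h'.2.1.2, h'.2.2⟩⟩
  have hE := h.mono hUS
  set B : Cube d := ⟨WithLp.toLp 2 fun _ => -(2 * R + 1), 2 * (2 * R + 1), by linarith⟩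
  have hv0 : ENNReal.ofReal R⁻¹ ^ d ≠ 0 :=
    (ENNReal.pow_pos (ENNReal.ofReal_pos.2 (inv_pos.2 hR)) _).ne'
  -- The sets `E Q` are disjoint, lie in one bounded cube, and have volume bounded below.
  have h1 := Measure.finite_const_le_meas_of_disjoint_iUnion (volume : Measure (Rd d))
    (ε := ENNReal.ofReal R⁻¹ ^ d / γ) (pos_iff_ne_zero.2 (ENNReal.div_ne_zero.2 ⟨hv0, h.ne_top⟩))
    (fun Q : U => hE.meas Q Q.2) hE.pairwise
    (ne_top_of_le_ne_top B.volume_ne_top (measure_mono (Set.iUnion_subset fun Q =>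
      (hE.sub Q Q.2).trans (Cube.subset_of_distZero_le hR (hP Q Q.2).2.1 (hP Q Q.2).2.2))))
  rw [show {Q : U | ENNReal.ofReal R⁻¹ ^ d / γ ≤ volume (E Q)} = Set.univ from
    Set.eq_univ_of_forall fun Q => ?_] at h1
  · exact Set.finite_coe_iff.1 (Set.finite_univ_iff.1 h1)
  · refine ENNReal.div_le_of_le_mul' (le_trans ?_ (hE.le Q Q.2))
    rw [Cube.volume_toSet]
    gcongr
    exact (hP Q Q.2).1

lemma truncated_subset_truncated {R R' : ℝ} (hR : 0 < R) (h : R ≤ R') :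
    truncated S R' ⊆ truncated S R := fun _ hQ => ⟨hQ.1, fun h' => hQ.2 ⟨hQ.1,
      ⟨(inv_anti₀ hR h).trans h'.2.1.1, h'.2.1.2.trans h⟩, h'.2.2.trans h⟩⟩

end Sparse

/-! ### Series of compact operators -/

section Compact

variable {F : Type*} [NormedAddCommGroup F] [NormedSpace ℂ F] {α : Type*} [MeasurableSpace α]
  {m : Measure α} {r : ℝ≥0∞} {ι : Type*}

lemma Lp.coeFn_finset_sum (v : ι → Lp ℂ r m) (t : Finset ι) :
    ⇑(∑ i ∈ t, v i) =ᵐ[m] fun x => ∑ i ∈ t, v i x := by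
  classical
  induction t using Finset.induction_on with
  | empty =>
    simp only [Finset.sum_empty]
    exact Lp.coeFn_zero ℂ r m
  | insert i t hi ih =>
    rw [Finset.sum_insert hi]
    filter_upwards [Lp.coeFn_add (v i) (∑ j ∈ t, v j), ih] with x h1 h2
    rw [h1, Pi.add_apply, h2, Finset.sum_insert hi]

/-- A series of compact operators into an `L^r` space converges to a compact operator if the
pointwise tails of the series are uniformly small in norm. -/
theorem exists_isCompactOperator_tsum [Fact (1 ≤ r)] [Countable ι] (T : ι → F →L[ℂ] Lp ℂ r m)
    (hT : ∀ i, IsCompactOperator (T i))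
    (hsum : ∀ f, ∀ᵐ x ∂m, Summable fun i => T i f x)
    (htail : ∀ ε : ℝ≥0∞, ε ≠ 0 → ∃ t : Finset ι, ∀ f : F,
      eLpNorm (fun x => ∑' i : {i // i ∉ t}, ‖T i f x‖ₑ) r m ≤ ε * ‖f‖ₑ) :
    ∃ T₀ : F →L[ℂ] Lp ℂ r m, IsCompactOperator T₀ ∧ ∀ f, T₀ f =ᵐ[m] fun x => ∑' i, T i f x := by
  classical
  have hfin : ∀ (t u : Finset ι) (f : F), Disjoint u t →
      ‖∑ i ∈ u, T i f‖ₑ ≤ eLpNorm (fun x => ∑' i : {i // i ∉ t}, ‖T i f x‖ₑ) r m := by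
    intro t u f hut
    rw [Lp.enorm_def]
    refine eLpNorm_mono_enorm_ae ?_
    filter_upwards [Lp.coeFn_finset_sum (fun i => T i f) u] with x hx
    rw [hx, enorm_eq_self]
    refine (enorm_sum_le _ _).trans ?_
    rw [← Finset.sum_subtype_of_mem (fun i => ‖T i f x‖ₑ) (p := fun i => i ∉ t)
      fun i hi => Finset.disjoint_left.1 hut hi]
    exact ENNReal.sum_le_tsum _
  -- The tail condition gives summability in operator norm, so the sum is a norm limit of compact
  -- finite sums.
  have hsm : Summable T := by
    rw [summable_iff_vanishing_norm]
    intro ε hε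
    obtain ⟨t, ht⟩ := htail (ENNReal.ofReal (ε / 2)) (ENNReal.ofReal_pos.2 (half_pos hε)).ne'
    refine ⟨t, fun u hu => lt_of_le_of_lt ?_ (half_lt_self hε)⟩
    refine ContinuousLinearMap.opNorm_le_bound _ (half_pos hε).le fun f => ?_
    have h1 := (hfin t u f hu).trans (ht f)
    rw [← ofReal_norm, ← ofReal_norm, ← ENNReal.ofReal_mul (half_pos hε).le,
      ENNReal.ofReal_le_ofReal_iff (by positivity)] at h1
    rwa [sum_apply]
  refine ⟨∑' i, T i, isCompactOperator_of_tendsto hsm.hasSum (Eventually.of_forall fun t =>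
    Finset.sum_induction T (fun A => IsCompactOperator A) (fun _ _ h1 h2 => h1.add h2)
      isCompactOperator_zero fun i _ => hT i), fun f => ?_⟩
  set T₀ := ∑' i, T i with hT₀
  have hlim : Tendsto (fun u : Finset ι => ∑ i ∈ u, T i f) atTop (𝓝 (T₀ f)) := by
    have h1 : HasSum (fun i => T i f) (T₀ f) :=
      (ContinuousLinearMap.apply ℂ (Lp ℂ r m) f).hasSum hsm.hasSum
    exact h1
  have hgm : AEStronglyMeasurable (fun x => ∑' i, T i f x) m :=
    (AEMeasurable.tsum fun i => (Lp.aestronglyMeasurable (T i f)).aemeasurable).aestronglyMeasurable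
  -- The norm limit and the pointwise sum are compared through a finite partial sum; each differs
  -- from it by at most one tail.
  have key : ∀ ε : ℝ≥0∞, ε ≠ 0 →
      eLpNorm (fun x => T₀ f x - ∑' i, T i f x) r m ≤ (2 * ‖f‖ₑ) * ε := by
    intro ε hε
    obtain ⟨t, ht⟩ := htail ε hε
    have h1 : ‖T₀ f - ∑ i ∈ t, T i f‖ₑ ≤ ε * ‖f‖ₑ := by
      refine le_of_tendsto ((hlim.sub_const (∑ i ∈ t, T i f)).enorm) ?_
      filter_upwards [eventually_ge_atTop t] with u hu
      rw [← Finset.sum_sdiff hu, add_sub_cancel_right]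
      exact (hfin t _ f Finset.sdiff_disjoint).trans (ht f)
    have h2 : eLpNorm (fun x => (∑ i ∈ t, T i f : Lp ℂ r m) x - ∑' i, T i f x) r m ≤
        ε * ‖f‖ₑ := by
      refine (eLpNorm_mono_enorm_ae ?_).trans (ht f)
      filter_upwards [Lp.coeFn_finset_sum (fun i => T i f) t, hsum f] with x hx hs
      rw [hx, ← hs.sum_add_tsum_subtype_compl t, sub_add_cancel_left, enorm_neg, enorm_eq_self]
      exact enorm_tsum_le_tsum_enorm
    have h3 : (fun x => T₀ f x - ∑' i, T i f x) =ᵐ[m] (⇑(T₀ f - ∑ i ∈ t, T i f) +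
        fun x => (∑ i ∈ t, T i f : Lp ℂ r m) x - ∑' i, T i f x) := by
      filter_upwards [Lp.coeFn_sub (T₀ f) (∑ i ∈ t, T i f)] with x hx
      rw [Pi.add_apply, hx, Pi.sub_apply]
      ring
    rw [eLpNorm_congr_ae h3]
    refine (eLpNorm_add_le (Lp.aestronglyMeasurable _) ((Lp.aestronglyMeasurable _).sub hgm)
      Fact.out).trans ?_
    rw [← Lp.enorm_def]
    refine (add_le_add h1 h2).trans (le_of_eq (by ring))
  have h0 : eLpNorm (fun x => T₀ f x - ∑' i, T i f x) r m = 0 := by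
    refine nonpos_iff_eq_zero.1 (le_of_forall_gt_imp_ge_of_dense fun η hη => ?_)
    obtain ⟨ε, hε, hle⟩ := ENNReal.exists_ne_zero_mul_le (C := 2 * ‖f‖ₑ) hη.ne'
      (ENNReal.mul_ne_top (by simp) enorm_ne_top)
    exact (key ε hε).trans hle
  have hsub : AEStronglyMeasurable (fun x => T₀ f x - ∑' i, T i f x) m :=
    (Lp.aestronglyMeasurable _).sub hgm
  rw [eLpNorm_eq_zero_iff hsub (zero_lt_one.trans_le (Fact.out (p := 1 ≤ r))).ne'] at h0
  filter_upwards [h0] with x hx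
  exact sub_eq_zero.1 hx

end Compact

/-! ### Well-definedness and norm bounds -/

section Setting

/-- The standing assumptions: a pair of weights, a sparse family, and a function for which the
sparse commutator forms are bounded. -/
structure BloomSetting (p q : ℝ) (K γ W : ℝ≥0∞) (mu lam : Rd d → ℝ) (b : Rd d → ℂ)
    (S : Set (Cube d)) (E : Cube d → Set (Rd d)) : Prop where
  one_lt_left : 1 < p
  one_lt_right : 1 < q
  weight_left : IsWeight mu
  weight_right : IsWeight lam
  pair_left : ApPair p p.conjExponent K (powMeasure p mu) (powMeasure (-p.conjExponent) mu)
  pair_right : ApPair q q.conjExponent K (powMeasure q lam) (powMeasure (-q.conjExponent) lam)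
  locallyIntegrable : LocallyIntegrable b volume
  sparse : SparseSets γ S E
  bound : OscFormBound p q.conjExponent b (powMeasure (-p.conjExponent) mu) (powMeasure q lam) S W
  bound_adj :
    OscFormBound q.conjExponent p b (powMeasure q lam) (powMeasure (-p.conjExponent) mu) S W
  bound_ne_top : W ≠ ∞

namespace BloomSetting

variable {p q : ℝ} {K γ W ε : ℝ≥0∞} {mu lam : Rd d → ℝ} {b f : Rd d → ℂ}
    {S T : Set (Cube d)} {E : Cube d → Set (Rd d)}

lemma exists_setLIntegral_le (h : BloomSetting p q K γ W mu lam b S E) (Q : Cube d) :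
    ∃ C : ℝ≥0∞, C ≠ ∞ ∧ ∀ f, MemLpw p mu f →
      ∫⁻ y in Q.toSet, ‖f y‖ₑ ≤ C * normLpw p mu f := by
  refine ⟨powMeasure (-p.conjExponent) mu Q.toSet ^ (1 / p.conjExponent),
    ENNReal.rpow_ne_top_of_nonneg h.pair_left.conj.symm.one_div_nonneg (h.pair_left.symm.ne_top Q),
    fun f hf => ?_⟩
  obtain ⟨φ, hφm, hφ, hN⟩ := hf.exists_density h.one_lt_left h.weight_left
  rw [← withDensity_enorm_cube hφ, ← hN, mul_comm]
  exact withDensity_cube_le h.pair_left.symm hφm Q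

lemma exists_setLIntegral_mul_le (h : BloomSetting p q K γ W mu lam b S E) {Q : Cube d}
    (hQ : Q ∈ S) : ∃ C : ℝ≥0∞, C ≠ ∞ ∧ ∀ f, MemLpw p mu f →
      ∫⁻ y in Q.toSet, ‖b y - avg b Q‖ₑ * ‖f y‖ₑ ≤ C * normLpw p mu f := by
  obtain ⟨C, hC, hle⟩ := h.bound_adj.exists_cube_le h.pair_right.symm h.bound_ne_top hQ
  refine ⟨C, hC, fun f hf => ?_⟩
  obtain ⟨φ, hφm, hφ, hN⟩ := hf.exists_density h.one_lt_left h.weight_left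
  rw [← setLIntegral_withDensity_enorm (hf.aestronglyMeasurable h.weight_left) hφ
    h.locallyIntegrable, ← hN]
  exact hle φ hφm

lemma integrableOn (h : BloomSetting p q K γ W mu lam b S E) (hf : MemLpw p mu f) (Q : Cube d) :
    IntegrableOn f Q.toSet := by
  obtain ⟨C, hC, hle⟩ := h.exists_setLIntegral_le Q
  exact ⟨(hf.aestronglyMeasurable h.weight_left).restrict,
    (hle f hf).trans_lt (ENNReal.mul_lt_top hC.lt_top hf.2)⟩

lemma integrableOn_mul (h : BloomSetting p q K γ W mu lam b S E) (hf : MemLpw p mu f) {Q : Cube d}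
    (hQ : Q ∈ S) : IntegrableOn (fun y => (b y - avg b Q) * f y) Q.toSet := by
  obtain ⟨C, hC, hle⟩ := h.exists_setLIntegral_mul_le hQ
  refine ⟨(((h.locallyIntegrable.aestronglyMeasurable.sub aestronglyMeasurable_const).mul
    (hf.aestronglyMeasurable h.weight_left))).restrict, ?_⟩
  refine lt_of_eq_of_lt ?_ ((hle f hf).trans_lt (ENNReal.mul_lt_top hC.lt_top hf.2))
  simp_rw [enorm_mul]

lemma lintegral_tsum_commMaj_le (h : BloomSetting p q K γ W mu lam b S E) (hf : MemLpw p mu f)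
    (hT : T ⊆ S) (hε : OscFormBound p q.conjExponent b (powMeasure (-p.conjExponent) mu)
      (powMeasure q lam) T ε) :
    (∫⁻ x, (∑' Q : T, commMaj b f Q x) ^ q ∂powMeasure q lam) ^ (1 / q) ≤
      ε * normLpw p mu f := by
  obtain ⟨φ, hφm, hφ, hN⟩ := hf.exists_density h.one_lt_left h.weight_left
  rw [← hN]
  exact BloomSparse.lintegral_tsum_commMaj_le h.pair_right (h.sparse.countable.mono hT)
    h.locallyIntegrable hφm hφ hε

lemma lintegral_tsum_adjMaj_le (h : BloomSetting p q K γ W mu lam b S E) (hf : MemLpw p mu f)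
    (hT : T ⊆ S) (hε : OscFormBound q.conjExponent p b (powMeasure q lam)
      (powMeasure (-p.conjExponent) mu) T ε) :
    (∫⁻ x, (∑' Q : T, adjMaj b f Q x) ^ q ∂powMeasure q lam) ^ (1 / q) ≤
      ε * normLpw p mu f := by
  obtain ⟨φ, hφm, hφ, hN⟩ := hf.exists_density h.one_lt_left h.weight_left
  rw [← hN]
  exact BloomSparse.lintegral_tsum_adjMaj_le h.pair_right (h.sparse.countable.mono hT)
    h.locallyIntegrable (hf.aestronglyMeasurable h.weight_left) hφm hφ hε

lemma aemeasurable_commMaj (h : BloomSetting p q K γ W mu lam b S E) (f : Rd d → ℂ) (Q : Cube d) :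
    AEMeasurable (commMaj b f Q) :=
  ((aemeasurable_enorm_sub_avg h.locallyIntegrable Q).mul_const _).indicator Q.measurableSet_toSet

/-- Each sum has finite norm in `L^p_μ` or `L^q_λ`, hence is finite almost everywhere for the
weighted measure, and so for Lebesgue measure because the weights are positive. -/
lemma ae_tsum_ne_top (h : BloomSetting p q K γ W mu lam b S E) (hf : MemLpw p mu f) :
    ∀ᵐ x ∂(volume : Measure (Rd d)), ∑' Q : S, sparseMaj f Q x ≠ ∞ ∧
      ∑' Q : S, commMaj b f Q x ≠ ∞ ∧ ∑' Q : S, adjMaj b f Q x ≠ ∞ := by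
  have := h.sparse.countable.to_subtype
  have hNt : normLpw p mu f ≠ ∞ := hf.2.ne
  have aux : ∀ {r : ℝ} {w : Rd d → ℝ} {H : Rd d → ℝ≥0∞}, 1 < r → IsWeight w → AEMeasurable H →
      (∫⁻ x, H x ^ r ∂powMeasure r w) ^ (1 / r) ≠ ∞ → ∀ᵐ x ∂(volume : Measure (Rd d)), H x ≠ ∞ := by
    intro r w H hr hw hH hfin
    have hr0 : 0 < r := by linarith
    refine (hw.absolutelyContinuous r).ae_le ?_
    have h1 : ∫⁻ x, H x ^ r ∂powMeasure r w ≠ ∞ := fun h' => hfin (by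
      rw [h', ENNReal.top_rpow_of_pos (by positivity)])
    filter_upwards [ae_lt_top' ((hH.mono_ac (powMeasure_ac r w)).pow_const r) h1] with x hx hx'
    rw [hx', ENNReal.top_rpow_of_pos hr0] at hx
    exact lt_irrefl _ hx
  have hm : ∀ Q : Cube d, Measurable (sparseMaj f Q) := fun Q =>
    measurable_const.indicator Q.measurableSet_toSet
  have hm' : ∀ Q : Cube d, Measurable (adjMaj b f Q) := fun Q =>
    measurable_const.indicator Q.measurableSet_toSet
  obtain ⟨φ, hφm, hφ, hN⟩ := hf.exists_density h.one_lt_left h.weight_left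
  filter_upwards [aux h.one_lt_left h.weight_left (H := fun x => ∑' Q : S, sparseMaj f Q x)
      (AEMeasurable.tsum fun Q : S => (hm Q).aemeasurable)
      (lintegral_tsum_sparseMaj_ne_top h.pair_left h.sparse.countable h.sparse hφm hφ (hN ▸ hNt)),
    aux h.one_lt_right h.weight_right (H := fun x => ∑' Q : S, commMaj b f Q x)
      (AEMeasurable.tsum fun Q : S => h.aemeasurable_commMaj f Q)
      (ne_top_of_le_ne_top (ENNReal.mul_ne_top h.bound_ne_top hNt)
        (h.lintegral_tsum_commMaj_le hf subset_rfl h.bound)),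
    aux h.one_lt_right h.weight_right (H := fun x => ∑' Q : S, adjMaj b f Q x)
      (AEMeasurable.tsum fun Q : S => (hm' Q).aemeasurable)
      (ne_top_of_le_ne_top (ENNReal.mul_ne_top h.bound_ne_top hNt)
        (h.lintegral_tsum_adjMaj_le hf subset_rfl h.bound_adj))] with x h1 h2 h3
  exact ⟨h1, h2, h3⟩

theorem wellDefinedAt (h : BloomSetting p q K γ W mu lam b S E) (hf : MemLpw p mu f) :
    WellDefinedAt b S f := by
  refine ⟨fun Q hQ => ⟨h.integrableOn hf Q, ?_, ?_⟩, ?_⟩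
  · refine ((h.integrableOn_mul hf hQ).add ((h.integrableOn hf Q).const_mul (avg b Q))).congr
      (Eventually.of_forall fun y => ?_)
    simp only [Pi.add_apply]
    ring
  · refine Integrable.mono (h.integrableOn_mul hf hQ) ?_ (Eventually.of_forall fun y => ?_)
    · exact ((Complex.continuous_ofReal.comp_aestronglyMeasurable
        (h.locallyIntegrable.aestronglyMeasurable.sub aestronglyMeasurable_const).norm).mul
        (hf.aestronglyMeasurable h.weight_left)).restrict
    · simp
  · filter_upwards [h.ae_tsum_ne_top hf] with x hx
    obtain ⟨h1, h2, h3⟩ := hx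
    have aux : ∀ {u : S → ℂ} {H : S → ℝ≥0∞}, (∀ Q, ‖u Q‖ₑ ≤ H Q) → ∑' Q, H Q ≠ ∞ →
        Summable fun Q => ‖u Q‖ := fun hle hH =>
      tsum_enorm_ne_top_iff_summable_norm.1 (ne_top_of_le_ne_top hH (ENNReal.tsum_le_tsum hle))
    refine ⟨aux (fun Q => enorm_sparseTerm_le f Q x) h1,
      aux (fun Q => enorm_sparseTerm_mul_le (h.integrableOn hf Q) (h.integrableOn_mul hf Q.2) x) ?_,
      aux (fun Q => enorm_commTerm_le b f Q x) h2, aux (fun Q => enorm_commAdjTerm_le b f Q x) h3⟩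
    -- The series for `A_S (b f)` converges where the other three majorant series do, `b x` being a
    -- fixed number.
    rw [ENNReal.tsum_add, ENNReal.tsum_add, ENNReal.tsum_mul_left]
    exact ENNReal.add_ne_top.2 ⟨ENNReal.mul_ne_top enorm_ne_top h1, ENNReal.add_ne_top.2 ⟨h2, h3⟩⟩

lemma normLpw_tsum_le {u : T → Rd d → ℂ} {H : T → Rd d → ℝ≥0∞} {M : ℝ≥0∞} (hq : 0 < q)
    (hu : ∀ Q x, ‖u Q x‖ₑ ≤ H Q x)
    (hM : (∫⁻ x, (∑' Q, H Q x) ^ q ∂powMeasure q lam) ^ (1 / q) ≤ M) :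
    normLpw q lam (fun x => ∑' Q, u Q x) ≤ M := by
  rw [normLpw_eq hq]
  refine le_trans ?_ hM
  gcongr with x
  exact enorm_tsum_le_tsum_enorm.trans (ENNReal.tsum_le_tsum fun Q => hu Q x)

lemma normLpw_sparseComm_le (h : BloomSetting p q K γ W mu lam b S E) (hf : MemLpw p mu f)
    (hT : T ⊆ S) (hε : OscFormBound p q.conjExponent b (powMeasure (-p.conjExponent) mu)
      (powMeasure q lam) T ε) :
    normLpw q lam (sparseComm b T f) ≤ ε * normLpw p mu f :=
  normLpw_tsum_le (zero_lt_one.trans h.one_lt_right) (fun Q x => enorm_commTerm_le b f Q x)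
    (h.lintegral_tsum_commMaj_le hf hT hε)

lemma normLpw_sparseCommAdj_le (h : BloomSetting p q K γ W mu lam b S E) (hf : MemLpw p mu f)
    (hT : T ⊆ S) (hε : OscFormBound q.conjExponent p b (powMeasure q lam)
      (powMeasure (-p.conjExponent) mu) T ε) :
    normLpw q lam (sparseCommAdj b T f) ≤ ε * normLpw p mu f :=
  normLpw_tsum_le (zero_lt_one.trans h.one_lt_right) (fun Q x => enorm_commAdjTerm_le b f Q x)
    (h.lintegral_tsum_adjMaj_le hf hT hε)

end BloomSetting

end Setting

/-! ### Finite rank terms and compactness -/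

namespace BloomSetting

variable {p q : ℝ} {K γ W ε : ℝ≥0∞} {mu lam : Rd d → ℝ} {b f : Rd d → ℂ}
    {S T : Set (Cube d)} {E : Cube d → Set (Rd d)}

/-- Used with `g = 1` and `g = b - avg b Q`: these functionals give the rank one pieces of each
term. -/
lemma exists_avg_clm (hmu : IsWeight mu) {g : Rd d → ℂ}
    (hg : AEStronglyMeasurable g volume) {Q : Cube d} {C : ℝ≥0∞} (hC : C ≠ ∞)
    (hle : ∀ f, MemLpw p mu f → ∫⁻ y in Q.toSet, ‖g y‖ₑ * ‖f y‖ₑ ≤ C * normLpw p mu f)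
    [Fact (1 ≤ ENNReal.ofReal p)] :
    ∃ ℓ : Lp ℂ (ENNReal.ofReal p) (powMeasure p mu) →L[ℂ] ℂ,
      ∀ f : Lp ℂ (ENNReal.ofReal p) (powMeasure p mu), ℓ f = avg (fun y => g y * f y) Q := by
  have hint : ∀ f : Rd d → ℂ, MemLpw p mu f → IntegrableOn (fun y => g y * f y) Q.toSet := by
    intro f hf
    refine ⟨(hg.mul (hf.aestronglyMeasurable hmu)).restrict, ?_⟩
    refine lt_of_eq_of_lt ?_ ((hle f hf).trans_lt (ENNReal.mul_lt_top hC.lt_top hf.2))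
    simp_rw [enorm_mul]
  have hmem : ∀ f : Lp ℂ (ENNReal.ofReal p) (powMeasure p mu), MemLpw p mu f := fun f => Lp.memLp f
  have hcongr : ∀ {u v : Rd d → ℂ}, u =ᵐ[powMeasure p mu] v → avg u Q = avg v Q := fun huv => by
    rw [avg, avg, setAverage_eq, setAverage_eq,
      integral_congr_ae (ae_restrict_of_ae ((hmu.absolutelyContinuous p).ae_le huv))]
  let ℓ : Lp ℂ (ENNReal.ofReal p) (powMeasure p mu) →ₗ[ℂ] ℂ :=
    { toFun := fun f => avg (fun y => g y * f y) Q
      map_add' := fun u v => by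
        rw [← avg_add (hint u (hmem u)) (hint v (hmem v))]
        refine hcongr ?_
        filter_upwards [Lp.coeFn_add u v] with x hx
        rw [hx, Pi.add_apply, mul_add]
      map_smul' := fun z u => by
        rw [RingHom.id_apply, smul_eq_mul, ← avg_const_mul]
        refine hcongr ?_
        filter_upwards [Lp.coeFn_smul z u] with x hx
        rw [hx, Pi.smul_apply, smul_eq_mul, mul_left_comm] }
  have hCv : C / volume Q.toSet ≠ ∞ := ENNReal.div_ne_top hC Q.volume_ne_zero
  refine ⟨ℓ.mkContinuous (C / volume Q.toSet).toReal fun f => ?_, fun f => rfl⟩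
  have h1 : ‖ℓ f‖ₑ ≤ C / volume Q.toSet * ‖f‖ₑ := by
    refine (enorm_avg_le _ Q).trans ?_
    simp_rw [enorm_mul]
    rw [Lp.enorm_def, ENNReal.mul_comm_div, ← mul_div_assoc]
    gcongr
    exact hle f (hmem f)
  rw [← ENNReal.ofReal_toReal hCv, ← ofReal_norm, ← ofReal_norm,
    ← ENNReal.ofReal_mul ENNReal.toReal_nonneg] at h1
  exact (ENNReal.ofReal_le_ofReal_iff (by positivity)).1 h1

lemma exists_avg_clm_one (h : BloomSetting p q K γ W mu lam b S E) (Q : Cube d)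
    [Fact (1 ≤ ENNReal.ofReal p)] :
    ∃ ℓ : Lp ℂ (ENNReal.ofReal p) (powMeasure p mu) →L[ℂ] ℂ,
      ∀ f : Lp ℂ (ENNReal.ofReal p) (powMeasure p mu), ℓ f = avg f Q := by
  obtain ⟨C, hC, hle⟩ := h.exists_setLIntegral_le Q
  obtain ⟨ℓ, hℓ⟩ := exists_avg_clm h.weight_left (g := fun _ => 1)
    aestronglyMeasurable_const (Q := Q) hC (by simpa using hle)
  exact ⟨ℓ, fun f => by simpa using hℓ f⟩

lemma exists_avg_clm_sub (h : BloomSetting p q K γ W mu lam b S E) {Q : Cube d} (hQ : Q ∈ S)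
    [Fact (1 ≤ ENNReal.ofReal p)] :
    ∃ ℓ : Lp ℂ (ENNReal.ofReal p) (powMeasure p mu) →L[ℂ] ℂ,
      ∀ f : Lp ℂ (ENNReal.ofReal p) (powMeasure p mu),
        ℓ f = avg (fun y => (b y - avg b Q) * f y) Q := by
  obtain ⟨C, hC, hle⟩ := h.exists_setLIntegral_mul_le hQ
  exact exists_avg_clm h.weight_left
    (h.locallyIntegrable.aestronglyMeasurable.sub aestronglyMeasurable_const) hC hle

lemma memLpw_indicator_one (h : BloomSetting p q K γ W mu lam b S E) (Q : Cube d) :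
    MemLpw q lam (Q.toSet.indicator fun _ => 1) :=
  memLp_indicator_const _ Q.measurableSet_toSet _ (Or.inr (h.pair_right.ne_top Q))

lemma memLpw_indicator_sub (h : BloomSetting p q K γ W mu lam b S E) {Q : Cube d} (hQ : Q ∈ S) :
    MemLpw q lam (Q.toSet.indicator fun x => b x - avg b Q) := by
  have hq : 0 < q := zero_lt_one.trans h.one_lt_right
  refine ⟨((h.locallyIntegrable.aestronglyMeasurable.sub aestronglyMeasurable_const).mono_ac
    (powMeasure_ac q lam)).indicator Q.measurableSet_toSet, ?_⟩
  have h1 := h.bound.indicator_rpow_ne_top h.pair_left h.pair_right h.locallyIntegrable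
    h.bound_ne_top hQ
  have h2 := normLpw_eq (w := lam) hq (Q.toSet.indicator fun x => b x - avg b Q)
  simp_rw [enorm_indicator_eq_indicator_enorm] at h2
  exact (h2.trans_ne h1).lt_top

lemma memLpw_indicator_norm_sub (h : BloomSetting p q K γ W mu lam b S E) {Q : Cube d}
    (hQ : Q ∈ S) : MemLpw q lam (Q.toSet.indicator fun x => (‖b x - avg b Q‖ : ℂ)) := by
  refine MemLp.mono (h.memLpw_indicator_sub hQ) ?_ (Eventually.of_forall fun x => ?_)
  · exact ((Complex.continuous_ofReal.comp_aestronglyMeasurable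
      (h.locallyIntegrable.aestronglyMeasurable.sub aestronglyMeasurable_const).norm).mono_ac
      (powMeasure_ac q lam)).indicator Q.measurableSet_toSet
  · by_cases hx : x ∈ Q.toSet <;> simp [hx]

lemma exists_rank_one [Fact (1 ≤ ENNReal.ofReal p)] [Fact (1 ≤ ENNReal.ofReal q)]
    (ℓ : Lp ℂ (ENNReal.ofReal p) (powMeasure p mu) →L[ℂ] ℂ) {v : Rd d → ℂ}
    (hv : MemLpw q lam v) :
    ∃ A : Lp ℂ (ENNReal.ofReal p) (powMeasure p mu) →L[ℂ]
        Lp ℂ (ENNReal.ofReal q) (powMeasure q lam),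
      IsCompactOperator A ∧ ∀ f, A f =ᵐ[powMeasure q lam] fun x => ℓ f * v x := by
  refine ⟨ℓ.smulRight (MemLp.toLp v hv), ?_, fun f => ?_⟩
  · have h1 : IsCompactOperator ℓ := isCompactOperator_of_locallyCompactSpace_dom ℓ
    exact h1.clm_comp (ContinuousLinearMap.toSpanSingleton ℂ (MemLp.toLp v hv))
  · filter_upwards [Lp.coeFn_smul (ℓ f) (MemLp.toLp v hv), MemLp.coeFn_toLp hv] with x h1 h2
    rw [ContinuousLinearMap.smulRight_apply, h1, Pi.smul_apply, h2, smul_eq_mul]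

/-- A series of compact operators over the sparse family, dominated by the majorants of the
sparse commutator and of its adjoint, is compact. -/
theorem isCompactFrom (h : BloomSetting p q K γ W mu lam b S E)
    (htrunc : ∀ ε : ℝ≥0∞, ε ≠ 0 → ∃ k₀ : ℝ, 0 < k₀ ∧
      OscFormBound p q.conjExponent b (powMeasure (-p.conjExponent) mu)
        (powMeasure q lam) (truncated S k₀) ε ∧
      OscFormBound q.conjExponent p b (powMeasure q lam)
        (powMeasure (-p.conjExponent) mu) (truncated S k₀) ε)
    {A : (Rd d → ℂ) → Rd d → ℂ} {u : Cube d → (Rd d → ℂ) → Rd d → ℂ}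
    [Fact (1 ≤ ENNReal.ofReal p)] [Fact (1 ≤ ENNReal.ofReal q)]
    (hu : ∀ Q ∈ S, ∃ T : Lp ℂ (ENNReal.ofReal p) (powMeasure p mu) →L[ℂ]
        Lp ℂ (ENNReal.ofReal q) (powMeasure q lam), IsCompactOperator T ∧
      ∀ f : Lp ℂ (ENNReal.ofReal p) (powMeasure p mu), T f =ᵐ[powMeasure q lam] u Q f)
    (hmaj : ∀ Q ∈ S, ∀ f, MemLpw p mu f → ∀ x,
      ‖u Q f x‖ₑ ≤ commMaj b f Q x + adjMaj b f Q x)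
    (hA : ∀ f, MemLpw p mu f → ∀ᵐ x ∂(volume : Measure (Rd d)), A f x = ∑' Q : S, u Q f x) :
    IsCompactFrom p q h.one_lt_left h.one_lt_right mu lam A := by
  classical
  have := h.sparse.countable.to_subtype
  have hq0 : 0 < q := zero_lt_one.trans h.one_lt_right
  choose! T hT hTu using hu
  have hmem : ∀ f : Lp ℂ (ENNReal.ofReal p) (powMeasure p mu), MemLpw p mu f := fun f => Lp.memLp f
  have hae : ∀ f : Lp ℂ (ENNReal.ofReal p) (powMeasure p mu), ∀ᵐ x ∂powMeasure q lam,
      ∀ Q : S, T Q f x = u Q f x := fun f => ae_all_iff.2 fun Q => hTu Q Q.2 f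
  have hmaj' : ∀ f : Lp ℂ (ENNReal.ofReal p) (powMeasure p mu), ∀ᵐ x ∂powMeasure q lam,
      ∀ Q : S, ‖T Q f x‖ₑ ≤ commMaj b f Q x + adjMaj b f Q x := fun f => by
    filter_upwards [hae f] with x hx Q
    rw [hx Q]
    exact hmaj Q Q.2 f (hmem f) x
  have key : ∃ T₀ : Lp ℂ (ENNReal.ofReal p) (powMeasure p mu) →L[ℂ]
      Lp ℂ (ENNReal.ofReal q) (powMeasure q lam), IsCompactOperator T₀ ∧
      ∀ f, T₀ f =ᵐ[powMeasure q lam] fun x => ∑' Q : S, T Q f x := by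
    refine exists_isCompactOperator_tsum (fun Q : S => T Q) (fun Q => hT Q Q.2)
      (fun f => ?_) (fun ε hε => ?_)
    · filter_upwards [hmaj' f, (powMeasure_ac q lam).ae_le (h.ae_tsum_ne_top (hmem f))] with x h1 h2
      refine (tsum_enorm_ne_top_iff_summable_norm.1
        (ne_top_of_le_ne_top ?_ (ENNReal.tsum_le_tsum h1))).of_norm
      rw [ENNReal.tsum_add]
      exact ENNReal.add_ne_top.2 h2.2
    -- The finite set consists of the cubes removed by the truncation. The tail over the others is
    -- bounded by the two truncated forms, `ε / 2` for each.
    · obtain ⟨k₀, hk₀, hb₁, hb₂⟩ := htrunc (ε / 2) (ENNReal.half_pos hε).ne'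
      have hTS : truncated S k₀ ⊆ S := Set.sdiff_subset
      have hfin := h.sparse.finite_sdiff_truncated hk₀
      refine ⟨(hfin.preimage Subtype.coe_injective.injOn).toFinset, fun f => ?_⟩
      set t : Finset S := (hfin.preimage Subtype.coe_injective.injOn).toFinset with ht
      have hmem_t : ∀ Q : {Q : S // Q ∉ t}, (Q : Cube d) ∈ truncated S k₀ := fun Q => by
        by_contra hcon
        exact Q.2 ((Set.Finite.mem_toFinset _).2 ⟨Q.1.2, hcon⟩)
      have hle : ∀ H : Cube d → ℝ≥0∞, ∑' Q : {Q : S // Q ∉ t}, H Q ≤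
          ∑' Q : truncated S k₀, H Q := fun H =>
        ENNReal.tsum_comp_le_tsum_of_injective
          (f := fun Q : {Q : S // Q ∉ t} => (⟨Q, hmem_t Q⟩ : truncated S k₀))
          (fun P Q hPQ => by simpa [Subtype.ext_iff] using hPQ)
          fun Q : truncated S k₀ => H Q
      rw [eLpNorm_eq_lintegral_rpow_enorm_toReal (by simpa using hq0) ENNReal.ofReal_ne_top,
        ENNReal.toReal_ofReal hq0.le]
      calc (∫⁻ x, ‖∑' Q : {Q : S // Q ∉ t}, ‖T Q f x‖ₑ‖ₑ ^ q ∂powMeasure q lam) ^ (1 / q)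
          ≤ (∫⁻ x, ((fun x => ∑' Q : truncated S k₀, commMaj b f Q x) +
              fun x => ∑' Q : truncated S k₀, adjMaj b f Q x) x ^ q ∂powMeasure q lam) ^ (1 / q) := by
            gcongr ?_ ^ (1 / q)
            refine lintegral_mono_ae ?_
            filter_upwards [hmaj' f] with x hx
            gcongr
            rw [enorm_eq_self, Pi.add_apply]
            refine (ENNReal.tsum_le_tsum fun Q : {Q : S // Q ∉ t} => hx Q).trans ?_
            rw [ENNReal.tsum_add]
            exact add_le_add (hle fun Q => commMaj b f Q x) (hle fun Q => adjMaj b f Q x)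
        _ ≤ _ := by
            have := (h.sparse.countable.mono hTS).to_subtype
            refine ENNReal.lintegral_Lp_add_le ?_ ?_ h.one_lt_right.le
            · exact (AEMeasurable.tsum fun Q : truncated S k₀ => h.aemeasurable_commMaj f Q).mono_ac
                (powMeasure_ac q lam)
            · exact AEMeasurable.tsum fun Q : truncated S k₀ =>
                (measurable_const.indicator Q.1.measurableSet_toSet).aemeasurable
        _ ≤ ε / 2 * normLpw p mu f + ε / 2 * normLpw p mu f :=
            add_le_add (h.lintegral_tsum_commMaj_le (hmem f) hTS hb₁)
              (h.lintegral_tsum_adjMaj_le (hmem f) hTS hb₂)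
        _ = ε * ‖f‖ₑ := by rw [← add_mul, ENNReal.add_halves, Lp.enorm_def, normLpw]
  obtain ⟨T₀, hT₀, hT₀f⟩ := key
  refine ⟨T₀, hT₀, fun f => (h.weight_right.absolutelyContinuous q).ae_le ?_⟩
  filter_upwards [hT₀f f, hae f, (powMeasure_ac q lam).ae_le (hA f (hmem f))] with x h1 h2 h3
  rw [h1, h3]
  exact tsum_congr h2

theorem isCompactFrom_sparseComm (h : BloomSetting p q K γ W mu lam b S E)
    (htrunc : ∀ ε : ℝ≥0∞, ε ≠ 0 → ∃ k₀ : ℝ, 0 < k₀ ∧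
      OscFormBound p q.conjExponent b (powMeasure (-p.conjExponent) mu)
        (powMeasure q lam) (truncated S k₀) ε ∧
      OscFormBound q.conjExponent p b (powMeasure q lam)
        (powMeasure (-p.conjExponent) mu) (truncated S k₀) ε) :
    IsCompactFrom p q h.one_lt_left h.one_lt_right mu lam (sparseComm b S) := by
  have : Fact (1 ≤ ENNReal.ofReal p) := ⟨ENNReal.one_le_ofReal.2 h.one_lt_left.le⟩
  have : Fact (1 ≤ ENNReal.ofReal q) := ⟨ENNReal.one_le_ofReal.2 h.one_lt_right.le⟩
  refine h.isCompactFrom htrunc (u := fun Q f => commTerm b f Q) (fun Q hQ => ?_)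
    (fun Q _ f _ x => (enorm_commTerm_le b f Q x).trans le_self_add)
    (fun f _ => Eventually.of_forall fun x => rfl)
  obtain ⟨ℓ, hℓ⟩ := h.exists_avg_clm_one Q
  obtain ⟨A, hA, hAf⟩ := exists_rank_one ℓ (h.memLpw_indicator_norm_sub hQ)
  refine ⟨A, hA, fun f => ?_⟩
  filter_upwards [hAf f] with x hx
  rw [hx, hℓ, commTerm]
  by_cases hxQ : x ∈ Q.toSet <;> simp [hxQ, mul_comm]

/-- Each term has rank at most two: it is `(b - ⟨b⟩_Q) 1_Q` times the functional `⟨f⟩_Q`, minus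
`1_Q` times the functional `⟨(b - ⟨b⟩_Q) f⟩_Q`. -/
theorem isCompactFrom_commSparseOp (h : BloomSetting p q K γ W mu lam b S E)
    (htrunc : ∀ ε : ℝ≥0∞, ε ≠ 0 → ∃ k₀ : ℝ, 0 < k₀ ∧
      OscFormBound p q.conjExponent b (powMeasure (-p.conjExponent) mu)
        (powMeasure q lam) (truncated S k₀) ε ∧
      OscFormBound q.conjExponent p b (powMeasure q lam)
        (powMeasure (-p.conjExponent) mu) (truncated S k₀) ε) :
    IsCompactFrom p q h.one_lt_left h.one_lt_right mu lam (commSparseOp b S) := by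
  have : Fact (1 ≤ ENNReal.ofReal p) := ⟨ENNReal.one_le_ofReal.2 h.one_lt_left.le⟩
  have : Fact (1 ≤ ENNReal.ofReal q) := ⟨ENNReal.one_le_ofReal.2 h.one_lt_right.le⟩
  refine h.isCompactFrom htrunc
    (u := fun Q f x => b x * sparseTerm f Q x - sparseTerm (fun y => b y * f y) Q x)
    (fun Q hQ => ?_)
    (fun Q hQ f hf x =>
      enorm_mul_sparseTerm_sub_le (h.integrableOn hf Q) (h.integrableOn_mul hf hQ) x)
    (fun f hf => ?_)
  · obtain ⟨ℓ₁, hℓ₁⟩ := h.exists_avg_clm_one Q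
    obtain ⟨ℓ₂, hℓ₂⟩ := h.exists_avg_clm_sub hQ
    obtain ⟨A₁, hA₁, hAf₁⟩ := exists_rank_one ℓ₁ (h.memLpw_indicator_sub hQ)
    obtain ⟨A₂, hA₂, hAf₂⟩ := exists_rank_one ℓ₂ (h.memLpw_indicator_one Q)
    refine ⟨A₁ - A₂, hA₁.sub hA₂, fun f => ?_⟩
    have hf : MemLpw p mu f := Lp.memLp f
    filter_upwards [hAf₁ f, hAf₂ f, Lp.coeFn_sub (A₁ f) (A₂ f)] with x h1 h2 h3
    rw [sub_apply, h3, Pi.sub_apply, h1, h2, hℓ₁, hℓ₂, sparseTerm, sparseTerm]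
    by_cases hxQ : x ∈ Q.toSet
    · simp only [Set.indicator_of_mem hxQ]
      rw [avg_mul_eq (h.integrableOn hf Q) (h.integrableOn_mul hf hQ)]
      ring
    · simp [hxQ]
  · filter_upwards [(h.wellDefinedAt hf).2] with x hx
    exact commSparseOp_eq_tsum hx.1 hx.2.1

end BloomSetting

/-! ### Assembly -/

/-- The standing assumptions hold for symbols of vanishing mean oscillation, and the forms over the
truncated families are small. -/
theorem MemVMO.exists_bloomSetting (hd : 0 < d) {p q α : ℝ} (hp : 1 < p) (hpq : p ≤ q)
    (hα : α / d = 1 / p - 1 / q) {mu lam : Rd d → ℝ} (hmu : MemApp p mu) (hlam : MemApp q lam)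
    {b : Rd d → ℂ} (hb : MemVMO α (bloomWeight p q mu lam) b) {S : Set (Cube d)}
    (hS : IsSparse S) :
    (∃ K γ W E, BloomSetting p q K γ W mu lam b S E) ∧
    ∀ ε : ℝ≥0∞, ε ≠ 0 → ∃ k₀ : ℝ, 0 < k₀ ∧
      OscFormBound p q.conjExponent b (powMeasure (-p.conjExponent) mu)
        (powMeasure q lam) (truncated S k₀) ε ∧
      OscFormBound q.conjExponent p b (powMeasure q lam)
        (powMeasure (-p.conjExponent) mu) (truncated S k₀) ε := by
  have hq : 1 < q := hp.trans_le hpq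
  have hcp := Real.HolderConjugate.conjExponent hp
  have hcq := Real.HolderConjugate.conjExponent hq
  obtain ⟨γ, E, hE⟩ := hS.exists_sparseSets
  set K := max (appConst p mu) (appConst q lam)
  have hK : K ≠ ∞ := (max_lt hmu.2 hlam.2).ne
  have hA := (hmu.apPair hp).mono (le_max_left _ _) hK
  have hC := (hlam.apPair hq).mono (le_max_right _ _) hK
  have hpq' : q.conjExponent ≤ p.conjExponent := by
    have h1 := hcp.inv_add_inv_eq_one
    have h2 := hcq.inv_add_inv_eq_one
    have h3 := inv_anti₀ hcp.pos hpq
    exact (inv_le_inv₀ hcp.symm.pos hcq.symm.pos).1 (by linarith)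
  have hB : ∀ P : Cube d, oscInt b P ≤ (⨆ Q, osc α (bloomWeight p q mu lam) b Q) *
      (powMeasure p mu P.toSet ^ (1 / p) *
        powMeasure (-q.conjExponent) lam P.toSet ^ (1 / q.conjExponent)) := fun P =>
    (oscInt_le_osc hp hpq hα hmu hlam b P).trans
      (mul_le_mul_left (le_iSup (fun Q => osc α (bloomWeight p q mu lam) b Q) P) _)
  have hV := fun ε hε => MemVMO.exists_oscInt_le hp hpq hα hmu hlam hb (ε := ε) hε
  have hB' : ∀ P : Cube d, oscInt b P ≤ (⨆ Q, osc α (bloomWeight p q mu lam) b Q) *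
      (powMeasure (-q.conjExponent) lam P.toSet ^ (1 / q.conjExponent) *
        powMeasure p mu P.toSet ^ (1 / p)) := fun P => (hB P).trans_eq (by ring)
  have hV' : ∀ ε : ℝ≥0∞, ε ≠ 0 → ∃ R : ℝ, 0 < R ∧ ∀ P : Cube d,
      oscInt b P ≤ ε * (powMeasure (-q.conjExponent) lam P.toSet ^ (1 / q.conjExponent) *
        powMeasure p mu P.toSet ^ (1 / p)) ∨ (P.side ∈ Set.Icc R⁻¹ R ∧ P.distZero ≤ R) :=
    fun ε hε => by
      obtain ⟨R, hR, h⟩ := hV ε hε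
      exact ⟨R, hR, fun P => (h P).imp_left fun h' => h'.trans_eq (by ring)⟩
  obtain ⟨W₁, hW₁t, hW₁⟩ := exists_tsum_oscForm_le hA hC hpq hb.1.1 hb.1.2.ne hB hE
  -- The adjoint form is the same theorem for the exponents `q' ≤ p'` and the exchanged pairs.
  obtain ⟨W₂, hW₂t, hW₂⟩ :=
    exists_tsum_oscForm_le hC.symm hA.symm hpq' hb.1.1 hb.1.2.ne hB' hE
  refine ⟨⟨K, γ, W₁ + W₂, E, hp, hq, hmu.1, hlam.1, hA, hC, hb.1.1, hE,
    fun φ ψ hφ hψ => (hW₁ φ ψ hφ hψ).trans ?_, fun φ ψ hφ hψ => (hW₂ φ ψ hφ hψ).trans ?_,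
    ENNReal.add_ne_top.2 ⟨hW₁t, hW₂t⟩⟩, fun ε hε => ?_⟩
  · gcongr; exact le_self_add
  · gcongr; exact le_add_self
  · obtain ⟨k₁, hk₁, h₁⟩ :=
      exists_truncated_tsum_oscForm_le hd hA hC hpq hb.1.1 hb.1.2.ne hB hV hE hε
    obtain ⟨k₂, hk₂, h₂⟩ := exists_truncated_tsum_oscForm_le hd hC.symm hA.symm hpq' hb.1.1
      hb.1.2.ne hB' hV' hE hε
    exact ⟨max k₁ k₂, lt_max_of_lt_left hk₁,
      h₁ _ (truncated_subset_truncated hk₁ (le_max_left _ _)),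
      h₂ _ (truncated_subset_truncated hk₂ (le_max_right _ _))⟩

end BloomSparse

end

theorem proposition5p2 {d : ℕ} (hd : 0 < d) (p q α : ℝ) (hp : 1 < p) (hpq : p ≤ q)
    (hα : α / d = 1 / p - 1 / q) (mu lam : Rd d → ℝ) (hmu : MemApp p mu) (hlam : MemApp q lam)
    (b : Rd d → ℂ) (hb : MemVMO α (bloomWeight p q mu lam) b)
    (S : Set (Cube d)) (hS : IsSparse S) :
    (∀ f : Rd d → ℂ, MemLpw p mu f → WellDefinedAt b S f) ∧
    (∀ ε : ℝ, 0 < ε → ∃ k₀ : ℝ, 0 < k₀ ∧ ∀ k : ℝ, k₀ ≤ k → ∀ f : Rd d → ℂ, MemLpw p mu f →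
      normLpw q lam (sparseComm b (truncated S k) f) +
          normLpw q lam (sparseCommAdj b (truncated S k) f) ≤
        ENNReal.ofReal ε * normLpw p mu f) ∧
    IsCompactFrom p q hp (hp.trans_le hpq) mu lam (commSparseOp b S) ∧
    IsCompactFrom p q hp (hp.trans_le hpq) mu lam (sparseComm b S) := by
  obtain ⟨⟨K, γ, W, E, h⟩, htrunc⟩ := MemVMO.exists_bloomSetting hd hp hpq hα hmu hlam hb hS
  refine ⟨fun f hf => h.wellDefinedAt hf, fun ε hε => ?_, h.isCompactFrom_commSparseOp htrunc,
    h.isCompactFrom_sparseComm htrunc⟩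
  obtain ⟨k₀, hk₀, h₁, h₂⟩ := htrunc (ENNReal.ofReal ε / 2)
    (ENNReal.half_pos (ENNReal.ofReal_pos.2 hε).ne').ne'
  refine ⟨k₀, hk₀, fun k hk f hf => ?_⟩
  have hT : truncated S k ⊆ truncated S k₀ := truncated_subset_truncated hk₀ hk
  have hTS : truncated S k ⊆ S := Set.sdiff_subset
  refine (add_le_add (h.normLpw_sparseComm_le hf hTS (h₁.mono hT))
    (h.normLpw_sparseCommAdj_le hf hTS (h₂.mono hT))).trans_eq ?_
  rw [← add_mul, ENNReal.add_halves]
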